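/- Let $m\ge 2$, $d\ge 1$ be integers and $s>\frac{(m-1)d}{2}+\frac12$. Let $\sigma$ be a finite positive Borel measure on $\mathbb{R}^{md}$, supported in the closed unit ball centred at the origin, whose Fourier transform $\widehat{\mathrm d\sigma}(\xi)=\int e^{-2\pi i y\cdot\xi}\,\mathrm d\sigma(y)$ satisfies $|\widehat{\mathrm d\sigma}(\xi)|\le A(1+|\xi|)^{-s}$ for all $\xi\in\mathbb{R}^{md}$, for some constant $A$. Writing $y=(y_1,\dots,y_m)$ with $y_i\in\mathbb{R}^d$, put $$\mathrm M_\sigma(f_1,\dots,f_m)(x)=\sup_{t>0}\Big|\int\prod_{i=1}^m f_i(x-ty_i)\,\mathrm d\sigma(y)\Big|,\qquad x\in\mathbb{R}^d.$$ Then there is a constant $C<\infty$, independent of $f_1,\dots,f_m$, such that for all $f_1,\dots,f_m\in L^2(\mathbb{R}^d)$ (complex-valued; in particular for all Schwartz functions) the integrals defining $\mathrm M_\sigma(f_1,\dots,f_m)(x)$ converge absolutely for almost every $x$ and every $t>0$, and $$\|\mathrm M_\sigma(f_1,\dots,f_m)\|_{L^{2/m}(\mathbb{R}^d)}\le C\prod_{i=1}^m\|f_i\|_{L^2(\mathbb{R}^d)}.$$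 -/

import Mathlib

open MeasureTheory
open scoped ENNReal NNReal RealInnerProductSpace

/-- The Euclidean space `ℝ^{md}`, whose points are written `y = (y₁, …, y_m)` with `y_i ∈ ℝ^d`;
its norm is `|y| = (|y₁|² + ⋯ + |y_m|²)^{1/2}`. -/
abbrev ProdSpace (m d : ℕ) : Type := PiLp 2 (fun _ : Fin m => EuclideanSpace ℝ (Fin d))

/-- The Fourier transform `∫ e^{-2πi y·ξ} dσ(y)` of a measure on `ℝ^{md}`. -/
noncomputable def fourierMeasure {m d : ℕ} (σ : Measure (ProdSpace m d)) (ξ : ProdSpace m d) : ℂ :=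
  ∫ y, Complex.exp (-(2 * Real.pi * ⟪y, ξ⟫ : ℝ) * Complex.I) ∂σ

/-- The decay condition `|σ^(ξ)| ≲ (1 + |ξ|)^{-s}`. -/
def HasFourierDecay {m d : ℕ} (σ : Measure (ProdSpace m d)) (s : ℝ) : Prop :=
  ∃ A : ℝ, ∀ ξ : ProdSpace m d, ‖fourierMeasure σ ξ‖ ≤ A * (1 + ‖ξ‖) ^ (-s)

/-- The multilinear average `A_σ(F)(x, t) = ∫ ∏ᵢ fᵢ(x - t yᵢ) dσ(y)`. -/
noncomputable def multAverage {m d : ℕ} (σ : Measure (ProdSpace m d))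
    (f : Fin m → EuclideanSpace ℝ (Fin d) → ℂ) (x : EuclideanSpace ℝ (Fin d)) (t : ℝ) : ℂ :=
  ∫ y, ∏ i, f i (x - t • y i) ∂σ

/-- The multilinear maximal average `M_σ(F)(x) = sup_{t > 0} |A_σ(F)(x, t)|`, a supremum
in `[0, ∞]`. -/
noncomputable def multMaximal {m d : ℕ} (σ : Measure (ProdSpace m d))
    (f : Fin m → EuclideanSpace ℝ (Fin d) → ℂ) (x : EuclideanSpace ℝ (Fin d)) : ℝ≥0∞ :=
  ⨆ (t : ℝ) (_ : 0 < t), ‖multAverage σ f x t‖ₑ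

/-! ### Plancherel's identity for the Fourier integral on `L¹ ∩ L²`. -/

section FourierL2

open FourierTransform
open scoped ContDiff

variable {V : Type*} [NormedAddCommGroup V] [InnerProductSpace ℝ V] [FiniteDimensional ℝ V]
  [MeasurableSpace V] [BorelSpace V]

/-! For test functions, cut `t > 0` into blocks `[2^k, 2^(k+1))` and rescale each block to `[1, 2]`.
At unit scale each `f i` splits into a mollification, `lowPart (f i)`, and a remainder. Expanding
the product gives one term for each set `S` of variables that carry the remainder.

If `S` is empty, the average is bounded pointwise, uniformly in `k`, by the product of the
Hardy–Littlewood maximal functions `M f i`. Hölder's inequality and the `L²` bound for `M`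
(`lintegral_hlMaximal_sq_le`) finish this case.

If `S` is nonempty, the engine is the single-scale bound `exists_lintegral_iSup_multAverage_sq_le`:
the `L²` norm of the supremum over `t ∈ [1, 2]` is at most a constant times a product of Sobolev
norms of negative order. By Fourier inversion the average is the restriction to the diagonal of a
function on `ℝ^{md}` with Fourier transform `∏ ĝᵢ(ξᵢ) · σ̂(tξ)`. For frequencies of size `2^j`, and
for squared `L²` norms, restriction to the diagonal costs `2^(j(m-1)d)`, the supremum over `t` costs
`2^j` by a one-dimensional Sobolev inequality, and the decay of `σ̂` gains `2^(-2js)`. The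
hypothesis on `s` says exactly that the total is `2^(-2jδ)` with `δ > 0`. Part of this surplus sums
the shells and the rest becomes the negative Sobolev order.

This is an `L²` bound, whereas the target is `L^(2/m)` and all scales must be summed. For `t ≤ 2`
the average at `x` only sees points within distance `2`, so everything localizes to unit balls.
There the low parts are controlled by the values of `M f i` at any point of the ball, which allows
division by `∏_{i ∉ S} M f i`, and Hölder lowers the exponent from `2` to `2/|S|`. The resulting
`L^(2/|S|)` bounds are summable in `k` (`exists_tsum_lintegral_unitMaximal_bandPiece_le`): the
multiplier of `f - lowPart f` vanishes at frequency `0` and the Sobolev weight decays at infinity,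
so `∑_k lpWeight ε (2^k ξ)` is bounded in `ξ`. The supremum over `k` is at most this sum, and
multiplying back by the maximal functions, which lie in `L²`, yields `L^(2/m)` by Hölder
(`exists_lintegral_bandMaximal_le`).

For general `L²` functions, changing `f i` on a Lebesgue null set could matter, since `σ` may be
singular. Each `|f i|` is therefore dominated everywhere by a lower semicontinuous function of
almost the same norm, infinite where `f i` differs from a fixed measurable representative. Such
functions are recovered from below by mollified truncations, and Fatou's lemma transfers the
estimate. The finiteness of the resulting majorant also gives absolute convergence. -/

/-- The `L²` Fourier transform of a function in `L¹ ∩ L²` is given by the Fourier integral. -/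
theorem fourier_toLp_ae_eq {h : V → ℂ} (h1 : Integrable h) (h2 : MemLp h 2) :
    (𝓕 (h2.toLp h) : Lp ℂ 2 (volume : Measure V)) =ᵐ[volume] 𝓕 h := by
  have hcont : Continuous (𝓕 h) :=
    VectorFourier.fourierIntegral_continuous Real.continuous_fourierChar
      (by exact continuous_inner) h1
  refine ae_eq_of_integral_contDiff_smul_eq ?_ (hcont.locallyIntegrable (μ := volume)) ?_
  · exact (Lp.memLp (𝓕 (h2.toLp h))).locallyIntegrable (by norm_num)
  intro g g_smooth g_cpt
  have hg₁ : HasCompactSupport (Complex.ofRealCLM ∘ g) := g_cpt.comp_left rfl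
  have hg₂ : ContDiff ℝ (⊤ : ℕ∞) (Complex.ofRealCLM ∘ g) := by fun_prop
  set G := hg₁.toSchwartzMap hg₂ with hG
  -- The `L²` transform agrees with the distributional one, so pairing it with `G` moves the
  -- transform onto `G`; the multiplication formula for integrable functions moves it back onto `h`.
  have key := congrArg (fun T => T G) (Lp.fourier_toTemperedDistribution_eq (h2.toLp h))
  simp only [TemperedDistribution.fourier_apply, Lp.toTemperedDistribution_apply] at key
  have e1 : ∫ x, g x • (𝓕 (h2.toLp h) : Lp ℂ 2 (volume : Measure V)) x
      = ∫ x, G x • (𝓕 (h2.toLp h) : Lp ℂ 2 (volume : Measure V)) x := by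
    congr
  rw [e1, ← key]
  have e2 : ∫ x, (𝓕 G) x • (h2.toLp h) x = ∫ x, (𝓕 G) x • h x := by
    apply integral_congr_ae
    filter_upwards [h2.coeFn_toLp] with x hx
    rw [hx]
  rw [e2]
  have := VectorFourier.integral_fourierIntegral_smul_eq_flip (L := innerₗ V)
    Real.continuous_fourierChar continuous_inner (G.integrable (μ := volume)) h1
  rw [flip_innerₗ] at this
  exact this

/-- Plancherel's identity for functions in `L¹ ∩ L²`. -/
theorem lintegral_enorm_fourier_sq {h : V → ℂ} (h1 : Integrable h) (h2 : MemLp h 2) :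
    ∫⁻ ξ, ‖𝓕 h ξ‖ₑ ^ 2 = ∫⁻ x, ‖h x‖ₑ ^ 2 := by
  have hn : ∀ F : Lp ℂ 2 (volume : Measure V), ‖F‖ₑ ^ 2 = ∫⁻ x, ‖F x‖ₑ ^ 2 := by
    intro F
    rw [Lp.enorm_def, eLpNorm_eq_lintegral_rpow_enorm_toReal (by norm_num) (by norm_num)]
    rw [← ENNReal.rpow_natCast, ← ENNReal.rpow_mul]
    simp
  have h3 : ‖(𝓕 (h2.toLp h) : Lp ℂ 2 (volume : Measure V))‖ₑ = ‖h2.toLp h‖ₑ := by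
    rw [← ofReal_norm, ← ofReal_norm, Lp.norm_fourier_eq]
  have h4 := congrArg (fun c => c ^ 2) h3
  simp only [hn] at h4
  refine (lintegral_congr_ae ?_).trans (h4.trans (lintegral_congr_ae ?_))
  · exact (fourier_toLp_ae_eq h1 h2).symm.fun_comp (fun c : ℂ => ‖c‖ₑ ^ 2)
  · exact h2.coeFn_toLp.fun_comp (fun c : ℂ => ‖c‖ₑ ^ 2)

end FourierL2

/-! ### The Hardy–Littlewood maximal function: weak type `(1, 1)` and the `L²` bound. -/

section HardyLittlewood

open Metric

variable {V : Type*} [NormedAddCommGroup V] [InnerProductSpace ℝ V] [FiniteDimensional ℝ V]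
  [MeasurableSpace V] [BorelSpace V]

/-- The centred Hardy–Littlewood maximal function of a nonnegative function. -/
noncomputable def hlMaximal (f : V → ℝ≥0∞) (x : V) : ℝ≥0∞ :=
  ⨆ (r : ℝ) (_ : 0 < r), (volume (ball x r))⁻¹ * ∫⁻ y in ball x r, f y

theorem lintegral_ball_le_hlMaximal (f : V → ℝ≥0∞) (x : V) {r : ℝ} (hr : 0 < r) :
    ∫⁻ y in ball x r, f y ≤ volume (ball x r) * hlMaximal f x := by
  have h : (volume (ball x r))⁻¹ * ∫⁻ y in ball x r, f y ≤ hlMaximal f x :=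
    le_iSup₂ (f := fun (r : ℝ) (_ : 0 < r) => (volume (ball x r))⁻¹ * ∫⁻ y in ball x r, f y) r hr
  rw [← ENNReal.div_eq_inv_mul, ENNReal.div_le_iff (measure_ball_pos _ _ hr).ne' measure_ball_lt_top.ne] at h
  rwa [mul_comm]

/-- An open ball is the increasing union of slightly smaller concentric balls, and each of these
stays inside the radius-`r` ball about any sufficiently near centre. No measurability of `f` is
needed. -/
theorem lowerSemicontinuous_lintegral_ball (f : V → ℝ≥0∞) (r : ℝ) :
    LowerSemicontinuous fun x : V => ∫⁻ y in ball x r, f y := by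
  intro x c hc
  have hmono : Monotone fun n : ℕ => ball x (r - 1 / ((n : ℝ) + 1)) := by
    intro a b hab
    apply ball_subset_ball
    have : (1 : ℝ) / ((b : ℝ) + 1) ≤ 1 / ((a : ℝ) + 1) :=
      Nat.one_div_le_one_div hab
    linarith
  have hU : (⋃ n : ℕ, ball x (r - 1 / ((n : ℝ) + 1))) = ball x r := by
    ext y
    simp only [Set.mem_iUnion, mem_ball]
    constructor
    · rintro ⟨n, hn⟩
      have : (0 : ℝ) < 1 / ((n : ℝ) + 1) := Nat.one_div_pos_of_nat
      linarith
    · intro hy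
      obtain ⟨n, hn⟩ := exists_nat_one_div_lt (sub_pos.2 hy)
      exact ⟨n, by linarith⟩
  have hs : ∫⁻ y in ball x r, f y = ⨆ n : ℕ, ∫⁻ y in ball x (r - 1 / ((n : ℝ) + 1)), f y := by
    rw [← hU, ← withDensity_apply' , Monotone.measure_iUnion hmono]
    simp only [withDensity_apply']
  dsimp only at hc
  rw [hs, gt_iff_lt, lt_iSup_iff] at hc
  obtain ⟨n, hn⟩ := hc
  have hpos : (0 : ℝ) < 1 / ((n : ℝ) + 1) := Nat.one_div_pos_of_nat
  filter_upwards [ball_mem_nhds x hpos] with z hz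
  refine hn.trans_le (lintegral_mono_set (ball_subset_ball' ?_))
  rw [mem_ball, dist_comm] at hz
  linarith

theorem lowerSemicontinuous_hlMaximal (f : V → ℝ≥0∞) : LowerSemicontinuous (hlMaximal f) := by
  apply lowerSemicontinuous_biSup
  intro r hr x c hc
  have hv : ∀ z : V, volume (ball z r) = volume (ball x r) := fun z => by
    rw [Measure.addHaar_ball_center, Measure.addHaar_ball_center volume x]
  dsimp only at hc
  have hne : volume (ball x r) ≠ 0 := (measure_ball_pos _ _ hr).ne'
  have hnt : volume (ball x r) ≠ ∞ := measure_ball_lt_top.ne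
  rw [gt_iff_lt, ← ENNReal.div_eq_inv_mul,
    ENNReal.lt_div_iff_mul_lt (Or.inl hne) (Or.inl hnt)] at hc
  filter_upwards [lowerSemicontinuous_lintegral_ball f r x _ hc] with z hz
  rw [hv z, gt_iff_lt, ← ENNReal.div_eq_inv_mul, ENNReal.lt_div_iff_mul_lt (Or.inl hne) (Or.inl hnt)]
  exact hz

theorem hlMaximal_add_le {f : V → ℝ≥0∞} {g : V → ℝ≥0∞} (hf : Measurable f) (x : V) :
    hlMaximal (f + g) x ≤ hlMaximal f x + hlMaximal g x := by
  refine iSup₂_le fun r hr => ?_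
  simp only [Pi.add_apply]
  rw [lintegral_add_left hf, mul_add]
  exact add_le_add
    (le_iSup₂ (f := fun (r : ℝ) (_ : 0 < r) => (volume (ball x r))⁻¹ * ∫⁻ y in ball x r, f y) r hr)
    (le_iSup₂ (f := fun (r : ℝ) (_ : 0 < r) => (volume (ball x r))⁻¹ * ∫⁻ y in ball x r, g y) r hr)

theorem hlMaximal_le_of_le_const {f : V → ℝ≥0∞} {c : ℝ≥0∞} (hf : ∀ x, f x ≤ c) (x : V) :
    hlMaximal f x ≤ c := by
  refine iSup₂_le fun r hr => ?_
  calc (volume (ball x r))⁻¹ * ∫⁻ y in ball x r, f y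
      ≤ (volume (ball x r))⁻¹ * ∫⁻ y in ball x r, c := by gcongr; exact hf _
    _ = (volume (ball x r) / volume (ball x r)) * c := by
        rw [setLIntegral_const, mul_comm c, ← mul_assoc, div_eq_mul_inv, mul_comm (volume _)]
    _ ≤ 1 * c := by gcongr; exact ENNReal.div_self_le_one
    _ = c := one_mul c

/-- The weak type `(1, 1)` inequality for truncated radii, on a general set. -/
theorem measure_le_of_forall_exists_ball {f : V → ℝ≥0∞} {c : ℝ≥0∞} (hc : c ≠ 0) (hc' : c ≠ ∞)
    {s : Set V} {R : ℝ}
    (hs : ∀ x ∈ s, ∃ r, 0 < r ∧ r ≤ R ∧ c * volume (ball x r) ≤ ∫⁻ y in ball x r, f y) :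
    volume s ≤ (4 : ℝ≥0∞) ^ Module.finrank ℝ V * (c⁻¹ * ∫⁻ y, f y) := by
  choose! r hr hR hcr using hs
  obtain ⟨u, hus, hdisj, hcov⟩ := Vitali.exists_disjoint_subfamily_covering_enlargement_ball
    s (fun x : V => x) r R hR 4 (by norm_num)
  have hcount : u.Countable := hdisj.countable_of_isOpen (fun _ _ => isOpen_ball)
    (fun x hx => nonempty_ball.2 (hr x (hus hx)))
  have := hcount.to_subtype
  calc volume s ≤ volume (⋃ x ∈ u, ball x (4 * r x)) := by
        apply measure_mono
        intro x hx
        obtain ⟨b, hb, hxb⟩ := hcov x hx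
        exact Set.mem_iUnion₂.2 ⟨b, hb, hxb (mem_ball_self (hr x hx))⟩
    _ ≤ ∑' x : u, volume (ball (x : V) (4 * r x)) := measure_biUnion_le _ hcount _
    _ = ∑' x : u, (4 : ℝ≥0∞) ^ Module.finrank ℝ V * volume (ball (x : V) (r x)) := by
        congr 1; ext x
        rw [Measure.addHaar_ball_mul_of_pos _ _ (by norm_num : (0 : ℝ) < 4),
          ← Measure.addHaar_ball_center volume (x : V), ENNReal.ofReal_pow (by norm_num)]
        norm_num
    _ ≤ ∑' x : u, (4 : ℝ≥0∞) ^ Module.finrank ℝ V *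
          (c⁻¹ * ∫⁻ y in ball (x : V) (r x), f y) := by
        gcongr with x
        rw [← ENNReal.div_eq_inv_mul, ENNReal.le_div_iff_mul_le (Or.inl hc) (Or.inl hc'), mul_comm]
        exact hcr x (hus x.2)
    _ = (4 : ℝ≥0∞) ^ Module.finrank ℝ V *
          (c⁻¹ * ∫⁻ y in ⋃ x ∈ u, ball (x : V) (r x), f y) := by
        rw [ENNReal.tsum_mul_left, ENNReal.tsum_mul_left,
          lintegral_biUnion hcount (fun _ _ => measurableSet_ball) hdisj]
    _ ≤ _ := by gcongr; exact Measure.restrict_le_self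

/-- The weak type `(1, 1)` inequality for the Hardy–Littlewood maximal function. -/
theorem volume_lt_hlMaximal_le (f : V → ℝ≥0∞) {c : ℝ≥0∞} (hc : c ≠ 0) (hc' : c ≠ ∞) :
    volume {x | c < hlMaximal f x} ≤
      (4 : ℝ≥0∞) ^ Module.finrank ℝ V * (c⁻¹ * ∫⁻ y, f y) := by
  -- The covering lemma requires bounded radii, so the level set is exhausted by the sets where a
  -- ball of radius at most `n` is a witness.
  let s : ℕ → Set V := fun n =>
    {x | ∃ r : ℝ, 0 < r ∧ r ≤ n ∧ c * volume (ball x r) ≤ ∫⁻ y in ball x r, f y}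
  have hmono : Monotone s := by
    intro a b hab x hx
    simp only [s, Set.mem_ofPred_eq] at hx ⊢
    obtain ⟨r, h1, h2, h3⟩ := hx
    exact ⟨r, h1, h2.trans (by exact_mod_cast hab), h3⟩
  have hsub : {x | c < hlMaximal f x} ⊆ ⋃ n, s n := by
    intro x hx
    simp only [hlMaximal, Set.mem_ofPred_eq, lt_iSup_iff] at hx
    obtain ⟨r, hr, h⟩ := hx
    obtain ⟨n, hn⟩ := exists_nat_ge r
    refine Set.mem_iUnion.2 ⟨n, r, hr, hn, ?_⟩
    rw [← ENNReal.div_eq_inv_mul, ENNReal.lt_div_iff_mul_lt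
      (Or.inl (measure_ball_pos _ _ hr).ne') (Or.inl measure_ball_lt_top.ne)] at h
    exact h.le
  refine (measure_mono hsub).trans ?_
  rw [hmono.measure_iUnion]
  exact iSup_le fun n => measure_le_of_forall_exists_ball (R := n) hc hc' fun x hx => by simpa [s] using hx

/-- The `L²` inequality for the Hardy–Littlewood maximal function of bounded functions. -/
theorem lintegral_hlMaximal_sq_le {f : V → ℝ≥0∞} (hf : Measurable f) {K : ℝ≥0∞} (hK : K ≠ ∞)
    (hfK : ∀ x, f x ≤ K) :
    ∫⁻ x, hlMaximal f x ^ 2 ≤ 8 * (4 : ℝ≥0∞) ^ Module.finrank ℝ V * ∫⁻ x, f x ^ 2 := by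
  set C := (4 : ℝ≥0∞) ^ Module.finrank ℝ V with hC
  have hM : Measurable (hlMaximal f) := (lowerSemicontinuous_hlMaximal f).measurable
  have hMt : ∀ x, hlMaximal f x ≠ ∞ := fun x =>
    ((hlMaximal_le_of_le_const hfK x).trans_lt hK.lt_top).ne
  have e1 : ∫⁻ x, hlMaximal f x ^ 2 = ∫⁻ x, ENNReal.ofReal ((hlMaximal f x).toReal ^ (2 : ℝ)) := by
    congr 1; ext x
    rw [Real.rpow_two, ENNReal.ofReal_pow ENNReal.toReal_nonneg, ENNReal.ofReal_toReal (hMt x)]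
  rw [e1, lintegral_rpow_eq_lintegral_meas_lt_mul volume
    (Filter.Eventually.of_forall fun _ => ENNReal.toReal_nonneg) hM.ennreal_toReal.aemeasurable
    (by norm_num)]
  have key : ∀ t ∈ Set.Ioi (0 : ℝ), volume {a | t < (hlMaximal f a).toReal} *
      ENNReal.ofReal (t ^ ((2 : ℝ) - 1)) ≤
        2 * C * ∫⁻ y, f y * (Set.indicator {p : ℝ × V | ENNReal.ofReal p.1 < 2 * f p.2} 1 (t, y)) := by
    intro t ht
    have ht : 0 < t := ht
    set c := ENNReal.ofReal (t / 2) with hcdef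
    have hc0 : c ≠ 0 := by simp [hcdef, ht]
    have hct : c ≠ ∞ := ENNReal.ofReal_ne_top
    have h2c : ENNReal.ofReal t = 2 * c := by
      rw [hcdef, ← ENNReal.ofReal_ofNat, ← ENNReal.ofReal_mul (by norm_num)]
      congr 1; ring
    -- Truncation at half the height: `f ≤ g + t/2`, so `M f > t` forces `M g > t/2`, and the weak
    -- type bound for `g` only integrates `f` over `{f > t/2}`.
    let g : V → ℝ≥0∞ := Set.indicator {y | c < f y} f
    have hgm : Measurable g := hf.indicator (measurableSet_lt measurable_const hf)
    have hfg : f ≤ g + fun _ => c := by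
      intro y
      by_cases hy : c < f y
      · simp [g, hy]
      · simp only [Pi.add_apply]; exact (not_lt.1 hy).trans le_add_self
    have hsub : {a | t < (hlMaximal f a).toReal} ⊆ {a | c < hlMaximal g a} := by
      intro a ha
      have h1 : 2 * c < hlMaximal f a := by
        rw [← h2c]; exact (ENNReal.ofReal_lt_iff_lt_toReal ht.le (hMt a)).2 ha
      have h2 : hlMaximal f a ≤ hlMaximal g a + c :=
        calc hlMaximal f a ≤ hlMaximal (g + fun _ => c) a := by
              unfold hlMaximal; gcongr; exact hfg _
          _ ≤ hlMaximal g a + hlMaximal (fun _ => c) a := hlMaximal_add_le hgm a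
          _ ≤ _ := by gcongr; exact hlMaximal_le_of_le_const (fun _ => le_rfl) a
      have h3 := h1.trans_le h2
      rw [two_mul] at h3
      exact lt_of_add_lt_add_right h3
    have hpow : ENNReal.ofReal (t ^ ((2 : ℝ) - 1)) = 2 * c := by
      rw [← h2c]; norm_num
    have hgi : ∫⁻ y, g y = ∫⁻ y, f y *
        (Set.indicator {p : ℝ × V | ENNReal.ofReal p.1 < 2 * f p.2} 1 (t, y)) := by
      congr 1; ext y
      have : (ENNReal.ofReal t < 2 * f y) ↔ c < f y := by
        rw [h2c]
        exact ENNReal.mul_lt_mul_iff_right (by norm_num) (by norm_num)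
      by_cases hy : c < f y
      · simp [g, Set.indicator, this, hy]
      · simp [g, Set.indicator, this, hy]
    calc _ ≤ (C * (c⁻¹ * ∫⁻ y, g y)) * (2 * c) := by
          rw [hpow]; gcongr
          exact (measure_mono hsub).trans (volume_lt_hlMaximal_le g hc0 hct)
      _ = 2 * C * (c⁻¹ * c) * ∫⁻ y, g y := by ring
      _ = _ := by rw [ENNReal.inv_mul_cancel hc0 hct, mul_one, hgi]
  have hmeas : MeasurableSet {p : ℝ × V | ENNReal.ofReal p.1 < 2 * f p.2} :=
    measurableSet_lt (by fun_prop) (by fun_prop)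
  have hind : Measurable (Set.indicator {p : ℝ × V | ENNReal.ofReal p.1 < 2 * f p.2}
      (1 : ℝ × V → ℝ≥0∞)) := measurable_one.indicator hmeas
  calc _ ≤ ENNReal.ofReal 2 * ∫⁻ t in Set.Ioi (0 : ℝ), 2 * C * ∫⁻ y, f y *
        (Set.indicator {p : ℝ × V | ENNReal.ofReal p.1 < 2 * f p.2} 1 (t, y)) := by
        gcongr ENNReal.ofReal 2 * ?_
        exact setLIntegral_mono' measurableSet_Ioi key
    _ = ENNReal.ofReal 2 * (2 * C * ∫⁻ y, f y * (2 * f y)) := by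
        rw [lintegral_const_mul' _ _ (by finiteness)]
        congr 2
        -- After Fubini, the heights `t > 0` that see the point `y` form the interval `(0, 2 f y)`,
        -- whose length supplies the second factor of `f y`.
        rw [lintegral_lintegral_swap]
        · congr 1; ext y
          have hy : f y ≠ ∞ := ((hfK y).trans_lt hK.lt_top).ne
          have : ∀ t : ℝ, Set.indicator {p : ℝ × V | ENNReal.ofReal p.1 < 2 * f p.2}
              (1 : ℝ × V → ℝ≥0∞) (t, y) = Set.indicator {t | ENNReal.ofReal t < 2 * f y} 1 t := by
            intro t; rfl
          simp_rw [this]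
          rw [lintegral_const_mul' _ _ hy]
          congr 1
          rw [lintegral_indicator_one (measurableSet_lt (by fun_prop) (by fun_prop)),
            Measure.restrict_apply (measurableSet_lt (by fun_prop) (by fun_prop))]
          have hset : {t | ENNReal.ofReal t < 2 * f y} ∩ Set.Ioi 0
              = Set.Ioo 0 (2 * f y).toReal := by
            ext t
            simp only [Set.mem_inter_iff, Set.mem_ofPred_eq, Set.mem_Ioi, Set.mem_Ioo]
            constructor
            · rintro ⟨h1, h2⟩
              exact ⟨h2, (ENNReal.ofReal_lt_iff_lt_toReal h2.le (by finiteness)).1 h1⟩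
            · rintro ⟨h2, h1⟩
              exact ⟨(ENNReal.ofReal_lt_iff_lt_toReal h2.le (by finiteness)).2 h1, h2⟩
          rw [hset, Real.volume_Ioo, sub_zero, ENNReal.ofReal_toReal (by finiteness)]
        · exact ((hf.comp measurable_snd).mul hind).aemeasurable
    _ = _ := by
        have : ∀ y, f y * (2 * f y) = 2 * f y ^ 2 := fun y => by ring
        simp_rw [this]
        rw [lintegral_const_mul _ (by fun_prop), ENNReal.ofReal_ofNat]
        ring

end HardyLittlewood

/-! ### Decay of Fourier transforms of measures, stable under Schwartz cutoffs and radial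
differentiation. -/

section FourierDecay

open FourierTransform

variable {V : Type*} [NormedAddCommGroup V] [InnerProductSpace ℝ V]

/-- The character `e^{-2πi y·ξ}`. -/
noncomputable def fourierKernel (y ξ : V) : ℂ :=
  Complex.exp (-(2 * Real.pi * ⟪y, ξ⟫ : ℝ) * Complex.I)

theorem continuous_fourierKernel : Continuous fun p : V × V => fourierKernel p.1 p.2 := by
  unfold fourierKernel; fun_prop

@[fun_prop]
theorem Continuous.fourierKernel {X : Type*} [TopologicalSpace X] {f g : X → V}
    (hf : Continuous f) (hg : Continuous g) :
    Continuous fun x => _root_.fourierKernel (f x) (g x) :=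
  continuous_fourierKernel.comp (hf.prodMk hg)

@[simp]
theorem norm_fourierKernel (y ξ : V) : ‖fourierKernel y ξ‖ = 1 := by
  rw [fourierKernel, ← Complex.ofReal_neg, Complex.norm_exp_ofReal_mul_I]

theorem fourierKernel_add_right (y ξ η : V) :
    fourierKernel y (ξ + η) = fourierKernel y ξ * fourierKernel y η := by
  rw [fourierKernel, fourierKernel, fourierKernel, ← Complex.exp_add, inner_add_right]
  congr 1; push_cast; ring

theorem fourierKernel_comm (y ξ : V) : fourierKernel y ξ = fourierKernel ξ y := by
  rw [fourierKernel, fourierKernel, real_inner_comm]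

theorem fourierKernel_add_left (y z ξ : V) :
    fourierKernel (y + z) ξ = fourierKernel y ξ * fourierKernel z ξ := by
  simp only [fourierKernel_comm _ ξ, fourierKernel_add_right]

@[simp]
theorem fourierKernel_zero_right (y : V) : fourierKernel y 0 = 1 := by
  simp [fourierKernel]

theorem fourierKernel_neg_comm (y ξ : V) : fourierKernel (-y) ξ = fourierKernel y (-ξ) := by
  simp [fourierKernel]

theorem one_add_norm_le_mul {W : Type*} [NormedAddCommGroup W] (ξ η : W) : 1 + ‖ξ‖ ≤ (1 + ‖ξ - η‖) * (1 + ‖η‖) := by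
  have h := norm_le_norm_sub_add ξ η
  nlinarith [norm_nonneg (ξ - η), norm_nonneg η]

/-- Peetre's inequality. -/
theorem one_add_norm_sub_rpow_neg_le {W : Type*} [NormedAddCommGroup W] {s : ℝ} (hs : 0 ≤ s)
    (ξ η : W) :
    (1 + ‖ξ - η‖) ^ (-s) ≤ (1 + ‖ξ‖) ^ (-s) * (1 + ‖η‖) ^ s := by
  have h0 : 0 < 1 + ‖ξ‖ := by positivity
  have h1 : 0 < 1 + ‖η‖ := by positivity
  have h2 : 0 < 1 + ‖ξ - η‖ := by positivity
  rw [Real.rpow_neg h2.le, Real.rpow_neg h0.le, inv_mul_eq_div, inv_eq_one_div,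
    div_le_div_iff₀ (by positivity) (by positivity), one_mul, mul_comm, ← Real.mul_rpow h2.le h1.le]
  exact Real.rpow_le_rpow h0.le (one_add_norm_le_mul ξ η) hs

variable [MeasurableSpace V] [BorelSpace V]

section Fourier
variable [FiniteDimensional ℝ V]

theorem fourier_eq_integral_fourierKernel (f : V → ℂ) (ξ : V) :
    𝓕 f ξ = ∫ y, fourierKernel y ξ * f y := by
  rw [Real.fourier_eq]
  congr 1; ext y
  rw [Circle.smul_def, Real.fourierChar_apply, fourierKernel, smul_eq_mul]
  congr 2; push_cast; ring

theorem fourierInv_eq_integral_fourierKernel (f : V → ℂ) (x : V) :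
    𝓕⁻ f x = ∫ ξ, fourierKernel (-x) ξ * f ξ := by
  rw [Real.fourierInv_eq_fourier_neg, fourier_eq_integral_fourierKernel]
  simp only [fourierKernel_comm (-x)]

/-- Fourier inversion for Schwartz functions. -/
theorem SchwartzMap.eq_integral_fourierKernel (f : SchwartzMap V ℂ) (x : V) :
    f x = ∫ ξ, fourierKernel (-x) ξ * 𝓕 (f : V → ℂ) ξ := by
  have h := congrArg (fun g : SchwartzMap V ℂ => g x) 
    (FourierTransform.fourierInv_fourier_eq (F := SchwartzMap V ℂ) f)
  simp only [SchwartzMap.fourierInv_coe, SchwartzMap.fourier_coe] at h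
  rw [← h, fourierInv_eq_integral_fourierKernel]

end Fourier

variable [FiniteDimensional ℝ V]

theorem SchwartzMap.integrable_one_add_norm_rpow_mul (f : SchwartzMap V ℂ) (s : ℝ) :
    Integrable fun x => (1 + ‖x‖) ^ s * ‖f x‖ := by
  obtain ⟨N, hN⟩ := exists_nat_ge s
  have h1 : Integrable fun x => (2 : ℝ) ^ (N - 1) * (‖f x‖ + ‖x‖ ^ N * ‖f x‖) :=
    (f.integrable.norm.add (f.integrable_pow_mul volume N)).const_mul _
  refine h1.mono' ?_ (Filter.Eventually.of_forall fun x => ?_)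
  · have : Continuous fun x : V => (1 + ‖x‖) ^ s :=
      (continuous_const.add continuous_norm).rpow_const
        (fun x => Or.inl (by linarith [norm_nonneg x] : (0 : ℝ) < 1 + ‖x‖).ne')
    exact (this.mul f.continuous.norm).aestronglyMeasurable
  · have hx := norm_nonneg x
    rw [Real.norm_of_nonneg (by positivity)]
    calc (1 + ‖x‖) ^ s * ‖f x‖ ≤ (1 + ‖x‖) ^ N * ‖f x‖ := by
          gcongr
          rw [← Real.rpow_natCast]
          exact Real.rpow_le_rpow_of_exponent_le (by linarith) hN
      _ ≤ (2 ^ (N - 1) * (1 ^ N + ‖x‖ ^ N)) * ‖f x‖ := by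
          gcongr; exact add_pow_le zero_le_one hx N
      _ = _ := by ring

/-- Multiplying a measure by a Schwartz function preserves the decay of its Fourier transform. -/
theorem exists_norm_integral_fourierKernel_mul_schwartz_le {μ : Measure V} [IsFiniteMeasure μ]
    {s A : ℝ} (hs : 0 ≤ s)
    (hA : ∀ ξ, ‖∫ y, fourierKernel y ξ ∂μ‖ ≤ A * (1 + ‖ξ‖) ^ (-s)) (χ : SchwartzMap V ℂ) :
    ∃ B, 0 ≤ B ∧ ∀ ξ, ‖∫ y, fourierKernel y ξ * χ y ∂μ‖ ≤ B * (1 + ‖ξ‖) ^ (-s) := by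
  have hA0 : 0 ≤ A := by
    have := (norm_nonneg _).trans (hA 0)
    simpa using this
  have hint : Integrable fun η => (1 + ‖η‖) ^ s * ‖𝓕 (χ : V → ℂ) η‖ := by
    simpa [SchwartzMap.fourier_coe] using (𝓕 χ).integrable_one_add_norm_rpow_mul s
  refine ⟨A * ∫ η, (1 + ‖η‖) ^ s * ‖𝓕 (χ : V → ℂ) η‖, ?_, fun ξ => ?_⟩
  · have : 0 ≤ ∫ η, (1 + ‖η‖) ^ s * ‖𝓕 (χ : V → ℂ) η‖ :=
      integral_nonneg fun η => by have := norm_nonneg η; positivity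
    positivity
  have hFi : Integrable (𝓕 (χ : V → ℂ)) := by
    rw [← SchwartzMap.fourier_coe]; exact (𝓕 χ).integrable
  -- The transform of `χ μ` is the convolution of the two transforms. Peetre's inequality then moves
  -- the decay from `ξ - η` to `ξ` at the price of `(1 + ‖η‖)^s`, which the rapid decay of `𝓕 χ`
  -- absorbs.
  have e1 : ∫ y, fourierKernel y ξ * χ y ∂μ
      = ∫ η, (𝓕 (χ : V → ℂ) η * ∫ y, fourierKernel y (ξ - η) ∂μ) := by
    calc _ = ∫ y, (∫ η, fourierKernel y (ξ - η) * 𝓕 (χ : V → ℂ) η) ∂μ := by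
          congr 1; ext y
          conv_lhs => rw [χ.eq_integral_fourierKernel y]
          rw [← integral_const_mul]
          congr 1; ext η
          rw [sub_eq_add_neg, fourierKernel_add_right, fourierKernel_neg_comm, mul_assoc]
      _ = ∫ η, ∫ y, fourierKernel y (ξ - η) * 𝓕 (χ : V → ℂ) η ∂μ := by
          apply integral_integral_swap
          have : Integrable (fun p : V × V => (1 : ℂ) * 𝓕 (χ : V → ℂ) p.2) (μ.prod volume) :=
            (integrable_const (1 : ℂ)).mul_prod hFi
          refine this.mono (AEStronglyMeasurable.mul ?_ hFi.aestronglyMeasurable.comp_snd) ?_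
          · exact Continuous.aestronglyMeasurable (by fun_prop)
          · exact Filter.Eventually.of_forall fun p => by simp [Function.uncurry]
      _ = _ := by
          congr 1; ext η
          rw [integral_mul_const, mul_comm]
  rw [e1]
  calc _ ≤ ∫ η, ‖𝓕 (χ : V → ℂ) η‖ * (A * ((1 + ‖ξ‖) ^ (-s) * (1 + ‖η‖) ^ s)) := by
        refine norm_integral_le_of_norm_le ?_ (Filter.Eventually.of_forall fun η => ?_)
        · refine (hint.const_mul (A * (1 + ‖ξ‖) ^ (-s))).congr (Filter.Eventually.of_forall ?_)
          intro η; simp only; ring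
        · rw [norm_mul]
          gcongr
          refine (hA _).trans ?_
          gcongr
          exact one_add_norm_sub_rpow_neg_le hs ξ η
    _ = ∫ η, (A * (1 + ‖ξ‖) ^ (-s)) * ((1 + ‖η‖) ^ s * ‖𝓕 (χ : V → ℂ) η‖) := by
        congr 1; ext η; ring
    _ = _ := by rw [integral_const_mul]; ring

/-- A linear functional, cut off outside the unit ball, as a Schwartz function. -/
theorem exists_schwartz_eq_inner {W : Type*} [NormedAddCommGroup W] [InnerProductSpace ℝ W]
    [FiniteDimensional ℝ W] (b : W) :
    ∃ χ : SchwartzMap W ℂ, ∀ y ∈ Metric.closedBall (0 : W) 1, χ y = (⟪y, b⟫ : ℝ) := by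
  let φ : ContDiffBump (0 : W) := ⟨1, 2, one_pos, one_lt_two⟩
  have h1 : HasCompactSupport fun y : W => ((φ y * ⟪y, b⟫ : ℝ) : ℂ) :=
    (φ.hasCompactSupport.mul_right (f' := fun y => ⟪y, b⟫)).comp_left
      (g := fun r : ℝ => (r : ℂ)) Complex.ofReal_zero
  have h2 : ContDiff ℝ (⊤ : ℕ∞) fun y : W => ((φ y * ⟪y, b⟫ : ℝ) : ℂ) :=
    Complex.ofRealCLM.contDiff.comp (φ.contDiff.mul (contDiff_id.inner ℝ contDiff_const))
  refine ⟨h1.toSchwartzMap h2, fun y hy => ?_⟩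
  simp [φ.one_of_mem_closedBall hy]

/-- The radial derivative of the Fourier transform of a compactly supported measure inherits the
decay of the Fourier transform, up to one power. -/
theorem exists_hasDerivAt_integral_fourierKernel {μ : Measure V} [IsFiniteMeasure μ]
    (hsupp : μ (Metric.closedBall (0 : V) 1)ᶜ = 0) {s A : ℝ} (hs : 0 ≤ s)
    (hA : ∀ ξ, ‖∫ y, fourierKernel y ξ ∂μ‖ ≤ A * (1 + ‖ξ‖) ^ (-s)) :
    ∃ a' : ℝ → V → ℂ, Continuous (Function.uncurry a') ∧
      (∀ t ξ, HasDerivAt (fun t : ℝ => ∫ y, fourierKernel y (t • ξ) ∂μ) (a' t ξ) t) ∧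
      ∃ B, 0 ≤ B ∧ ∀ t, 1 ≤ t → ∀ ξ, ‖a' t ξ‖ ≤ B * (1 + ‖ξ‖) ^ (1 - s) := by
  have hae : ∀ᵐ y ∂μ, y ∈ Metric.closedBall (0 : V) 1 := by
    rw [ae_iff]; exact hsupp
  let b := stdOrthonormalBasis ℝ V
  choose χ hχ using fun i => exists_schwartz_eq_inner (b i)
  choose B hB0 hB using fun i => exists_norm_integral_fourierKernel_mul_schwartz_le hs hA (χ i)
  let F : Fin (Module.finrank ℝ V) → V → ℂ := fun i ξ => ∫ y, fourierKernel y ξ * χ i y ∂μ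
  have hχb : ∀ i, ∃ C, ∀ y, ‖χ i y‖ ≤ C := fun i => by
    obtain ⟨C, -, hC⟩ := (χ i).decay 0 0
    exact ⟨C, fun y => by simpa using hC y⟩
  have hFc : ∀ i, Continuous (F i) := by
    intro i
    obtain ⟨C, hC⟩ := hχb i
    refine continuous_of_dominated (bound := fun _ => C) (fun ξ => ?_) (fun ξ => ?_) ?_ ?_
    · exact Continuous.aestronglyMeasurable (by fun_prop)
    · exact Filter.Eventually.of_forall fun y => by simpa using hC y
    · exact integrable_const _
    · exact Filter.Eventually.of_forall fun y => by fun_prop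
  have hχi : ∀ i ξ, Integrable (fun y => fourierKernel y ξ * χ i y) μ := by
    intro i ξ
    obtain ⟨C, hC⟩ := hχb i
    refine (integrable_const C).mono' (Continuous.aestronglyMeasurable (by fun_prop)) ?_
    exact Filter.Eventually.of_forall fun y => by simpa using hC y
  -- Differentiating the kernel brings down `⟪y, ξ⟫ = ∑ ⟪y, b i⟫ ⟪b i, ξ⟫`. On the support of `μ`,
  -- `⟪y, b i⟫` is the Schwartz function `χ i`, so each term is the transform of `χ i μ`, with full
  -- decay, times one factor linear in `ξ`.
  refine ⟨fun t ξ => ∑ i, (-(2 * Real.pi * Complex.I) * (⟪b i, ξ⟫ : ℝ)) * F i (t • ξ), ?_, ?_, ?_⟩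
  · simp only [Function.uncurry_def]
    refine continuous_finsetSum _ fun i _ => ?_
    have := hFc i
    fun_prop
  · intro t ξ
    have hder : ∀ y : V, ∀ t : ℝ, HasDerivAt (fun t : ℝ => fourierKernel y (t • ξ))
        (fourierKernel y (t • ξ) * (-(2 * Real.pi * Complex.I) * (⟪y, ξ⟫ : ℝ))) t := by
      intro y t
      have h1 : HasDerivAt (fun t : ℝ => (-(2 * Real.pi * (t * ⟪y, ξ⟫) : ℝ) : ℂ) * Complex.I)
          (-(2 * Real.pi * Complex.I) * (⟪y, ξ⟫ : ℝ)) t := by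
        have h2 : HasDerivAt (fun t : ℝ => (2 * Real.pi * (t * ⟪y, ξ⟫) : ℝ))
            (2 * Real.pi * (1 * ⟪y, ξ⟫)) t :=
          ((hasDerivAt_id t).mul_const _).const_mul _
        refine (h2.ofReal_comp.neg.mul_const Complex.I).congr_deriv ?_
        push_cast; ring
      have h3 := h1.cexp
      simpa only [fourierKernel, real_inner_smul_right] using h3
    have key := hasDerivAt_integral_of_dominated_loc_of_deriv_le (μ := μ) (𝕜 := ℝ)
      (F := fun t y => fourierKernel y (t • ξ))
      (F' := fun t y => fourierKernel y (t • ξ) * (-(2 * Real.pi * Complex.I) * (⟪y, ξ⟫ : ℝ)))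
      (x₀ := t) (s := Set.univ) (bound := fun _ => 2 * Real.pi * ‖ξ‖) Filter.univ_mem
      (Filter.Eventually.of_forall fun t => Continuous.aestronglyMeasurable (by fun_prop))
      ((integrable_const (1 : ℝ)).mono' (Continuous.aestronglyMeasurable (by fun_prop))
        (Filter.Eventually.of_forall fun y => by simp))
      (Continuous.aestronglyMeasurable (by fun_prop)) ?_ (integrable_const _)
      (Filter.Eventually.of_forall fun y t _ => hder y t)
    · refine key.2.congr_deriv ?_
      calc _ = ∫ y, ∑ i, (-(2 * Real.pi * Complex.I) * (⟪b i, ξ⟫ : ℝ)) *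
              (fourierKernel y (t • ξ) * χ i y) ∂μ := by
            apply integral_congr_ae
            filter_upwards [hae] with y hy
            have : ⟪y, ξ⟫ = ∑ i, ⟪y, b i⟫ * ⟪b i, ξ⟫ := (b.sum_inner_mul_inner y ξ).symm
            rw [this, Complex.ofReal_sum, Finset.mul_sum, Finset.mul_sum]
            refine Finset.sum_congr rfl fun i _ => ?_
            rw [hχ i y hy]
            push_cast; ring
        _ = _ := by
            rw [integral_finsetSum _ fun i _ => (hχi i _).const_mul _]
            simp only [integral_const_mul, F]
    · filter_upwards [hae] with y hy t _
      have hy : ‖y‖ ≤ 1 := by simpa using hy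
      rw [norm_mul, norm_fourierKernel, one_mul, norm_mul, norm_neg, norm_mul, norm_mul,
        Complex.norm_I, Complex.norm_real, Complex.norm_real, Real.norm_of_nonneg Real.pi_pos.le]
      simp only [Complex.norm_ofNat, mul_one]
      have := (abs_real_inner_le_norm y ξ).trans (mul_le_of_le_one_left (norm_nonneg ξ) hy)
      rw [Real.norm_eq_abs]
      have hpi := Real.pi_pos
      gcongr
  · refine ⟨∑ i, 2 * Real.pi * B i, Finset.sum_nonneg fun i _ => ?_, fun t ht ξ => ?_⟩
    · have := hB0 i; have := Real.pi_pos; positivity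
    rw [Finset.sum_mul]
    refine (norm_sum_le _ _).trans (Finset.sum_le_sum fun i _ => ?_)
    rw [norm_mul, norm_mul, norm_neg, norm_mul, norm_mul,
      Complex.norm_I, Complex.norm_real, Complex.norm_real, Real.norm_of_nonneg Real.pi_pos.le]
    simp only [Complex.norm_ofNat, mul_one]
    have h1 : ‖⟪b i, ξ⟫‖ ≤ 1 + ‖ξ‖ := by
      have := norm_inner_le_norm (𝕜 := ℝ) (b i) ξ
      rw [b.orthonormal.1 i, one_mul] at this
      linarith
    have h2 : ‖F i (t • ξ)‖ ≤ B i * (1 + ‖ξ‖) ^ (-s) := by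
      refine (hB i _).trans ?_
      have := hB0 i
      gcongr ?_ * ?_
      -- This is where `t ≥ 1` enters: `1 + ‖ξ‖ ≤ 1 + ‖t • ξ‖` and the exponent is nonpositive.
      apply Real.rpow_le_rpow_of_nonpos (by positivity) _ (by linarith)
      rw [norm_smul, Real.norm_of_nonneg (by linarith)]
      nlinarith [norm_nonneg ξ]
    have hp : 0 < 1 + ‖ξ‖ := by positivity
    rw [sub_eq_add_neg, Real.rpow_add hp, Real.rpow_one]
    have hpi := Real.pi_pos
    have := hB0 i
    calc _ ≤ 2 * Real.pi * (1 + ‖ξ‖) * (B i * (1 + ‖ξ‖) ^ (-s)) := by gcongr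
      _ = _ := by ring

end FourierDecay

/-! ### A Sobolev inequality in the dilation parameter and restriction to the diagonal. -/

section SobolevTrace

open FourierTransform

/-- One-dimensional Sobolev inequality on `[1, 2]` with a free parameter. -/
theorem enorm_sq_le_lintegral_of_hasDerivAt {u u' : ℝ → ℂ} (hu : ∀ t, HasDerivAt u (u' t) t)
    (hm : Measurable u') {M : ℝ} (hM : ∀ t ∈ Set.Icc (1 : ℝ) 2, ‖u' t‖ ≤ M)
    {l : ℝ} (hl : 0 < l) {t : ℝ} (ht : t ∈ Set.Icc (1 : ℝ) 2) :
    ‖u t‖ₑ ^ 2 ≤ ENNReal.ofReal (1 + l) * (∫⁻ τ in Set.Icc (1 : ℝ) 2, ‖u τ‖ₑ ^ 2) +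
      ENNReal.ofReal l⁻¹ * ∫⁻ τ in Set.Icc (1 : ℝ) 2, ‖u' τ‖ₑ ^ 2 := by
  have huc : Continuous u := continuous_iff_continuousAt.2 fun t => (hu t).continuousAt
  have hg : ∀ t, HasDerivAt (fun t => ‖u t‖ ^ 2) (2 * ⟪u t, u' t⟫) t := fun t => (hu t).norm_sq
  have hi1 : IntegrableOn (fun τ => ‖u τ‖ ^ 2) (Set.Icc (1 : ℝ) 2) :=
    (huc.norm.pow 2).continuousOn.integrableOn_Icc
  have hi2 : IntegrableOn (fun τ => ‖u' τ‖ ^ 2) (Set.Icc (1 : ℝ) 2) := by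
    refine Measure.integrableOn_of_bounded (M := M ^ 2) (by simp)
      (hm.norm.pow_const 2).aestronglyMeasurable ?_
    filter_upwards [ae_restrict_mem measurableSet_Icc] with τ hτ
    rw [Real.norm_of_nonneg (by positivity)]
    gcongr
    exact hM τ hτ
  set D : ℝ → ℝ := fun τ => l * ‖u τ‖ ^ 2 + l⁻¹ * ‖u' τ‖ ^ 2 with hD
  have hDi : IntegrableOn D (Set.Icc (1 : ℝ) 2) := (hi1.const_mul l).add (hi2.const_mul l⁻¹)
  have hD0 : ∀ τ, 0 ≤ D τ := fun τ => by simp only [hD]; positivity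
  -- The derivative of `‖u‖²` is split by the weighted arithmetic–geometric inequality; `l` is later
  -- taken equal to the frequency, which balances `u` against `u'`.
  have hgD : ∀ τ, ‖2 * ⟪u τ, u' τ⟫‖ ≤ D τ := by
    intro τ
    rw [norm_mul, Real.norm_ofNat]
    have h1 := norm_inner_le_norm (𝕜 := ℝ) (u τ) (u' τ)
    have h2 : 0 ≤ l⁻¹ * (l * ‖u τ‖ - ‖u' τ‖) ^ 2 := by positivity
    have h3 : l⁻¹ * (l * ‖u τ‖ - ‖u' τ‖) ^ 2
        = l * ‖u τ‖ ^ 2 + l⁻¹ * ‖u' τ‖ ^ 2 - 2 * (‖u τ‖ * ‖u' τ‖) := by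
      field_simp; ring
    simp only [hD]
    linarith
  have hgi : IntegrableOn (fun τ => 2 * ⟪u τ, u' τ⟫) (Set.Icc (1 : ℝ) 2) :=
    Integrable.mono' hDi ((huc.measurable.inner hm).const_mul 2).aestronglyMeasurable
      (Filter.Eventually.of_forall hgD)
  set I := ∫ τ in Set.Icc (1 : ℝ) 2, D τ with hI
  have hle : ∀ τ ∈ Set.Icc (1 : ℝ) 2, ‖u t‖ ^ 2 ≤ ‖u τ‖ ^ 2 + I := by
    intro τ hτ
    have hsub : Set.uIcc τ t ⊆ Set.Icc 1 2 := Set.uIcc_subset_Icc hτ ht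
    have h1 : ∫ r in τ..t, 2 * ⟪u r, u' r⟫ = ‖u t‖ ^ 2 - ‖u τ‖ ^ 2 :=
      intervalIntegral.integral_eq_sub_of_hasDerivAt (fun r _ => hg r)
        (intervalIntegrable_iff.2 (hgi.mono_set (Set.uIoc_subset_uIcc.trans hsub)))
    have h2 : ‖∫ r in τ..t, 2 * ⟪u r, u' r⟫‖ ≤ I := by
      refine (intervalIntegral.norm_integral_le_integral_norm_uIoc).trans ?_
      calc _ ≤ ∫ r in Set.uIoc τ t, D r :=
            setIntegral_mono (hgi.mono_set (Set.uIoc_subset_uIcc.trans hsub)).norm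
              (hDi.mono_set (Set.uIoc_subset_uIcc.trans hsub)) hgD
        _ ≤ I := setIntegral_mono_set hDi (Filter.Eventually.of_forall hD0)
              (LE.le.eventuallyLE (Set.uIoc_subset_uIcc.trans hsub))
    rw [h1] at h2
    have := (Real.le_norm_self _).trans h2
    linarith
  -- Averaging over `τ` is plain integration here because `[1, 2]` has length one.
  have hfin : ‖u t‖ ^ 2 ≤ (1 + l) * (∫ τ in Set.Icc (1 : ℝ) 2, ‖u τ‖ ^ 2) +
      l⁻¹ * ∫ τ in Set.Icc (1 : ℝ) 2, ‖u' τ‖ ^ 2 := by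
    have h1 : ∫ τ in Set.Icc (1 : ℝ) 2, ‖u t‖ ^ 2
        ≤ ∫ τ in Set.Icc (1 : ℝ) 2, (‖u τ‖ ^ 2 + I) :=
      setIntegral_mono_on (integrableOn_const (by simp)) (hi1.add (integrableOn_const (by simp)))
        measurableSet_Icc hle
    rw [integral_add hi1 (integrableOn_const (by simp)), setIntegral_const, setIntegral_const] at h1
    have h2 : I = l * (∫ τ in Set.Icc (1 : ℝ) 2, ‖u τ‖ ^ 2) +
        l⁻¹ * ∫ τ in Set.Icc (1 : ℝ) 2, ‖u' τ‖ ^ 2 := by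
      rw [hI, hD, integral_add (hi1.const_mul l) (hi2.const_mul l⁻¹), integral_const_mul,
        integral_const_mul]
    norm_num at h1
    linarith
  have hcv : ∀ {v : ℝ → ℂ}, IntegrableOn (fun τ => ‖v τ‖ ^ 2) (Set.Icc (1 : ℝ) 2) →
      ENNReal.ofReal (∫ τ in Set.Icc (1 : ℝ) 2, ‖v τ‖ ^ 2)
        = ∫⁻ τ in Set.Icc (1 : ℝ) 2, ‖v τ‖ₑ ^ 2 := by
    intro v hv
    rw [ofReal_integral_eq_lintegral_ofReal hv (Filter.Eventually.of_forall fun _ => by positivity)]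
    congr 1; ext τ
    rw [ENNReal.ofReal_pow (norm_nonneg _), ofReal_norm]
  rw [← hcv hi1, ← hcv hi2, ← ENNReal.ofReal_mul (by positivity),
    ← ENNReal.ofReal_mul (by positivity), ← ENNReal.ofReal_add, ← ofReal_norm,
    ← ENNReal.ofReal_pow (norm_nonneg _)]
  · exact ENNReal.ofReal_le_ofReal hfin
  · exact mul_nonneg (by positivity) (integral_nonneg fun _ => by positivity)
  · exact mul_nonneg (by positivity) (integral_nonneg fun _ => by positivity)

variable {V : Type*} [NormedAddCommGroup V] [InnerProductSpace ℝ V] [FiniteDimensional ℝ V]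
  [MeasurableSpace V] [BorelSpace V]

/-- Coordinates on `V^{n+1}` for which the last one is the sum of all components. -/
def consSub {n : ℕ} (p : (Fin n → V) × V) : Fin (n + 1) → V :=
  Fin.cons (p.2 - ∑ i, p.1 i) p.1

omit [InnerProductSpace ℝ V] [FiniteDimensional ℝ V] [MeasurableSpace V] [BorelSpace V] in
theorem sum_consSub {n : ℕ} (p : (Fin n → V) × V) : ∑ i, consSub p i = p.2 := by
  simp [consSub, Fin.sum_univ_succ]

theorem measurePreserving_consSub (n : ℕ) :
    MeasurePreserving (consSub : (Fin n → V) × V → Fin (n + 1) → V) := by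
  have h1 : MeasurePreserving (fun p : (Fin n → V) × V => (p.1, p.2 - ∑ i, p.1 i)) := by
    refine MeasurePreserving.skew_product (g := fun (a : Fin n → V) (b : V) => b - ∑ i, a i)
      (MeasurePreserving.id (volume : Measure (Fin n → V))) ?_ ?_
    · simp only [Function.uncurry_def]; fun_prop
    · exact Filter.Eventually.of_forall fun a =>
        (measurePreserving_sub_right volume (∑ i, a i)).map_eq
  have h2 := (volume_preserving_piFinSuccAbove (fun _ : Fin (n + 1) => V) 0).symm
  have h3 : MeasurePreserving (Prod.swap : (Fin n → V) × V → V × (Fin n → V)) :=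
    Measure.measurePreserving_swap
  have h4 := h2.comp (h3.comp h1)
  convert! h4 using 1
  ext p : 1
  simp [consSub, MeasurableEquiv.piFinSuccAbove, Fin.insertNthEquiv]

/-- The restriction to the diagonal of a function with frequencies in a ball of `V^{n+1}`. -/
theorem lintegral_enorm_sq_diagonal_le {n : ℕ} {H : (Fin (n + 1) → V) → ℂ} (hHm : Measurable H)
    (hH : Integrable H) {R : ℝ} (hR0 : 0 < R) (hR : ∀ ξ, R < ‖ξ‖ → H ξ = 0) :
    ∫⁻ x : V, ‖∫ ξ, fourierKernel (-x) (∑ i, ξ i) * H ξ‖ₑ ^ 2 ≤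
      volume (Metric.closedBall (0 : Fin n → V) R) * ∫⁻ ξ, ‖H ξ‖ₑ ^ 2 := by
  by_cases htop : ∫⁻ ξ, ‖H ξ‖ₑ ^ 2 = ∞
  · rw [htop, ENNReal.mul_top (Metric.measure_closedBall_pos volume _ hR0).ne']
    exact le_top
  have hΦ := measurePreserving_consSub (V := V) n
  have hint : Integrable (fun p => H (consSub p)) (volume : Measure ((Fin n → V) × V)) :=
    hΦ.integrable_comp_of_integrable hH
  set h : V → ℂ := fun η => ∫ ξ' : Fin n → V, H (consSub (ξ', η)) with hh
  have h1 : Integrable h := Integrable.integral_prod_right (by exact hint)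
  -- On the diagonal only the total frequency `∑ ξᵢ` matters. Integrating `H` over the fibres of the
  -- sum map leaves a function `h` of one variable in `V`, to which Plancherel applies.
  have hU : ∀ x : V, ∫ ξ, fourierKernel (-x) (∑ i, ξ i) * H ξ = 𝓕 h (-x) := by
    intro x
    have e1 : ∫ ξ, fourierKernel (-x) (∑ i, ξ i) * H ξ
        = ∫ p : (Fin n → V) × V, fourierKernel (-x) p.2 * H (consSub p) := by
      rw [← hΦ.map_eq, integral_map hΦ.measurable.aemeasurable]
      · simp only [sum_consSub]
      · exact (Continuous.aestronglyMeasurable (by fun_prop)).mul hHm.aestronglyMeasurable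
    rw [e1, fourier_eq_integral_fourierKernel]
    have hint' : Integrable (fun p : (Fin n → V) × V => fourierKernel (-x) p.2 * H (consSub p)) := by
      refine hint.mono ((Continuous.aestronglyMeasurable (by fun_prop)).mul
        hint.aestronglyMeasurable) (Filter.Eventually.of_forall fun p => by simp)
    rw [Measure.volume_eq_prod, integral_prod_symm _ hint']
    congr 1; ext η
    simp only [hh]
    rw [integral_const_mul, fourierKernel_comm]
  -- Cauchy–Schwarz on each fibre. The first `n` coordinates parametrize the fibre, and the support
  -- condition keeps them in a ball of radius `R`, whose volume is the cost of the restriction.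
  have hpt : ∀ η, ‖h η‖ₑ ^ 2 ≤ volume (Metric.closedBall (0 : Fin n → V) R) *
      ∫⁻ ξ' : Fin n → V, ‖H (consSub (ξ', η))‖ₑ ^ 2 := by
    intro η
    have hz : ∀ ξ' : Fin n → V, ξ' ∉ Metric.closedBall (0 : Fin n → V) R →
        H (consSub (ξ', η)) = 0 := by
      intro ξ' hξ'
      apply hR
      rw [mem_closedBall_zero_iff, not_le] at hξ'
      refine hξ'.trans_le ((pi_norm_le_iff_of_nonneg (norm_nonneg _)).2 fun i => ?_)
      have := norm_le_pi_norm (consSub (ξ', η)) i.succ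
      simpa [consSub] using this
    have hmeas : Measurable fun ξ' : Fin n → V => ‖H (consSub (ξ', η))‖ₑ :=
      (hHm.comp (hΦ.measurable.comp (by fun_prop))).enorm
    have hCS := ENNReal.lintegral_mul_le_Lp_mul_Lq (volume : Measure (Fin n → V))
      Real.HolderConjugate.two_two
      (f := Set.indicator (Metric.closedBall (0 : Fin n → V) R) 1)
      (g := fun ξ' => ‖H (consSub (ξ', η))‖ₑ)
      (measurable_one.indicator Metric.isClosed_closedBall.measurableSet).aemeasurable
      hmeas.aemeasurable
    have e2 : ∀ ξ' : Fin n → V, (Set.indicator (Metric.closedBall (0 : Fin n → V) R)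
        (1 : (Fin n → V) → ℝ≥0∞) * fun ξ' => ‖H (consSub (ξ', η))‖ₑ) ξ'
          = ‖H (consSub (ξ', η))‖ₑ := by
      intro ξ'
      by_cases hξ : ξ' ∈ Metric.closedBall (0 : Fin n → V) R
      · simp [hξ]
      · simp [hξ, hz ξ' hξ]
    have e3 : ∀ ξ' : Fin n → V, (Set.indicator (Metric.closedBall (0 : Fin n → V) R)
        (1 : (Fin n → V) → ℝ≥0∞) ξ') ^ (2 : ℝ)
          = Set.indicator (Metric.closedBall (0 : Fin n → V) R) 1 ξ' := by
      intro ξ'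
      by_cases hξ : ξ' ∈ Metric.closedBall (0 : Fin n → V) R
      · simp [hξ]
      · simp [hξ]
    simp_rw [e2, e3] at hCS
    rw [lintegral_indicator_one Metric.isClosed_closedBall.measurableSet] at hCS
    calc ‖h η‖ₑ ^ 2 ≤ (∫⁻ ξ' : Fin n → V, ‖H (consSub (ξ', η))‖ₑ) ^ 2 := by
          gcongr; exact enorm_integral_le_lintegral_enorm _
      _ ≤ _ := by
          refine (pow_le_pow_left₀ zero_le hCS 2).trans (le_of_eq ?_)
          rw [mul_pow, ← ENNReal.rpow_natCast, ← ENNReal.rpow_mul, ← ENNReal.rpow_natCast,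
            ← ENNReal.rpow_mul]
          norm_num
  have htot : ∫⁻ η, ‖h η‖ₑ ^ 2 ≤ volume (Metric.closedBall (0 : Fin n → V) R) *
      ∫⁻ ξ, ‖H ξ‖ₑ ^ 2 := by
    refine (lintegral_mono hpt).trans (le_of_eq ?_)
    rw [lintegral_const_mul' _ _ (isCompact_closedBall _ _).measure_lt_top.ne]
    congr 1
    rw [← hΦ.lintegral_comp (hHm.enorm.pow_const 2), Measure.volume_eq_prod, lintegral_prod_symm]
    exact ((hHm.comp hΦ.measurable).enorm.pow_const 2).aemeasurable
  have h2 : MemLp h 2 := by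
    refine ⟨h1.aestronglyMeasurable, ?_⟩
    rw [eLpNorm_lt_top_iff_lintegral_rpow_enorm_lt_top (by norm_num) (by norm_num)]
    simp only [ENNReal.toReal_ofNat, ENNReal.rpow_ofNat]
    refine htot.trans_lt (ENNReal.mul_lt_top (isCompact_closedBall _ _).measure_lt_top
      (lt_top_iff_ne_top.2 htop))
  simp_rw [hU]
  calc _ = ∫⁻ x, ‖𝓕 h x‖ₑ ^ 2 := lintegral_neg_eq_self (fun x => ‖𝓕 h x‖ₑ ^ 2)
    _ = _ := lintegral_enorm_fourier_sq h1 h2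
    _ ≤ _ := htot

end SobolevTrace

/-! ### Summation over dyadic frequency shells of the maximal estimate on the diagonal. -/

section Core

variable {V : Type*} [NormedAddCommGroup V] [InnerProductSpace ℝ V] [FiniteDimensional ℝ V]
  [MeasurableSpace V] [BorelSpace V]

/-- Dyadic shells in frequency space. -/
def freqShell (W : Type*) [NormedAddCommGroup W] (j : ℕ) : Set W :=
  {ξ | (2 : ℝ) ^ j ≤ 1 + ‖ξ‖ ∧ 1 + ‖ξ‖ < (2 : ℝ) ^ (j + 1)}

section Shell

variable {W : Type*} [NormedAddCommGroup W]

theorem mem_freqShell {j : ℕ} {ξ : W} :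
    ξ ∈ freqShell W j ↔ (2 : ℝ) ^ j ≤ 1 + ‖ξ‖ ∧ 1 + ‖ξ‖ < (2 : ℝ) ^ (j + 1) := Iff.rfl

theorem measurableSet_freqShell [MeasurableSpace W] [OpensMeasurableSpace W] (j : ℕ) :
    MeasurableSet (freqShell W j) := by
  have h1 : MeasurableSet {ξ : W | (2 : ℝ) ^ j ≤ 1 + ‖ξ‖} :=
    measurableSet_le measurable_const (by fun_prop)
  have h2 : MeasurableSet {ξ : W | 1 + ‖ξ‖ < (2 : ℝ) ^ (j + 1)} :=
    measurableSet_lt (by fun_prop) measurable_const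
  exact h1.inter h2

theorem iUnion_freqShell : ⋃ j, freqShell W j = Set.univ := by
  refine Set.eq_univ_of_forall fun ξ => Set.mem_iUnion.2 ?_
  exact exists_nat_pow_near (by linarith [norm_nonneg ξ]) one_lt_two

theorem pairwise_disjoint_freqShell : Pairwise (Function.onFun Disjoint (freqShell W)) := by
  have key : ∀ i j : ℕ, i < j → Disjoint (freqShell W i) (freqShell W j) := by
    intro i j hij
    rw [Set.disjoint_left]
    intro ξ h1 h2
    rw [mem_freqShell] at h1 h2
    have : (2 : ℝ) ^ (i + 1) ≤ 2 ^ j := pow_le_pow_right₀ one_le_two hij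
    linarith
  intro i j hij
  rcases lt_or_gt_of_ne hij with h | h
  · exact key i j h
  · exact (key j i h).symm

end Shell

/-- `L²` bound, in space and in the dilation parameter, for a multiplier restricted to a shell. -/
theorem lintegral_lintegral_enorm_sq_shell_le {n : ℕ} {c : ℝ → (Fin (n + 1) → V) → ℂ}
    (hc : Continuous (Function.uncurry c)) (j : ℕ) {K : ℝ}
    (hK : ∀ t ∈ Set.Icc (1 : ℝ) 2, ∀ ξ ∈ freqShell (Fin (n + 1) → V) j, ‖c t ξ‖ ≤ K)
    {G : (Fin (n + 1) → V) → ℂ} (hGm : Measurable G) (hG : Integrable G) :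
    ∫⁻ x : V, ∫⁻ t in Set.Icc (1 : ℝ) 2, ‖∫ ξ, fourierKernel (-x) (∑ i, ξ i) *
        ((freqShell (Fin (n + 1) → V) j).indicator G ξ * c t ξ)‖ₑ ^ 2 ≤
      volume (Metric.closedBall (0 : Fin n → V) (2 ^ (j + 1))) * (ENNReal.ofReal K ^ 2 *
        ∫⁻ ξ in freqShell (Fin (n + 1) → V) j, ‖G ξ‖ₑ ^ 2) := by
  set S := freqShell (Fin (n + 1) → V) j with hS
  have hSm : MeasurableSet S := measurableSet_freqShell j
  have hcm : Measurable (Function.uncurry c) := hc.measurable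
  have hjm : Measurable fun p : V × ℝ => ∫ ξ, fourierKernel (-p.1) (∑ i, ξ i) *
      (S.indicator G ξ * c p.2 ξ) := by
    refine (StronglyMeasurable.integral_prod_right' (ν := volume)
      (f := fun q : (V × ℝ) × (Fin (n + 1) → V) => fourierKernel (-q.1.1) (∑ i, q.2 i) *
      (S.indicator G q.2 * c q.1.2 q.2)) (Measurable.stronglyMeasurable ?_)).measurable
    refine Measurable.mul (Continuous.measurable (by fun_prop)) (Measurable.mul ?_ ?_)
    · exact (hGm.indicator hSm).comp measurable_snd
    · exact hcm.comp ((measurable_snd.comp measurable_fst).prodMk measurable_snd)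
  rw [lintegral_lintegral_swap (hjm.enorm.pow_const 2).aemeasurable]
  have key : ∀ t ∈ Set.Icc (1 : ℝ) 2, ∫⁻ x : V, ‖∫ ξ, fourierKernel (-x) (∑ i, ξ i) *
      (S.indicator G ξ * c t ξ)‖ₑ ^ 2 ≤
      volume (Metric.closedBall (0 : Fin n → V) (2 ^ (j + 1))) *
        (ENNReal.ofReal K ^ 2 * ∫⁻ ξ in S, ‖G ξ‖ₑ ^ 2) := by
    intro t ht
    have hct : Measurable (c t) := hcm.comp (measurable_const.prodMk measurable_id)
    have hHm : Measurable fun ξ => S.indicator G ξ * c t ξ := (hGm.indicator hSm).mul hct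
    have hb : ∀ ξ, ‖S.indicator G ξ * c t ξ‖ ≤ K * ‖S.indicator G ξ‖ := by
      intro ξ
      by_cases hξ : ξ ∈ S
      · rw [norm_mul, mul_comm]
        gcongr
        exact hK t ht ξ hξ
      · simp [hξ]
    have hHi : Integrable fun ξ => S.indicator G ξ * c t ξ :=
      ((hG.indicator hSm).norm.const_mul K).mono' hHm.aestronglyMeasurable
        (Filter.Eventually.of_forall hb)
    refine (lintegral_enorm_sq_diagonal_le hHm hHi (R := 2 ^ (j + 1)) (by positivity) ?_).trans ?_
    · intro ξ hξ
      have : ξ ∉ S := fun h => by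
        have := (mem_freqShell.1 h).2
        linarith
      simp [this]
    · gcongr
      rw [← lintegral_indicator hSm, ← lintegral_const_mul' _ _ (by finiteness)]
      refine lintegral_mono fun ξ => ?_
      by_cases hξ : ξ ∈ S
      · simp only [Set.indicator_of_mem hξ]
        rw [enorm_mul, mul_pow, mul_comm]
        gcongr
        rw [← ofReal_norm]
        exact ENNReal.ofReal_le_ofReal (hK t ht ξ hξ)
      · simp [hξ]
  calc _ ≤ ∫⁻ t in Set.Icc (1 : ℝ) 2, volume (Metric.closedBall (0 : Fin n → V) (2 ^ (j + 1))) *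
        (ENNReal.ofReal K ^ 2 * ∫⁻ ξ in S, ‖G ξ‖ₑ ^ 2) := setLIntegral_mono' measurableSet_Icc key
    _ = _ := by
      rw [setLIntegral_const, Real.volume_Icc]
      norm_num

/-- Cauchy–Schwarz for a series with a geometric weight. -/
theorem ENNReal.tsum_sq_le (a w : ℕ → ℝ≥0∞) (hw : ∀ j, w j ≠ 0) (hw' : ∀ j, w j ≠ ∞) :
    (∑' j, a j) ^ 2 ≤ (∑' j, w j) * ∑' j, (w j)⁻¹ * a j ^ 2 := by
  have h := ENNReal.lintegral_mul_le_Lp_mul_Lq (Measure.count : Measure ℕ)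
    Real.HolderConjugate.two_two (f := fun j => w j ^ (1 / 2 : ℝ))
    (g := fun j => (w j)⁻¹ ^ (1 / 2 : ℝ) * a j) (measurable_of_countable _).aemeasurable
    (measurable_of_countable _).aemeasurable
  simp only [lintegral_count, Pi.mul_apply] at h
  have e1 : ∀ j, w j ^ (1 / 2 : ℝ) * ((w j)⁻¹ ^ (1 / 2 : ℝ) * a j) = a j := by
    intro j
    rw [← mul_assoc, ← ENNReal.mul_rpow_of_nonneg _ _ (by norm_num),
      ENNReal.mul_inv_cancel (hw j) (hw' j), ENNReal.one_rpow, one_mul]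
  have e2 : ∀ j, (w j ^ (1 / 2 : ℝ)) ^ (2 : ℝ) = w j := by
    intro j; rw [← ENNReal.rpow_mul]; norm_num
  have e3 : ∀ j, ((w j)⁻¹ ^ (1 / 2 : ℝ) * a j) ^ (2 : ℝ) = (w j)⁻¹ * a j ^ 2 := by
    intro j
    rw [ENNReal.mul_rpow_of_nonneg _ _ (by norm_num), ← ENNReal.rpow_mul]; norm_num
  simp_rw [e1, e2, e3] at h
  calc _ ≤ _ := pow_le_pow_left₀ zero_le h 2
    _ = _ := by
      rw [mul_pow, ← ENNReal.rpow_natCast, ← ENNReal.rpow_mul, ← ENNReal.rpow_natCast,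
        ← ENNReal.rpow_mul]
      norm_num

/-- Bookkeeping for the shell `1 + ‖ξ‖ ∼ q = 2^j`. The factors `1 + q` and `q⁻¹` come from the
Sobolev inequality with `l = q`, `(2q)^N` from the diagonal, the squares from the decay of the
multiplier and of its `t`-derivative, and `(2q)^δ` from inserting the Sobolev weight. The exponents
add up to `N + 1 - 2s + δ = -δ`. -/
theorem shell_constant_le {q N δ s A B : ℝ} (hq : 1 ≤ q) (h : N + 1 - 2 * s = -2 * δ) :
    (1 + q) * ((2 * q) ^ N * ((A * q ^ (-s)) ^ 2 * (2 * q) ^ δ)) +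
      q⁻¹ * ((2 * q) ^ N * ((B * (2 * q * q ^ (-s))) ^ 2 * (2 * q) ^ δ)) ≤
    2 ^ (N + δ) * (2 * A ^ 2 + 4 * B ^ 2) * q ^ (-δ) := by
  have hq0 : 0 < q := by linarith
  have h2 : (2 * q) ^ N * (2 * q) ^ δ = 2 ^ (N + δ) * q ^ (N + δ) := by
    rw [← Real.rpow_add (by positivity), Real.mul_rpow (by norm_num) hq0.le]
  have h3 : q ^ (N + δ) * (q * (q ^ (-s)) ^ 2) = q ^ (-δ) := by
    have h4 : q * (q ^ (-s)) ^ 2 = q ^ (1 + -s * 2) := by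
      rw [Real.rpow_add hq0, Real.rpow_one, Real.rpow_mul hq0.le, Real.rpow_two]
    rw [h4, ← Real.rpow_add hq0]
    congr 1; linarith
  calc _ ≤ (2 * q) * ((2 * q) ^ N * ((A * q ^ (-s)) ^ 2 * (2 * q) ^ δ)) +
      q⁻¹ * ((2 * q) ^ N * ((B * (2 * q * q ^ (-s))) ^ 2 * (2 * q) ^ δ)) := by gcongr; linarith
    _ = ((2 * q) ^ N * (2 * q) ^ δ) * (2 * A ^ 2 + 4 * B ^ 2) * (q * (q ^ (-s)) ^ 2) := by
      field_simp
      ring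
    _ = _ := by rw [h2, ← h3]; ring

theorem ofReal_shell_constant_mul {e₁ e₂ X a b Y : ℝ} (h₁ : 0 ≤ e₁) (h₂ : 0 ≤ e₂) (hX : 0 ≤ X)
    (ha : 0 ≤ a) (hb : 0 ≤ b) (hY : 0 ≤ Y) (v P : ℝ≥0∞) :
    ENNReal.ofReal (e₁ * (X * (a ^ 2 * Y)) + e₂ * (X * (b ^ 2 * Y))) * v * P =
      ENNReal.ofReal e₁ * (ENNReal.ofReal X * v *
        (ENNReal.ofReal a ^ 2 * (ENNReal.ofReal Y * P))) +
      ENNReal.ofReal e₂ * (ENNReal.ofReal X * v *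
        (ENNReal.ofReal b ^ 2 * (ENNReal.ofReal Y * P))) := by
  rw [ENNReal.ofReal_add (by positivity) (by positivity), ENNReal.ofReal_mul h₁,
    ENNReal.ofReal_mul hX, ENNReal.ofReal_mul (by positivity), ENNReal.ofReal_mul h₂,
    ENNReal.ofReal_mul hX, ENNReal.ofReal_mul (by positivity), ENNReal.ofReal_pow ha,
    ENNReal.ofReal_pow hb]
  ring

/-- On the shell `1 + ‖ξ‖ < 2 · 2^j`, so the weight `(1 + ‖ξ‖)^(-δ)` can be inserted at cost `(2 ·
2^j)^δ`. This spends half of the available surplus `2δ`. -/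
theorem lintegral_shell_enorm_sq_le {n : ℕ} (G : (Fin (n + 1) → V) → ℂ) (j : ℕ) {δ : ℝ}
    (hδ : 0 < δ) :
    ∫⁻ ξ in freqShell (Fin (n + 1) → V) j, ‖G ξ‖ₑ ^ 2 ≤ ENNReal.ofReal ((2 * 2 ^ j) ^ δ) *
      ∫⁻ ξ in freqShell (Fin (n + 1) → V) j, ‖G ξ‖ₑ ^ 2 * ENNReal.ofReal ((1 + ‖ξ‖) ^ (-δ)) := by
  rw [← lintegral_const_mul' _ _ ENNReal.ofReal_ne_top]
  refine setLIntegral_mono' (measurableSet_freqShell j) fun ξ hξ => ?_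
  have hp : 0 < 1 + ‖ξ‖ := by positivity
  have h1 : 1 ≤ (2 * 2 ^ j) ^ δ * (1 + ‖ξ‖) ^ (-δ) := by
    rw [Real.rpow_neg hp.le, ← div_eq_mul_inv, one_le_div (by positivity)]
    have := (mem_freqShell.1 hξ).2
    rw [pow_succ, mul_comm] at this
    gcongr
  calc ‖G ξ‖ₑ ^ 2 = ENNReal.ofReal 1 * ‖G ξ‖ₑ ^ 2 := by simp
    _ ≤ ENNReal.ofReal ((2 * 2 ^ j) ^ δ * (1 + ‖ξ‖) ^ (-δ)) * ‖G ξ‖ₑ ^ 2 := by gcongr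
    _ = _ := by rw [ENNReal.ofReal_mul (by positivity)]; ring

/-- Maximal bound on the diagonal for a family of multipliers `a t`, `t ∈ [1, 2]`, with more than
`(n dim V + 1) / 2` orders of decay. -/
theorem exists_lintegral_iSup_enorm_sq_le {n : ℕ} {a a' : ℝ → (Fin (n + 1) → V) → ℂ}
    (ha : Continuous (Function.uncurry a)) (ha' : Continuous (Function.uncurry a'))
    (hd : ∀ t ξ, HasDerivAt (fun t => a t ξ) (a' t ξ) t) {M : ℝ} (hM : ∀ t ξ, ‖a t ξ‖ ≤ M)
    {s δ A B : ℝ} (hs : 0 ≤ s) (hA0 : 0 ≤ A) (hB0 : 0 ≤ B)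
    (hA : ∀ t ∈ Set.Icc (1 : ℝ) 2, ∀ ξ, ‖a t ξ‖ ≤ A * (1 + ‖ξ‖) ^ (-s))
    (hB : ∀ t ∈ Set.Icc (1 : ℝ) 2, ∀ ξ, ‖a' t ξ‖ ≤ B * (1 + ‖ξ‖) ^ (1 - s))
    (hδ : 0 < δ) (hsδ : (n * Module.finrank ℝ V : ℝ) + 1 - 2 * s = -2 * δ) :
    ∃ C : ℝ≥0, ∀ G : (Fin (n + 1) → V) → ℂ, Measurable G → Integrable G →
      ∫⁻ x : V, (⨆ t ∈ Set.Icc (1 : ℝ) 2,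
        ‖∫ ξ, fourierKernel (-x) (∑ i, ξ i) * (G ξ * a t ξ)‖ₑ) ^ 2 ≤
        C * ∫⁻ ξ, ‖G ξ‖ₑ ^ 2 * ENNReal.ofReal ((1 + ‖ξ‖) ^ (-δ)) := by
  set S : ℕ → Set (Fin (n + 1) → V) := freqShell (Fin (n + 1) → V) with hS
  set N : ℝ := n * Module.finrank ℝ V with hN
  set v0 : ℝ≥0∞ := volume (Metric.ball (0 : Fin n → V) 1) with hv0
  set K : ℝ := 2 ^ (N + δ) * (2 * A ^ 2 + 4 * B ^ 2) with hK
  have hK0 : 0 ≤ K := by positivity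
  -- These weights decay at half the rate of the shell bounds: fast enough to be summable, and slow
  -- enough that `(w j)⁻¹ 2^(-jδ) ≤ 1` in the weighted Cauchy–Schwarz inequality.
  set w : ℕ → ℝ≥0∞ := fun j => ENNReal.ofReal ((2 ^ j) ^ (-(δ / 2))) with hw
  have hw0 : ∀ j, w j ≠ 0 := fun j => by
    simp only [hw, ne_eq, ENNReal.ofReal_eq_zero, not_le]; positivity
  have hwt : ∀ j, w j ≠ ∞ := fun j => ENNReal.ofReal_ne_top
  have hwsum : ∑' j, w j ≠ ∞ := by
    have e : ∀ j : ℕ, (((2 : ℝ) ^ j) ^ (-(δ / 2))) = ((2 : ℝ) ^ (-(δ / 2))) ^ j := fun j => by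
      rw [← Real.rpow_natCast, ← Real.rpow_natCast, ← Real.rpow_mul (by norm_num),
        ← Real.rpow_mul (by norm_num), mul_comm]
    simp only [hw, e]
    refine Summable.tsum_ofReal_ne_top (summable_geometric_of_lt_one (by positivity) ?_)
    exact Real.rpow_lt_one_of_one_lt_of_neg one_lt_two (by linarith)
  refine ⟨((∑' j, w j) * (ENNReal.ofReal K * v0)).toNNReal, fun G hGm hG => ?_⟩
  rw [ENNReal.coe_toNNReal (ENNReal.mul_ne_top hwsum
    (ENNReal.mul_ne_top ENNReal.ofReal_ne_top measure_ball_lt_top.ne))]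
  have hSm : ∀ j, MeasurableSet (S j) := fun j => measurableSet_freqShell j
  let u : ℕ → V → ℝ → ℂ := fun j x t =>
    ∫ ξ, fourierKernel (-x) (∑ i, ξ i) * ((S j).indicator G ξ * a t ξ)
  let u' : ℕ → V → ℝ → ℂ := fun j x t =>
    ∫ ξ, fourierKernel (-x) (∑ i, ξ i) * ((S j).indicator G ξ * a' t ξ)
  -- The Sobolev majorant with `l = 2^j`: it dominates `‖u j x t‖ₑ ^ 2` for all `t ∈ [1, 2]` and no
  -- longer involves `t`.
  let b : ℕ → V → ℝ≥0∞ := fun j x =>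
    ENNReal.ofReal (1 + 2 ^ j) * (∫⁻ τ in Set.Icc (1 : ℝ) 2, ‖u j x τ‖ₑ ^ 2) +
      ENNReal.ofReal (2 ^ j)⁻¹ * ∫⁻ τ in Set.Icc (1 : ℝ) 2, ‖u' j x τ‖ₑ ^ 2
  have hmeas : ∀ (j : ℕ) (c : ℝ → (Fin (n + 1) → V) → ℂ), Continuous (Function.uncurry c) →
      Measurable fun p : V × ℝ => ∫ ξ, fourierKernel (-p.1) (∑ i, ξ i) *
        ((S j).indicator G ξ * c p.2 ξ) := by
    intro j c hc
    refine (StronglyMeasurable.integral_prod_right' (ν := volume)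
      (f := fun q : (V × ℝ) × (Fin (n + 1) → V) => fourierKernel (-q.1.1) (∑ i, q.2 i) *
      ((S j).indicator G q.2 * c q.1.2 q.2)) (Measurable.stronglyMeasurable ?_)).measurable
    refine Measurable.mul (Continuous.measurable (by fun_prop)) (Measurable.mul ?_ ?_)
    · exact (hGm.indicator (hSm j)).comp measurable_snd
    · exact hc.measurable.comp ((measurable_snd.comp measurable_fst).prodMk measurable_snd)
  have hum' : ∀ j, Measurable (Function.uncurry (u' j)) := fun j => hmeas j a' ha'
  have hbm : ∀ j, Measurable (b j) := fun j =>
    (((hmeas j a ha).enorm.pow_const 2).lintegral_prod_right'.const_mul _).add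
      (((hmeas j a' ha').enorm.pow_const 2).lintegral_prod_right'.const_mul _)
  have hkerm : ∀ x : V, Measurable fun ξ : Fin (n + 1) → V => fourierKernel (-x) (∑ i, ξ i) :=
    fun x => Continuous.measurable (by fun_prop)
  have hcb : ∀ (j : ℕ) (r : ℝ), ∃ Q, ∀ t ∈ Set.Icc (-r) r, ∀ ξ ∈ S j, ‖a' t ξ‖ ≤ Q := by
    intro j r
    obtain ⟨Q, hQ⟩ := ((isCompact_Icc (a := -r) (b := r)).prod
      (isCompact_closedBall (0 : Fin (n + 1) → V) (2 ^ (j + 1)))).exists_bound_of_continuousOn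
      ha'.continuousOn
    refine ⟨Q, fun t ht ξ hξ => hQ (t, ξ) ⟨ht, ?_⟩⟩
    have := (mem_freqShell.1 hξ).2
    rw [mem_closedBall_zero_iff]; linarith
  have hGi : ∀ j, Integrable ((S j).indicator G) := fun j => hG.indicator (hSm j)
  have hderiv : ∀ j x t, HasDerivAt (u j x) (u' j x t) t := by
    intro j x t
    obtain ⟨Q, hQ⟩ := hcb j (|t| + 1)
    refine (hasDerivAt_integral_of_dominated_loc_of_deriv_le (𝕜 := ℝ)
      (F := fun t ξ => fourierKernel (-x) (∑ i, ξ i) * ((S j).indicator G ξ * a t ξ))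
      (F' := fun t ξ => fourierKernel (-x) (∑ i, ξ i) * ((S j).indicator G ξ * a' t ξ))
      (x₀ := t) (s := Set.Icc (-(|t| + 1)) (|t| + 1))
      (bound := fun ξ => ‖(S j).indicator G ξ‖ * Q) ?_ ?_ ?_ ?_ ?_ ?_ ?_).2
    · refine Icc_mem_nhds ?_ ?_
      · linarith [neg_abs_le t]
      · linarith [le_abs_self t]
    · exact Filter.Eventually.of_forall fun t => ((hkerm x).mul ((hGm.indicator (hSm j)).mul
        (ha.measurable.comp (measurable_const.prodMk measurable_id)))).aestronglyMeasurable
    · refine ((hGi j).norm.mul_const M).mono' ((hkerm x).mul ((hGm.indicator (hSm j)).mul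
        (ha.measurable.comp (measurable_const.prodMk measurable_id)))).aestronglyMeasurable ?_
      refine Filter.Eventually.of_forall fun ξ => ?_
      rw [norm_mul, norm_fourierKernel, one_mul, norm_mul]
      gcongr
      exact hM t ξ
    · exact ((hkerm x).mul ((hGm.indicator (hSm j)).mul
        (ha'.measurable.comp (measurable_const.prodMk measurable_id)))).aestronglyMeasurable
    · refine Filter.Eventually.of_forall fun ξ r hr => ?_
      rw [norm_mul, norm_fourierKernel, one_mul, norm_mul]
      by_cases hξ : ξ ∈ S j
      · gcongr
        exact hQ r hr ξ hξ
      · simp [hξ]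
    · exact (hGi j).norm.mul_const Q
    · exact Filter.Eventually.of_forall fun ξ r _ => ((hd r ξ).const_mul _).const_mul _
  have hub : ∀ j x, ∀ t ∈ Set.Icc (1 : ℝ) 2, ‖u j x t‖ₑ ^ 2 ≤ b j x := by
    intro j x t ht
    obtain ⟨Q, hQ⟩ := hcb j 2
    have hm' : Measurable (u' j x) := (hum' j).of_uncurry_left
    refine enorm_sq_le_lintegral_of_hasDerivAt (hderiv j x) hm'
      (M := ∫ ξ, ‖(S j).indicator G ξ‖ * Q) (fun r hr => ?_) (by positivity) ht
    refine norm_integral_le_of_norm_le ((hGi j).norm.mul_const Q)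
      (Filter.Eventually.of_forall fun ξ => ?_)
    rw [norm_mul, norm_fourierKernel, one_mul, norm_mul]
    by_cases hξ : ξ ∈ S j
    · gcongr
      exact hQ r ⟨by linarith [hr.1], hr.2⟩ ξ hξ
    · simp [hξ]
  let P : ℕ → ℝ≥0∞ := fun j => ∫⁻ ξ in S j, ‖G ξ‖ₑ ^ 2 * ENNReal.ofReal ((1 + ‖ξ‖) ^ (-δ))
  have hbint : ∀ j, ∫⁻ x, b j x ≤ ENNReal.ofReal (K * (2 ^ j) ^ (-δ)) * v0 * P j := by
    intro j
    set q : ℝ := 2 ^ j with hq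
    have hq1 : 1 ≤ q := one_le_pow₀ one_le_two
    have hq0 : 0 < q := by linarith
    have hvol : volume (Metric.closedBall (0 : Fin n → V) (2 ^ (j + 1)))
        = ENNReal.ofReal ((2 * q) ^ N) * v0 := by
      rw [Measure.addHaar_closedBall _ _ (by positivity), Module.finrank_pi_fintype]
      congr 2
      rw [pow_succ, mul_comm, ← Real.rpow_natCast]
      simp [hN, hq]
    have hsq : ∀ ξ ∈ S j, (1 + ‖ξ‖) ^ (-s) ≤ q ^ (-s) := fun ξ hξ =>
      Real.rpow_le_rpow_of_nonpos hq0 (mem_freqShell.1 hξ).1 (by linarith)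
    have h1 := lintegral_lintegral_enorm_sq_shell_le (V := V) ha j (K := A * q ^ (-s))
      (fun t ht ξ hξ => (hA t ht ξ).trans (mul_le_mul_of_nonneg_left (hsq ξ hξ) hA0)) hGm hG
    have h2 := lintegral_lintegral_enorm_sq_shell_le (V := V) ha' j (K := B * (2 * q * q ^ (-s)))
      (fun t ht ξ hξ => (hB t ht ξ).trans (by
        rw [sub_eq_add_neg, Real.rpow_add (by positivity), Real.rpow_one]
        have h3 := (mem_freqShell.1 hξ).2.le
        rw [pow_succ, mul_comm] at h3
        exact mul_le_mul_of_nonneg_left (mul_le_mul h3 (hsq ξ hξ) (by positivity) (by positivity))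
          hB0)) hGm hG
    have h3 := lintegral_shell_enorm_sq_le G j hδ
    calc ∫⁻ x, b j x = ENNReal.ofReal (1 + q) * (∫⁻ x, ∫⁻ τ in Set.Icc (1 : ℝ) 2, ‖u j x τ‖ₑ ^ 2) +
          ENNReal.ofReal q⁻¹ * ∫⁻ x, ∫⁻ τ in Set.Icc (1 : ℝ) 2, ‖u' j x τ‖ₑ ^ 2 := by
          rw [lintegral_add_left]
          · rw [lintegral_const_mul' _ _ ENNReal.ofReal_ne_top,
              lintegral_const_mul' _ _ ENNReal.ofReal_ne_top]
          · exact ((hmeas j a ha).enorm.pow_const 2).lintegral_prod_right'.const_mul _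
      _ ≤ ENNReal.ofReal (1 + q) * (ENNReal.ofReal ((2 * q) ^ N) * v0 *
            (ENNReal.ofReal (A * q ^ (-s)) ^ 2 * (ENNReal.ofReal ((2 * q) ^ δ) * P j))) +
          ENNReal.ofReal q⁻¹ * (ENNReal.ofReal ((2 * q) ^ N) * v0 *
            (ENNReal.ofReal (B * (2 * q * q ^ (-s))) ^ 2 *
              (ENNReal.ofReal ((2 * q) ^ δ) * P j))) := by
          rw [hvol] at h1 h2
          gcongr
          · exact h1.trans (by gcongr)
          · exact h2.trans (by gcongr)
      _ = ENNReal.ofReal ((1 + q) * ((2 * q) ^ N * ((A * q ^ (-s)) ^ 2 * (2 * q) ^ δ)) +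
            q⁻¹ * ((2 * q) ^ N * ((B * (2 * q * q ^ (-s))) ^ 2 * (2 * q) ^ δ))) * v0 * P j := by
          exact (ofReal_shell_constant_mul (by positivity) (by positivity) (by positivity)
            (by positivity) (by positivity) (by positivity) _ _).symm
      _ ≤ _ := by
          gcongr
          exact shell_constant_le hq1 hsδ
  -- The shells partition frequency space, the zeroth one containing the origin because they are
  -- defined through `1 + ‖ξ‖`; no separate low-frequency term arises.
  have hUsum : ∀ x, ∀ t, ‖∫ ξ, fourierKernel (-x) (∑ i, ξ i) * (G ξ * a t ξ)‖ₑ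
      ≤ ∑' j, ‖u j x t‖ₑ := by
    intro x t
    have hint : Integrable fun ξ => fourierKernel (-x) (∑ i, ξ i) * (G ξ * a t ξ) := by
      refine (hG.norm.mul_const M).mono' ((hkerm x).mul (hGm.mul
        (ha.measurable.comp (measurable_const.prodMk measurable_id)))).aestronglyMeasurable ?_
      refine Filter.Eventually.of_forall fun ξ => ?_
      rw [norm_mul, norm_fourierKernel, one_mul, norm_mul]
      gcongr
      exact hM t ξ
    have h1 := hasSum_integral_iUnion hSm pairwise_disjoint_freqShell hint.integrableOn
    rw [iUnion_freqShell, setIntegral_univ] at h1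
    have h2 : ∀ j, ∫ ξ in S j, fourierKernel (-x) (∑ i, ξ i) * (G ξ * a t ξ) = u j x t := by
      intro j
      rw [← integral_indicator (hSm j)]
      congr 1; ext ξ
      by_cases hξ : ξ ∈ S j <;> simp [hξ]
    simp_rw [h2] at h1
    rw [← h1.tsum_eq]
    exact enorm_tsum_le_tsum_enorm
  calc _ ≤ ∫⁻ x, (∑' j, w j) * ∑' j, (w j)⁻¹ * b j x := by
        refine lintegral_mono fun x => ?_
        have h1 : ∀ t ∈ Set.Icc (1 : ℝ) 2, ‖∫ ξ, fourierKernel (-x) (∑ i, ξ i) *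
            (G ξ * a t ξ)‖ₑ ≤ ((∑' j, w j) * ∑' j, (w j)⁻¹ * b j x) ^ (1 / 2 : ℝ) := by
          intro t ht
          have h2 : ‖∫ ξ, fourierKernel (-x) (∑ i, ξ i) * (G ξ * a t ξ)‖ₑ ^ 2
              ≤ (∑' j, w j) * ∑' j, (w j)⁻¹ * b j x :=
            calc _ ≤ (∑' j, ‖u j x t‖ₑ) ^ 2 := by gcongr; exact hUsum x t
              _ ≤ (∑' j, w j) * ∑' j, (w j)⁻¹ * ‖u j x t‖ₑ ^ 2 := ENNReal.tsum_sq_le _ w hw0 hwt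
              _ ≤ _ := by gcongr with j; exact hub j x t ht
          refine le_trans (le_of_eq ?_) (ENNReal.rpow_le_rpow h2 (by norm_num : (0 : ℝ) ≤ 1 / 2))
          rw [← ENNReal.rpow_natCast, ← ENNReal.rpow_mul]
          norm_num
        calc _ ≤ (((∑' j, w j) * ∑' j, (w j)⁻¹ * b j x) ^ (1 / 2 : ℝ)) ^ 2 :=
              pow_le_pow_left₀ zero_le (iSup₂_le h1) 2
          _ = _ := by
            rw [← ENNReal.rpow_natCast, ← ENNReal.rpow_mul]
            norm_num
    _ = (∑' j, w j) * ∑' j, (w j)⁻¹ * ∫⁻ x, b j x := by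
        rw [lintegral_const_mul' _ _ hwsum, lintegral_tsum fun j =>
          ((hbm j).const_mul _).aemeasurable]
        congr 2; ext j
        rw [lintegral_const_mul _ (hbm j)]
    _ ≤ (∑' j, w j) * ∑' j, (ENNReal.ofReal K * v0) * P j := by
        refine mul_le_mul' le_rfl (ENNReal.tsum_le_tsum fun j => ?_)
        calc (w j)⁻¹ * ∫⁻ x, b j x
            ≤ (w j)⁻¹ * (ENNReal.ofReal (K * (2 ^ j) ^ (-δ)) * v0 * P j) := by
              gcongr; exact hbint j
          _ ≤ (w j)⁻¹ * (ENNReal.ofReal K * w j * v0 * P j) := by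
              gcongr
              rw [← ENNReal.ofReal_mul hK0]
              gcongr
              · exact one_le_pow₀ one_le_two
              · linarith
          _ = ((w j)⁻¹ * w j) * (ENNReal.ofReal K * v0 * P j) := by ring
          _ = _ := by rw [ENNReal.inv_mul_cancel (hw0 j) (hwt j), one_mul]
    _ = (∑' j, w j) * (ENNReal.ofReal K * v0) * ∑' j, P j := by
        rw [ENNReal.tsum_mul_left]; ring
    _ = _ := by
        rw [← lintegral_iUnion hSm pairwise_disjoint_freqShell, iUnion_freqShell,
          setLIntegral_univ]

end Core

/-! ### Fourier representation of the averages and the single-scale maximal estimate. -/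

section Representation

open FourierTransform

theorem lintegral_fin_prod_eq_prod {X : Type*} [MeasureSpace X]
    [SigmaFinite (volume : Measure X)] {n : ℕ} (f : Fin n → X → ℝ≥0∞) (hf : ∀ i, Measurable (f i)) :
    ∫⁻ x : Fin n → X, ∏ i, f i (x i) = ∏ i, ∫⁻ x, f i x := by
  induction n with
  | zero => simp [volume_pi]
  | succ n ih =>
    have h := (volume_preserving_piFinSuccAbove (fun _ : Fin (n + 1) => X) 0).symm
    have hm : Measurable fun x : Fin (n + 1) → X => ∏ i, f i (x i) :=
      Finset.measurable_prod _ fun i _ => (hf i).comp (measurable_pi_apply i)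
    have hm' : Measurable fun x : Fin n → X => ∏ i, f i.succ (x i) :=
      Finset.measurable_prod _ fun i _ => (hf _).comp (measurable_pi_apply i)
    rw [← h.lintegral_comp hm, Fin.prod_univ_succ, ← ih _ fun i => hf i.succ]
    rw [Measure.volume_eq_prod, ← lintegral_prod_mul (hf 0).aemeasurable hm'.aemeasurable]
    congr 1; ext p
    simp [Fin.prod_univ_succ, MeasurableEquiv.piFinSuccAbove, Fin.insertNthEquiv]

variable {m d : ℕ}

/-- A negative-order Sobolev norm (squared). -/
noncomputable def negSobolevSq (ε : ℝ) (g : EuclideanSpace ℝ (Fin d) → ℂ) : ℝ≥0∞ :=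
  ∫⁻ ξ, ‖𝓕 g ξ‖ₑ ^ 2 * ENNReal.ofReal ((1 + ‖ξ‖) ^ (-ε))

theorem fourierMeasure_eq (σ : Measure (ProdSpace m d)) (ξ : ProdSpace m d) :
    fourierMeasure σ ξ = ∫ y, fourierKernel y ξ ∂σ := rfl

theorem SchwartzMap.integrable_fourier (g : SchwartzMap (EuclideanSpace ℝ (Fin d)) ℂ) :
    Integrable (𝓕 (g : EuclideanSpace ℝ (Fin d) → ℂ)) := by
  rw [← SchwartzMap.fourier_coe]; exact (𝓕 g).integrable

theorem SchwartzMap.continuous_fourier (g : SchwartzMap (EuclideanSpace ℝ (Fin d)) ℂ) :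
    Continuous (𝓕 (g : EuclideanSpace ℝ (Fin d) → ℂ)) := by
  rw [← SchwartzMap.fourier_coe]; exact (𝓕 g).continuous

/-- Separates the roles of `x` and `t`: the position only sees the total frequency, which is what
the diagonal estimate requires, and the dilation only enters through the multiplier `σ̂(tξ)`. -/
theorem prod_fourierKernel (x : EuclideanSpace ℝ (Fin d)) (t : ℝ) (y : ProdSpace m d)
    (ξ : Fin m → EuclideanSpace ℝ (Fin d)) :
    ∏ i, fourierKernel (-(x - t • y i)) (ξ i) =
      fourierKernel (-x) (∑ i, ξ i) * fourierKernel y (t • WithLp.toLp 2 ξ) := by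
  have h1 : fourierKernel (-x) (∑ i, ξ i) = ∏ i, fourierKernel (-x) (ξ i) := by
    induction (Finset.univ : Finset (Fin m)) using Finset.induction_on with
    | empty => simp
    | insert i s hi ih => rw [Finset.sum_insert hi, Finset.prod_insert hi, fourierKernel_add_right, ih]
  have h2 : fourierKernel y (t • WithLp.toLp 2 ξ) = ∏ i, fourierKernel (t • y i) (ξ i) := by
    have h3 : ⟪y, t • (WithLp.toLp 2 ξ : ProdSpace m d)⟫ = ∑ i, t * ⟪y i, ξ i⟫ := by
      rw [real_inner_smul_right, PiLp.inner_apply, Finset.mul_sum]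
    simp only [fourierKernel, ← Complex.exp_sum, h3, real_inner_smul_left]
    congr 1
    rw [← Finset.sum_mul]
    congr 1
    push_cast
    rw [Finset.mul_sum, ← Finset.sum_neg_distrib]
  rw [h1, h2, ← Finset.prod_mul_distrib]
  refine Finset.prod_congr rfl fun i _ => ?_
  rw [← fourierKernel_add_left]
  congr 1
  abel

/-- Fourier representation of the multilinear average. -/
theorem multAverage_eq_integral_fourier (σ : Measure (ProdSpace m d)) [IsFiniteMeasure σ]
    (g : Fin m → SchwartzMap (EuclideanSpace ℝ (Fin d)) ℂ) (x : EuclideanSpace ℝ (Fin d)) (t : ℝ) :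
    multAverage σ (fun i => g i) x t =
      ∫ ξ : Fin m → EuclideanSpace ℝ (Fin d), fourierKernel (-x) (∑ i, ξ i) *
        ((∏ i, 𝓕 (g i : EuclideanSpace ℝ (Fin d) → ℂ) (ξ i)) *
          fourierMeasure σ (t • WithLp.toLp 2 ξ)) := by
  have hG : Integrable fun ξ : Fin m → EuclideanSpace ℝ (Fin d) =>
      ∏ i, 𝓕 (g i : EuclideanSpace ℝ (Fin d) → ℂ) (ξ i) :=
    Integrable.fintype_prod fun i => (g i).integrable_fourier
  calc multAverage σ (fun i => g i) x t
      = ∫ y, (∫ ξ : Fin m → EuclideanSpace ℝ (Fin d), fourierKernel (-x) (∑ i, ξ i) *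
          fourierKernel y (t • WithLp.toLp 2 ξ) *
            ∏ i, 𝓕 (g i : EuclideanSpace ℝ (Fin d) → ℂ) (ξ i)) ∂σ := by
        unfold multAverage
        congr 1; ext y
        simp_rw [← prod_fourierKernel, ← Finset.prod_mul_distrib]
        rw [integral_fintype_prod_volume_eq_prod fun i ξ =>
          fourierKernel (-(x - t • y i)) ξ * 𝓕 (g i : EuclideanSpace ℝ (Fin d) → ℂ) ξ]
        exact Finset.prod_congr rfl fun i _ => (g i).eq_integral_fourierKernel _
    _ = ∫ ξ : Fin m → EuclideanSpace ℝ (Fin d), (∫ y, fourierKernel (-x) (∑ i, ξ i) *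
          fourierKernel y (t • WithLp.toLp 2 ξ) *
            ∏ i, 𝓕 (g i : EuclideanSpace ℝ (Fin d) → ℂ) (ξ i) ∂σ) := by
        apply integral_integral_swap
        have h1 : Integrable (fun p : ProdSpace m d × (Fin m → EuclideanSpace ℝ (Fin d)) =>
            (1 : ℂ) * ∏ i, 𝓕 (g i : EuclideanSpace ℝ (Fin d) → ℂ) (p.2 i)) (σ.prod volume) :=
          (integrable_const (1 : ℂ)).mul_prod hG
        refine h1.mono (AEStronglyMeasurable.mul ?_ hG.aestronglyMeasurable.comp_snd) ?_
        · exact Continuous.aestronglyMeasurable (by fun_prop)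
        · exact Filter.Eventually.of_forall fun p => by simp [Function.uncurry]
    _ = _ := by
        congr 1; ext ξ
        rw [fourierMeasure_eq, integral_mul_const, integral_const_mul]
        ring

theorem continuous_fourierMeasure (σ : Measure (ProdSpace m d)) [IsFiniteMeasure σ] :
    Continuous (fourierMeasure σ) := by
  refine continuous_of_dominated (F := fun ξ y => fourierKernel y ξ) (bound := fun _ => (1 : ℝ))
    (fun ξ => ?_) (fun ξ => ?_) (integrable_const _) ?_
  · exact Continuous.aestronglyMeasurable (by fun_prop)
  · exact Filter.Eventually.of_forall fun y => by simp
  · exact Filter.Eventually.of_forall fun y => by fun_prop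

theorem norm_le_norm_toLp (ξ : Fin m → EuclideanSpace ℝ (Fin d)) :
    ‖ξ‖ ≤ ‖(WithLp.toLp 2 ξ : ProdSpace m d)‖ :=
  (pi_norm_le_iff_of_nonneg (norm_nonneg _)).2 fun i =>
    PiLp.norm_apply_le (WithLp.toLp 2 ξ : ProdSpace m d) i

theorem norm_fourierMeasure_le (σ : Measure (ProdSpace m d)) [IsFiniteMeasure σ]
    (ξ : ProdSpace m d) : ‖fourierMeasure σ ξ‖ ≤ σ.real Set.univ := by
  rw [fourierMeasure_eq]
  refine (norm_integral_le_integral_norm _).trans ?_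
  simp

/-- Single-scale `L²` maximal bound with a gain of negative Sobolev norms. -/
theorem exists_lintegral_iSup_multAverage_sq_le (hm : 2 ≤ m) (hd : 1 ≤ d) {s : ℝ}
    (hs : ((m : ℝ) - 1) * (d : ℝ) / 2 + 1 / 2 < s)
    (σ : Measure (ProdSpace m d)) [IsFiniteMeasure σ]
    (hsupp : σ (Metric.closedBall (0 : ProdSpace m d) 1)ᶜ = 0)
    (hdecay : HasFourierDecay σ s) :
    ∃ ε : ℝ, 0 < ε ∧ ∃ C : ℝ≥0, ∀ g : Fin m → SchwartzMap (EuclideanSpace ℝ (Fin d)) ℂ,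
      ∫⁻ x, (⨆ t ∈ Set.Icc (1 : ℝ) 2, ‖multAverage σ (fun i => g i) x t‖ₑ) ^ 2 ≤
        C * ∏ i, negSobolevSq ε (g i) := by
  obtain ⟨n, rfl⟩ : ∃ n, m = n + 1 := ⟨m - 1, by omega⟩
  obtain ⟨A, hA⟩ := hdecay
  have hn1 : (1 : ℝ) ≤ n := by exact_mod_cast (by omega : 1 ≤ n)
  have hd1 : (1 : ℝ) ≤ d := by exact_mod_cast hd
  push_cast at hs
  -- With `m ≥ 2` and `d ≥ 1` the threshold is at least `1`. This makes the exponent `1 - s` of the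
  -- derivative bound nonpositive, so that the Euclidean norm can be replaced by the smaller
  -- supremum norm.
  have hs1 : 1 ≤ s := by nlinarith
  set δ : ℝ := (2 * s - 1 - n * d) / 2 with hδ
  have hδ0 : 0 < δ := by
    rw [hδ]; linarith
  have hA0 : 0 ≤ A := by
    have := (norm_nonneg _).trans (hA 0)
    simpa using this
  obtain ⟨a', ha'c, ha'd, B, hB0, hB⟩ := exists_hasDerivAt_integral_fourierKernel hsupp
    (by linarith : 0 ≤ s) hA
  have htoLp : Continuous fun ξ : Fin (n + 1) → EuclideanSpace ℝ (Fin d) =>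
      (WithLp.toLp 2 ξ : ProdSpace (n + 1) d) := PiLp.continuous_toLp 2 _
  have key := exists_lintegral_iSup_enorm_sq_le (V := EuclideanSpace ℝ (Fin d)) (n := n)
    (a := fun t ξ => fourierMeasure σ (t • WithLp.toLp 2 ξ))
    (a' := fun t ξ => a' t (WithLp.toLp 2 ξ)) (s := s) (δ := δ) (A := A) (B := B)
    (M := σ.real Set.univ) ?_ ?_ ?_ ?_ (by linarith) hA0 hB0 ?_ ?_ hδ0 ?_
  · obtain ⟨C, hC⟩ := key
    -- The joint weight `(1 + ‖ξ‖)^(-δ)` is shared equally among the `m = n + 1` variables, using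
    -- `‖ξᵢ‖ ≤ ‖ξ‖`.
    refine ⟨δ / ((n + 1 : ℕ) : ℝ), by positivity, C, fun g => ?_⟩
    simp_rw [multAverage_eq_integral_fourier]
    refine (hC _ ?_ ?_).trans ?_
    · exact Finset.measurable_prod _ fun i _ =>
        ((g i).continuous_fourier.measurable).comp (measurable_pi_apply i)
    · exact Integrable.fintype_prod fun i => (g i).integrable_fourier
    · gcongr
      simp only [negSobolevSq]
      rw [← lintegral_fin_prod_eq_prod]
      · refine lintegral_mono fun ξ => ?_
        rw [Finset.prod_mul_distrib, Finset.prod_pow, ← ofReal_norm, norm_prod,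
          ENNReal.ofReal_prod_of_nonneg fun i _ => norm_nonneg _]
        simp only [ofReal_norm]
        gcongr
        rw [← ENNReal.ofReal_prod_of_nonneg fun i _ => by positivity]
        apply ENNReal.ofReal_le_ofReal
        have e : (1 + ‖ξ‖) ^ (-δ) = ∏ i : Fin (n + 1), (1 + ‖ξ‖) ^ (-(δ / ((n + 1 : ℕ) : ℝ))) := by
          rw [Finset.prod_const, ← Real.rpow_natCast, ← Real.rpow_mul (by positivity)]
          congr 1
          rw [Finset.card_univ, Fintype.card_fin]
          field_simp
        rw [e]
        refine Finset.prod_le_prod (fun i _ => by positivity) fun i _ => ?_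
        refine Real.rpow_le_rpow_of_nonpos (by positivity) ?_ ?_
        · linarith [norm_le_pi_norm ξ i]
        · have : 0 ≤ δ / ((n + 1 : ℕ) : ℝ) := by positivity
          linarith
      · intro i
        exact ((g i).continuous_fourier.measurable.enorm.pow_const 2).mul (by fun_prop)
  · exact (continuous_fourierMeasure σ).comp (continuous_fst.smul (htoLp.comp continuous_snd))
  · exact ha'c.comp (continuous_fst.prodMk (htoLp.comp continuous_snd))
  · exact fun t ξ => ha'd t _
  · exact fun t ξ => norm_fourierMeasure_le σ _
  · intro t ht ξ
    refine (hA _).trans ?_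
    gcongr ?_ * ?_
    refine Real.rpow_le_rpow_of_nonpos (by positivity) ?_ (by linarith)
    rw [norm_smul, Real.norm_of_nonneg (by linarith [ht.1])]
    have h1 := norm_le_norm_toLp ξ
    nlinarith [ht.1, norm_nonneg ξ]
  · intro t ht ξ
    refine (hB t ht.1 _).trans ?_
    gcongr ?_ * ?_
    refine Real.rpow_le_rpow_of_nonpos (by positivity) ?_ (by linarith)
    linarith [norm_le_norm_toLp ξ]
  · rw [finrank_euclideanSpace_fin, hδ]; ring

end Representation

/-! ### Negative Sobolev norms under localization to unit scale. -/

section NegSobolev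

open FourierTransform

variable {d : ℕ}

theorem SchwartzMap.lintegral_enorm_sq_fourier (g : SchwartzMap (EuclideanSpace ℝ (Fin d)) ℂ) :
    ∫⁻ ξ, ‖𝓕 (g : EuclideanSpace ℝ (Fin d) → ℂ) ξ‖ₑ ^ 2 = ∫⁻ x, ‖g x‖ₑ ^ 2 :=
  lintegral_enorm_fourier_sq g.integrable (g.memLp 2)

theorem negSobolevSq_le_lintegral {ε : ℝ} (hε : 0 ≤ ε)
    (g : SchwartzMap (EuclideanSpace ℝ (Fin d)) ℂ) :
    negSobolevSq ε g ≤ ∫⁻ x, ‖g x‖ₑ ^ 2 := by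
  rw [← g.lintegral_enorm_sq_fourier]
  refine lintegral_mono fun ξ => ?_
  refine mul_le_of_le_one_right' ?_
  rw [← ENNReal.ofReal_one]
  apply ENNReal.ofReal_le_ofReal
  exact Real.rpow_le_one_of_one_le_of_nonpos (by linarith [norm_nonneg ξ]) (by linarith)

/-- The Fourier transform of a translated cutoff of `h`, as a function of the translation. -/
theorem fourier_translate_mul (χ h : SchwartzMap (EuclideanSpace ℝ (Fin d)) ℂ)
    (z ξ : EuclideanSpace ℝ (Fin d)) :
    𝓕 (fun x => χ (x - z) * h x) ξ =
      𝓕 (fun η => 𝓕 (χ : EuclideanSpace ℝ (Fin d) → ℂ) η *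
        𝓕 (h : EuclideanSpace ℝ (Fin d) → ℂ) (ξ - η)) z := by
  rw [fourier_eq_integral_fourierKernel, fourier_eq_integral_fourierKernel]
  calc ∫ x, fourierKernel x ξ * (χ (x - z) * h x)
      = ∫ x, ∫ η, fourierKernel η z * 𝓕 (χ : EuclideanSpace ℝ (Fin d) → ℂ) η *
          (fourierKernel x (ξ - η) * h x) := by
        congr 1; ext x
        rw [χ.eq_integral_fourierKernel, mul_left_comm, ← integral_mul_const]
        congr 1; ext η
        rw [neg_sub, sub_eq_add_neg z x, fourierKernel_add_left, sub_eq_add_neg ξ η,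
          fourierKernel_add_right, fourierKernel_neg_comm, fourierKernel_comm z η]
        ring
    _ = ∫ η, ∫ x, fourierKernel η z * 𝓕 (χ : EuclideanSpace ℝ (Fin d) → ℂ) η *
          (fourierKernel x (ξ - η) * h x) := by
        apply integral_integral_swap
        have h1 : Integrable (fun p : EuclideanSpace ℝ (Fin d) × EuclideanSpace ℝ (Fin d) =>
            h p.1 * 𝓕 (χ : EuclideanSpace ℝ (Fin d) → ℂ) p.2) (volume.prod volume) :=
          h.integrable.mul_prod χ.integrable_fourier
        refine h1.mono (AEStronglyMeasurable.mul (AEStronglyMeasurable.mul ?_ ?_)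
          (AEStronglyMeasurable.mul ?_ ?_)) ?_
        · exact Continuous.aestronglyMeasurable (by fun_prop)
        · exact (χ.continuous_fourier.comp continuous_snd).aestronglyMeasurable
        · exact Continuous.aestronglyMeasurable (by fun_prop)
        · exact (h.continuous.comp continuous_fst).aestronglyMeasurable
        · exact Filter.Eventually.of_forall fun p => by
            simp [Function.uncurry, mul_comm]
    _ = _ := by
        congr 1; ext η
        rw [integral_const_mul, ← fourier_eq_integral_fourierKernel, mul_assoc]

/-- Localizing at unit scale and averaging over the position of the cutoff does not destroy
negative Sobolev norms. -/
theorem exists_lintegral_negSobolevSq_translate_le {ε : ℝ} (hε : 0 ≤ ε)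
    (χ : SchwartzMap (EuclideanSpace ℝ (Fin d)) ℂ) :
    ∃ C : ℝ≥0, ∀ h : SchwartzMap (EuclideanSpace ℝ (Fin d)) ℂ,
      ∫⁻ z, negSobolevSq ε (fun x => χ (x - z) * h x) ≤ C * negSobolevSq ε h := by
  have hfin : ∫⁻ η, ‖𝓕 (χ : EuclideanSpace ℝ (Fin d) → ℂ) η‖ₑ ^ 2 *
      ENNReal.ofReal ((1 + ‖η‖) ^ ε) ≠ ∞ := by
    obtain ⟨K, -, hK⟩ := (𝓕 χ).decay 0 0
    have hi := ((𝓕 χ).integrable_one_add_norm_rpow_mul ε).const_mul K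
    refine ((lintegral_mono fun η => ?_).trans_lt hi.lintegral_lt_top).ne
    have h1 : ‖𝓕 (χ : EuclideanSpace ℝ (Fin d) → ℂ) η‖ ≤ K := by
      simpa [SchwartzMap.fourier_coe] using hK η
    rw [← ofReal_norm, ← ENNReal.ofReal_pow (norm_nonneg _), ← ENNReal.ofReal_mul (by positivity)]
    apply ENNReal.ofReal_le_ofReal
    rw [SchwartzMap.fourier_coe, sq, mul_assoc]
    have := norm_nonneg (𝓕 (χ : EuclideanSpace ℝ (Fin d) → ℂ) η)
    rw [mul_comm ‖𝓕 (χ : EuclideanSpace ℝ (Fin d) → ℂ) η‖ ((1 + ‖η‖) ^ ε)]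
    gcongr
  refine ⟨(∫⁻ η, ‖𝓕 (χ : EuclideanSpace ℝ (Fin d) → ℂ) η‖ₑ ^ 2 *
      ENNReal.ofReal ((1 + ‖η‖) ^ ε)).toNNReal, fun h => ?_⟩
  rw [ENNReal.coe_toNNReal hfin]
  have hχc := χ.continuous_fourier
  have hhc := h.continuous_fourier
  have hm1 : Measurable fun p : EuclideanSpace ℝ (Fin d) × EuclideanSpace ℝ (Fin d) =>
      𝓕 (fun x => χ (x - p.1) * h x) p.2 := by
    simp_rw [fourier_eq_integral_fourierKernel]
    refine (StronglyMeasurable.integral_prod_right' (ν := volume)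
      (f := fun q : (EuclideanSpace ℝ (Fin d) × EuclideanSpace ℝ (Fin d)) ×
        EuclideanSpace ℝ (Fin d) => fourierKernel q.2 q.1.2 * (χ (q.2 - q.1.1) * h q.2))
      (Continuous.stronglyMeasurable ?_)).measurable
    have := χ.continuous
    have := h.continuous
    fun_prop
  unfold negSobolevSq
  rw [lintegral_lintegral_swap]
  swap
  · exact ((hm1.enorm.pow_const 2).mul (by fun_prop)).aemeasurable
  -- For fixed `ξ` the localized transform is itself a Fourier transform in the position `z`, so
  -- Plancherel in `z` replaces the convolution by a product without cross terms.
  have key : ∀ ξ, ∫⁻ z, ‖𝓕 (fun x => χ (x - z) * h x) ξ‖ₑ ^ 2 *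
      ENNReal.ofReal ((1 + ‖ξ‖) ^ (-ε)) =
      ∫⁻ η, ‖𝓕 (χ : EuclideanSpace ℝ (Fin d) → ℂ) η‖ₑ ^ 2 *
        (‖𝓕 (h : EuclideanSpace ℝ (Fin d) → ℂ) (ξ - η)‖ₑ ^ 2 *
        ENNReal.ofReal ((1 + ‖ξ‖) ^ (-ε))) := by
    intro ξ
    obtain ⟨K, -, hK⟩ := (𝓕 h).decay 0 0
    have hb : ∀ η, ‖𝓕 (h : EuclideanSpace ℝ (Fin d) → ℂ) (ξ - η)‖ ≤ K := fun η => by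
      simpa [SchwartzMap.fourier_coe] using hK (ξ - η)
    have hcc : Continuous fun η => 𝓕 (χ : EuclideanSpace ℝ (Fin d) → ℂ) η *
        𝓕 (h : EuclideanSpace ℝ (Fin d) → ℂ) (ξ - η) := by fun_prop
    have hpt : ∀ η, ‖𝓕 (χ : EuclideanSpace ℝ (Fin d) → ℂ) η *
        𝓕 (h : EuclideanSpace ℝ (Fin d) → ℂ) (ξ - η)‖ ≤
          ‖(K : ℂ) * 𝓕 (χ : EuclideanSpace ℝ (Fin d) → ℂ) η‖ := by
      intro η
      rw [norm_mul, norm_mul, mul_comm, Complex.norm_real]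
      gcongr
      exact (hb η).trans (Real.le_norm_self K)
    have hi : Integrable fun η => 𝓕 (χ : EuclideanSpace ℝ (Fin d) → ℂ) η *
        𝓕 (h : EuclideanSpace ℝ (Fin d) → ℂ) (ξ - η) :=
      (χ.integrable_fourier.const_mul (K : ℂ)).mono hcc.aestronglyMeasurable
        (Filter.Eventually.of_forall hpt)
    have hχ2 : MemLp (𝓕 (χ : EuclideanSpace ℝ (Fin d) → ℂ)) 2 := by
      rw [← SchwartzMap.fourier_coe]; exact (𝓕 χ).memLp 2
    have hi2 : MemLp (fun η => 𝓕 (χ : EuclideanSpace ℝ (Fin d) → ℂ) η *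
        𝓕 (h : EuclideanSpace ℝ (Fin d) → ℂ) (ξ - η)) 2 :=
      (hχ2.const_mul (K : ℂ)).mono hcc.aestronglyMeasurable (Filter.Eventually.of_forall hpt)
    rw [lintegral_mul_const' _ _ ENNReal.ofReal_ne_top]
    simp_rw [fourier_translate_mul χ h _ ξ]
    rw [lintegral_enorm_fourier_sq hi hi2, ← lintegral_mul_const' _ _ ENNReal.ofReal_ne_top]
    congr 1; ext η
    rw [enorm_mul, mul_pow, mul_assoc]
  simp_rw [key]
  rw [lintegral_lintegral_swap]
  swap
  · simp only [Function.uncurry_def]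
    have h1 : Measurable fun p : EuclideanSpace ℝ (Fin d) × EuclideanSpace ℝ (Fin d) =>
        𝓕 (χ : EuclideanSpace ℝ (Fin d) → ℂ) p.2 := hχc.measurable.comp measurable_snd
    have h2 : Measurable fun p : EuclideanSpace ℝ (Fin d) × EuclideanSpace ℝ (Fin d) =>
        𝓕 (h : EuclideanSpace ℝ (Fin d) → ℂ) (p.1 - p.2) :=
      hhc.measurable.comp (measurable_fst.sub measurable_snd)
    fun_prop
  have hhm : Measurable fun ζ => ‖𝓕 (h : EuclideanSpace ℝ (Fin d) → ℂ) ζ‖ₑ ^ 2 :=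
    hhc.measurable.enorm.pow_const 2
  have hχm : Measurable fun η => ‖𝓕 (χ : EuclideanSpace ℝ (Fin d) → ℂ) η‖ₑ ^ 2 *
      ENNReal.ofReal ((1 + ‖η‖) ^ ε) := (hχc.measurable.enorm.pow_const 2).mul (by fun_prop)
  rw [← lintegral_mul_const _ hχm]
  refine lintegral_mono fun η => ?_
  rw [lintegral_const_mul' _ _ (by finiteness), mul_assoc]
  gcongr
  rw [← lintegral_add_right_eq_self _ η, ← lintegral_const_mul' _ _ ENNReal.ofReal_ne_top]
  refine lintegral_mono fun ζ => ?_
  rw [add_sub_cancel_right, mul_left_comm]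
  gcongr
  rw [← ENNReal.ofReal_mul (by positivity)]
  apply ENNReal.ofReal_le_ofReal
  -- With `ξ = ζ + η`, Peetre's inequality moves the weight onto `ζ`, and the loss `(1 + ‖η‖)^ε` is
  -- integrable against `‖𝓕 χ η‖²`.
  have := one_add_norm_sub_rpow_neg_le hε ζ (-η)
  rw [sub_neg_eq_add, norm_neg] at this
  linarith

end NegSobolev

/-! ### Splitting at unit scale and orthogonality between scales. -/

section LowFrequency

open FourierTransform ContinuousLinearMap
open scoped Convolution

variable {d : ℕ}

/-- Smooth compactly supported functions. -/
def IsTestFunction (f : EuclideanSpace ℝ (Fin d) → ℂ) : Prop :=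
  ContDiff ℝ (⊤ : ℕ∞) f ∧ HasCompactSupport f

namespace IsTestFunction

variable {f g : EuclideanSpace ℝ (Fin d) → ℂ}

/-- A test function as a Schwartz function. -/
noncomputable def toSchwartz (hf : IsTestFunction f) : SchwartzMap (EuclideanSpace ℝ (Fin d)) ℂ :=
  hf.2.toSchwartzMap hf.1

theorem continuous (hf : IsTestFunction f) : Continuous f := hf.1.continuous

theorem integrable (hf : IsTestFunction f) : Integrable f := hf.toSchwartz.integrable

theorem exists_bound (hf : IsTestFunction f) : ∃ K, ∀ x, ‖f x‖ ≤ K :=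
  hf.2.exists_bound_of_continuous hf.continuous

theorem sub (hf : IsTestFunction f) (hg : IsTestFunction g) :
    IsTestFunction fun x => f x - g x :=
  ⟨hf.1.sub hg.1, hf.2.sub hg.2⟩

theorem mul_left (hf : IsTestFunction f) (hg : ContDiff ℝ (⊤ : ℕ∞) g) :
    IsTestFunction fun x => g x * f x :=
  ⟨hg.mul hf.1, hf.2.mul_left⟩

theorem comp_smul (hf : IsTestFunction f) {r : ℝ} (hr : r ≠ 0) :
    IsTestFunction fun x => f (r • x) :=
  ⟨hf.1.comp (contDiff_const_smul r), hf.2.comp_homeomorph (Homeomorph.smulOfNeZero r hr)⟩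

end IsTestFunction

/-- A fixed smooth bump function supported in the unit ball. -/
noncomputable def unitBump (d : ℕ) : ContDiffBump (0 : EuclideanSpace ℝ (Fin d)) :=
  ⟨1 / 2, 1, by norm_num, by norm_num⟩

/-- The normalized bump function as a complex-valued function. -/
noncomputable def unitMollifier (d : ℕ) (x : EuclideanSpace ℝ (Fin d)) : ℂ :=
  ((unitBump d).normed volume x : ℝ)

/-- The average of `f` at unit scale. -/
noncomputable def lowPart (f : EuclideanSpace ℝ (Fin d) → ℂ) : EuclideanSpace ℝ (Fin d) → ℂ :=
  (unitBump d).normed volume ⋆[lsmul ℝ ℝ, volume] f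

theorem lowPart_apply (f : EuclideanSpace ℝ (Fin d) → ℂ) (x : EuclideanSpace ℝ (Fin d)) :
    lowPart f x = ∫ y, unitMollifier d y * f (x - y) := by
  simp [lowPart, convolution, unitMollifier]

theorem IsTestFunction.lowPart {f : EuclideanSpace ℝ (Fin d) → ℂ} (hf : IsTestFunction f) :
    IsTestFunction (lowPart f) :=
  ⟨(unitBump d).hasCompactSupport_normed.contDiff_convolution_left _ (unitBump d).contDiff_normed
    hf.integrable.locallyIntegrable, (unitBump d).hasCompactSupport_normed.convolution _ hf.2⟩

theorem integrable_unitMollifier : Integrable (unitMollifier d) :=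
  (unitBump d).integrable_normed.ofReal

theorem fourier_lowPart {f : EuclideanSpace ℝ (Fin d) → ℂ} (hf : Integrable f)
    (ξ : EuclideanSpace ℝ (Fin d)) :
    𝓕 (lowPart f) ξ = 𝓕 (unitMollifier d) ξ * 𝓕 f ξ := by
  have h := Real.fourier_smul_convolution_eq (integrable_unitMollifier (d := d)) hf ξ
  rw [smul_eq_mul] at h
  rw [← h]
  congr 1

theorem norm_fourierKernel_sub_one_le (y ξ : EuclideanSpace ℝ (Fin d)) :
    ‖fourierKernel y ξ - 1‖ ≤ 2 * Real.pi * (‖y‖ * ‖ξ‖) := by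
  have h := Real.norm_exp_I_mul_ofReal_sub_one_le (x := -(2 * Real.pi * ⟪y, ξ⟫))
  have e : fourierKernel y ξ = Complex.exp (Complex.I * (-(2 * Real.pi * ⟪y, ξ⟫) : ℝ)) := by
    rw [fourierKernel, mul_comm]; push_cast; rfl
  rw [e]
  refine h.trans ?_
  rw [norm_neg, norm_mul, Real.norm_of_nonneg (by positivity)]
  gcongr
  exact norm_inner_le_norm y ξ

/-- The mollifier is nonnegative with integral one, so the left side is an average of `1 - e^{-2πi
y·ξ}` over the unit ball. Its smallness near `ξ = 0` is what makes the remainders at different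
scales nearly orthogonal. -/
theorem norm_one_sub_fourier_unitMollifier_le (ξ : EuclideanSpace ℝ (Fin d)) :
    ‖1 - 𝓕 (unitMollifier d) ξ‖ ≤ min 2 (2 * Real.pi * ‖ξ‖) := by
  have h1 : (1 : ℂ) = ∫ y, unitMollifier d y := by
    simp only [unitMollifier]
    rw [integral_complex_ofReal, (unitBump d).integral_normed, Complex.ofReal_one]
  have hi : Integrable fun y => fourierKernel y ξ * unitMollifier d y := by
    refine integrable_unitMollifier.mono ((Continuous.aestronglyMeasurable (by fun_prop)).mul
      integrable_unitMollifier.aestronglyMeasurable) (Filter.Eventually.of_forall fun y => by simp)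
  have h2 : 1 - 𝓕 (unitMollifier d) ξ = ∫ y, (1 - fourierKernel y ξ) * unitMollifier d y := by
    rw [fourier_eq_integral_fourierKernel]
    conv_lhs => rw [h1]
    rw [← integral_sub integrable_unitMollifier hi]
    congr 1; ext y; ring
  have hn : ∀ y, ‖unitMollifier d y‖ = (unitBump d).normed volume y := fun y => by
    rw [unitMollifier, Complex.norm_real, Real.norm_of_nonneg ((unitBump d).nonneg_normed y)]
  have key : ∀ c : ℝ, (∀ y, ‖y‖ ≤ 1 → ‖1 - fourierKernel y ξ‖ ≤ c) →
      ‖1 - 𝓕 (unitMollifier d) ξ‖ ≤ c := by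
    intro c hc
    rw [h2]
    calc _ ≤ ∫ y, c * (unitBump d).normed volume y := by
          refine norm_integral_le_of_norm_le ((unitBump d).integrable_normed.const_mul c)
            (Filter.Eventually.of_forall fun y => ?_)
          rw [norm_mul, hn]
          by_cases hy : y ∈ Function.support ((unitBump d).normed volume)
          · rw [(unitBump d).support_normed_eq, mem_ball_zero_iff] at hy
            have := (unitBump d).nonneg_normed (μ := volume) y
            gcongr
            exact hc y hy.le
          · rw [Function.notMem_support] at hy
            simp [hy]
      _ = c := by
          rw [integral_const_mul, (unitBump d).integral_normed, mul_one]
  refine le_min (key 2 fun y _ => ?_) (key _ fun y hy => ?_)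
  · refine (norm_sub_le _ _).trans ?_
    simp; norm_num
  · rw [norm_sub_rev]
    refine (norm_fourierKernel_sub_one_le y ξ).trans ?_
    have := Real.pi_pos
    gcongr
    exact mul_le_of_le_one_left (norm_nonneg _) hy

/-- Weight of the square function associated with `f - lowPart f` and a negative Sobolev norm. -/
noncomputable def lpWeight (ε : ℝ) (ξ : EuclideanSpace ℝ (Fin d)) : ℝ≥0∞ :=
  ENNReal.ofReal ((min 2 (2 * Real.pi * ‖ξ‖)) ^ 2 * (1 + ‖ξ‖) ^ (-ε))

theorem measurable_lpWeight (ε : ℝ) :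
    Measurable (lpWeight ε : EuclideanSpace ℝ (Fin d) → ℝ≥0∞) := by
  unfold lpWeight; fun_prop

theorem negSobolevSq_sub_lowPart_le {f : EuclideanSpace ℝ (Fin d) → ℂ} (hf : IsTestFunction f)
    (ε : ℝ) :
    negSobolevSq ε (fun x => f x - lowPart f x) ≤ ∫⁻ ξ, ‖𝓕 f ξ‖ₑ ^ 2 * lpWeight ε ξ := by
  refine lintegral_mono fun ξ => ?_
  have h : 𝓕 (fun x => f x - lowPart f x) ξ = (1 - 𝓕 (unitMollifier d) ξ) * 𝓕 f ξ := by
    rw [sub_mul, one_mul, ← fourier_lowPart hf.integrable]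
    simp only [fourier_eq_integral_fourierKernel]
    have hi : ∀ {g : EuclideanSpace ℝ (Fin d) → ℂ}, Integrable g →
        Integrable fun y => fourierKernel y ξ * g y := fun hg =>
      hg.mono ((Continuous.aestronglyMeasurable (by fun_prop)).mul hg.aestronglyMeasurable)
        (Filter.Eventually.of_forall fun y => by simp)
    rw [← integral_sub (hi hf.integrable) (hi hf.lowPart.integrable)]
    congr 1; ext y; ring
  rw [h, enorm_mul, mul_pow, mul_comm (‖_‖ₑ ^ 2), mul_assoc]
  gcongr
  rw [lpWeight, ← ofReal_norm, ← ENNReal.ofReal_pow (norm_nonneg _), ENNReal.ofReal_mul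
    (by positivity)]
  gcongr
  exact norm_one_sub_fourier_unitMollifier_le ξ

/-- The weight is `O(‖ξ‖²)` near the origin and `O(‖ξ‖^(-ε))` at infinity, so along dyadic dilates
it is dominated by two geometric series with the common rate `γ = min ε 2`. -/
theorem exists_tsum_lpWeight_le {ε : ℝ} (hε : 0 < ε) :
    ∃ C : ℝ≥0, ∀ ξ : EuclideanSpace ℝ (Fin d), ∑' k : ℤ, lpWeight ε ((2 : ℝ) ^ k • ξ) ≤ C := by
  set γ := min ε 2 with hγ
  have hγ0 : 0 < γ := lt_min hε two_pos
  set a : ℝ := (2 : ℝ) ^ (-γ) with ha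
  have ha0 : 0 < a := by positivity
  have ha1 : a < 1 := Real.rpow_lt_one_of_one_lt_of_neg one_lt_two (by linarith)
  have hpi := Real.pi_pos
  have hsmall : ∀ r : ℝ, 0 < r → r ≤ 1 →
      (min 2 (2 * Real.pi * r)) ^ 2 * (1 + r) ^ (-ε) ≤ 64 * r ^ γ := by
    intro r hr hr1
    have h1 : (min 2 (2 * Real.pi * r)) ^ 2 ≤ (2 * Real.pi * r) ^ 2 := by
      gcongr; exact min_le_right _ _
    have h2 : (1 + r) ^ (-ε) ≤ 1 := Real.rpow_le_one_of_one_le_of_nonpos (by linarith) (by linarith)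
    have h3 : r ^ (2 : ℝ) ≤ r ^ γ := Real.rpow_le_rpow_of_exponent_ge hr hr1 (min_le_right _ _)
    rw [Real.rpow_two] at h3
    have h4 : Real.pi ^ 2 ≤ 16 := by nlinarith [Real.pi_le_four]
    calc _ ≤ (2 * Real.pi * r) ^ 2 * 1 := by gcongr
      _ = 4 * Real.pi ^ 2 * r ^ 2 := by ring
      _ ≤ 4 * 16 * r ^ γ := by gcongr
      _ = _ := by ring
  have hlarge : ∀ r : ℝ, 1 ≤ r →
      (min 2 (2 * Real.pi * r)) ^ 2 * (1 + r) ^ (-ε) ≤ 64 * r ^ (-γ) := by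
    intro r hr
    have h0 : 0 ≤ min 2 (2 * Real.pi * r) := le_min (by norm_num) (by positivity)
    have h1 : (min 2 (2 * Real.pi * r)) ^ 2 ≤ 2 ^ 2 := by
      gcongr; exact min_le_left _ _
    have h2 : (1 + r) ^ (-ε) ≤ r ^ (-ε) :=
      Real.rpow_le_rpow_of_nonpos (by linarith) (by linarith) (by linarith)
    have h3 : r ^ (-ε) ≤ r ^ (-γ) :=
      Real.rpow_le_rpow_of_exponent_le hr (neg_le_neg (min_le_left _ _))
    calc _ ≤ 2 ^ 2 * r ^ (-γ) := by gcongr; exact h2.trans h3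
      _ ≤ _ := by gcongr; norm_num
  have hS : (∑' n : ℕ, ENNReal.ofReal (a ^ n)) ≠ ∞ :=
    Summable.tsum_ofReal_ne_top (summable_geometric_of_lt_one ha0.le ha1)
  -- Here `64 = 4 · 16` uses `π ≤ 4`, and `2 ^ γ` pays for knowing the norm of the dilate only up to
  -- a factor two.
  set K : ℝ≥0∞ := ENNReal.ofReal (64 * 2 ^ γ) with hK
  refine ⟨(K * (∑' n : ℕ, ENNReal.ofReal (a ^ n) + ∑' n : ℕ, ENNReal.ofReal (a ^ n))).toNNReal,
    fun ξ => ?_⟩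
  rw [ENNReal.coe_toNNReal (ENNReal.mul_ne_top ENNReal.ofReal_ne_top
    (ENNReal.add_ne_top.2 ⟨hS, hS⟩))]
  by_cases hξ : ξ = 0
  · simp [hξ, lpWeight]
  have hr : 0 < ‖ξ‖ := norm_pos_iff.2 hξ
  obtain ⟨k₀, hk₀⟩ := exists_mem_Ico_zpow hr one_lt_two
  have hbound : ∀ j : ℤ, lpWeight ε ((2 : ℝ) ^ (j - k₀) • ξ) ≤
      K * ENNReal.ofReal (a ^ j.natAbs) := by
    intro j
    rw [hK, ← ENNReal.ofReal_mul (by positivity), lpWeight]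
    apply ENNReal.ofReal_le_ofReal
    have hn : ‖(2 : ℝ) ^ (j - k₀) • ξ‖ = 2 ^ (j - k₀) * ‖ξ‖ := by
      rw [norm_smul, Real.norm_of_nonneg (by positivity)]
    rw [hn]
    set R : ℝ := 2 ^ (j - k₀) * ‖ξ‖ with hR
    have hR0 : 0 < R := by positivity
    have hR1 : (2 : ℝ) ^ j ≤ R := by
      calc (2 : ℝ) ^ j = 2 ^ (j - k₀) * 2 ^ k₀ := by rw [← zpow_add₀ two_ne_zero]; simp
        _ ≤ R := by rw [hR]; gcongr; exact hk₀.1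
    have hR2 : R ≤ (2 : ℝ) ^ (j + 1) := by
      calc R ≤ 2 ^ (j - k₀) * 2 ^ (k₀ + 1) := by rw [hR]; gcongr; exact hk₀.2.le
        _ = _ := by rw [← zpow_add₀ two_ne_zero]; congr 1; ring
    have h2γ : (1 : ℝ) ≤ 2 ^ γ := Real.one_le_rpow one_le_two hγ0.le
    rcases le_or_gt 0 j with hj | hj
    · have h1 : 1 ≤ R := (one_le_zpow₀ one_le_two hj).trans hR1
      refine (hlarge R h1).trans ?_
      have h2 : R ^ (-γ) ≤ a ^ j.natAbs := by
        calc R ^ (-γ) ≤ ((2 : ℝ) ^ j) ^ (-γ) :=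
              Real.rpow_le_rpow_of_nonpos (by positivity) hR1 (by linarith)
          _ = a ^ j.natAbs := by
              rw [ha, ← Real.rpow_natCast, ← Real.rpow_intCast, ← Real.rpow_mul (by norm_num),
                ← Real.rpow_mul (by norm_num), mul_comm]
              congr 2
              rw [Nat.cast_natAbs, abs_of_nonneg hj]
      calc 64 * R ^ (-γ) ≤ (64 * 1) * a ^ j.natAbs := by rw [mul_one]; gcongr
        _ ≤ _ := by gcongr
    · have h1 : R ≤ 1 := hR2.trans (zpow_le_one_of_nonpos₀ one_le_two (by omega))
      refine (hsmall R hR0 h1).trans ?_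
      have h2 : R ^ γ ≤ 2 ^ γ * a ^ j.natAbs := by
        calc R ^ γ ≤ ((2 : ℝ) ^ (j + 1)) ^ γ := by gcongr
          _ = 2 ^ γ * a ^ j.natAbs := by
              rw [ha, ← Real.rpow_natCast, ← Real.rpow_intCast, ← Real.rpow_mul (by norm_num),
                ← Real.rpow_mul (by norm_num), ← Real.rpow_add (by norm_num)]
              congr 1
              rw [Nat.cast_natAbs, abs_of_neg hj]
              push_cast; ring
      rw [mul_assoc]
      gcongr
  calc ∑' k : ℤ, lpWeight ε ((2 : ℝ) ^ k • ξ)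
      = ∑' j : ℤ, lpWeight ε ((2 : ℝ) ^ (j - k₀) • ξ) :=
        ((Equiv.subRight k₀).tsum_eq fun k : ℤ => lpWeight ε ((2 : ℝ) ^ k • ξ)).symm
    _ ≤ ∑' j : ℤ, K * ENNReal.ofReal (a ^ j.natAbs) := ENNReal.tsum_le_tsum hbound
    _ = K * (∑' n : ℕ, ENNReal.ofReal (a ^ n) + ∑' n : ℕ, ENNReal.ofReal (a ^ (n + 1))) := by
        rw [ENNReal.tsum_mul_left, tsum_of_nat_of_neg_add_one ENNReal.summable ENNReal.summable]
        congr 5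
    _ ≤ _ := by
        gcongr K * (_ + ?_)
        refine ENNReal.tsum_le_tsum fun n => ?_
        gcongr ENNReal.ofReal ?_
        exact pow_le_pow_of_le_one ha0.le ha1.le (Nat.le_succ n)

/-- The average at unit scale is controlled by the maximal function at nearby points. -/
theorem exists_enorm_lowPart_le (d : ℕ) :
    ∃ K : ℝ≥0, ∀ f : EuclideanSpace ℝ (Fin d) → ℂ, ∀ x x' : EuclideanSpace ℝ (Fin d),
      dist x' x ≤ 5 → ‖lowPart f x'‖ₑ ≤ K * hlMaximal (fun y => ‖f y‖ₑ) x := by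
  obtain ⟨M, hM⟩ := (unitBump d).hasCompactSupport_normed.exists_bound_of_continuous
    ((unitBump d).continuous_normed (μ := volume))
  have hM0 : 0 ≤ M := (norm_nonneg _).trans (hM 0)
  -- The radius `6` is the allowed displacement `5` plus the radius `1` of the mollifier.
  refine ⟨(ENNReal.ofReal M * volume (Metric.ball (0 : EuclideanSpace ℝ (Fin d)) 6)).toNNReal,
    fun f x x' hx => ?_⟩
  rw [ENNReal.coe_toNNReal (ENNReal.mul_ne_top ENNReal.ofReal_ne_top measure_ball_lt_top.ne)]
  have hsupp : ∀ y, ‖unitMollifier d (x' - y) * f y‖ₑ ≤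
      (Metric.ball x 6).indicator (fun y => ENNReal.ofReal M * ‖f y‖ₑ) y := by
    intro y
    by_cases hy : y ∈ Metric.ball x 6
    · rw [Set.indicator_of_mem hy, enorm_mul]
      gcongr
      rw [unitMollifier, ← ofReal_norm, Complex.norm_real]
      exact ENNReal.ofReal_le_ofReal (hM _)
    · have : x' - y ∉ Function.support ((unitBump d).normed volume) := by
        rw [(unitBump d).support_normed_eq, mem_ball_zero_iff, ← dist_eq_norm]
        intro h
        apply hy
        have h1 : dist x' y < 1 := h
        rw [Metric.mem_ball]
        have h2 := dist_triangle y x' x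
        rw [dist_comm y x'] at h2
        linarith
      rw [Function.notMem_support] at this
      simp [unitMollifier, this]
  calc ‖lowPart f x'‖ₑ = ‖∫ y, unitMollifier d (x' - y) * f y‖ₑ := by
        rw [lowPart_apply, ← integral_sub_left_eq_self _ volume x']
        simp
    _ ≤ ∫⁻ y, ‖unitMollifier d (x' - y) * f y‖ₑ := enorm_integral_le_lintegral_enorm _
    _ ≤ ∫⁻ y, (Metric.ball x 6).indicator (fun y => ENNReal.ofReal M * ‖f y‖ₑ) y :=
        lintegral_mono hsupp
    _ = ENNReal.ofReal M * ∫⁻ y in Metric.ball x 6, ‖f y‖ₑ := by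
        rw [lintegral_indicator measurableSet_ball, lintegral_const_mul' _ _ ENNReal.ofReal_ne_top]
    _ ≤ ENNReal.ofReal M * (volume (Metric.ball x 6) * hlMaximal (fun y => ‖f y‖ₑ) x) := by
        gcongr
        exact lintegral_ball_le_hlMaximal _ _ (by norm_num)
    _ = _ := by rw [Measure.addHaar_ball_center, mul_assoc]

end LowFrequency

/-! ### The maximal function over `t ∈ [1, 2]`: expansion into band pieces and localization. -/

section UnitScale

open FourierTransform

variable {m d : ℕ}

/-- The multilinear maximal function over `t ∈ [1, 2]`. -/
noncomputable def unitMaximal (σ : Measure (ProdSpace m d))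
    (f : Fin m → EuclideanSpace ℝ (Fin d) → ℂ) (x : EuclideanSpace ℝ (Fin d)) : ℝ≥0∞ :=
  ⨆ t ∈ Set.Icc (1 : ℝ) 2, ‖multAverage σ f x t‖ₑ

theorem continuous_prod_shift {f : Fin m → EuclideanSpace ℝ (Fin d) → ℂ}
    (hf : ∀ i, IsTestFunction (f i)) (x : EuclideanSpace ℝ (Fin d)) (t : ℝ) :
    Continuous fun y : ProdSpace m d => ∏ i, f i (x - t • y i) := by
  refine continuous_finsetProd _ fun i _ => ?_
  have := (hf i).continuous
  fun_prop

theorem exists_prod_bound {f : Fin m → EuclideanSpace ℝ (Fin d) → ℂ}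
    (hf : ∀ i, IsTestFunction (f i)) :
    ∃ K : ℝ, ∀ z : Fin m → EuclideanSpace ℝ (Fin d), ‖∏ i, f i (z i)‖ ≤ K := by
  choose K hK using fun i => (hf i).exists_bound
  refine ⟨∏ i, K i, fun z => ?_⟩
  rw [norm_prod]
  exact Finset.prod_le_prod (fun i _ => norm_nonneg _) fun i _ => hK i _

theorem integrable_prod_shift (σ : Measure (ProdSpace m d)) [IsFiniteMeasure σ]
    {f : Fin m → EuclideanSpace ℝ (Fin d) → ℂ}
    (hf : ∀ i, IsTestFunction (f i)) (x : EuclideanSpace ℝ (Fin d)) (t : ℝ) :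
    Integrable (fun y : ProdSpace m d => ∏ i, f i (x - t • y i)) σ := by
  obtain ⟨K, hK⟩ := exists_prod_bound hf
  exact Integrable.of_bound (continuous_prod_shift hf x t).aestronglyMeasurable K
    (Filter.Eventually.of_forall fun y => hK _)

theorem continuous_multAverage (σ : Measure (ProdSpace m d)) [IsFiniteMeasure σ]
    {f : Fin m → EuclideanSpace ℝ (Fin d) → ℂ} (hf : ∀ i, IsTestFunction (f i)) (t : ℝ) :
    Continuous fun x => multAverage σ f x t := by
  obtain ⟨K, hK⟩ := exists_prod_bound hf
  refine continuous_of_dominated (bound := fun _ => K)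
    (fun x => (continuous_prod_shift hf x t).aestronglyMeasurable)
    (fun x => Filter.Eventually.of_forall fun y => hK _) (integrable_const _)
    (Filter.Eventually.of_forall fun y => continuous_finsetProd _ fun i _ => ?_)
  have := (hf i).continuous
  fun_prop

theorem measurable_unitMaximal (σ : Measure (ProdSpace m d)) [IsFiniteMeasure σ]
    {f : Fin m → EuclideanSpace ℝ (Fin d) → ℂ} (hf : ∀ i, IsTestFunction (f i)) :
    Measurable (unitMaximal σ f) := by
  refine LowerSemicontinuous.measurable (lowerSemicontinuous_iSup fun t =>
    lowerSemicontinuous_iSup fun _ => ?_)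
  exact (continuous_multAverage σ hf t).enorm.lowerSemicontinuous

/-- The functions `f i - lowPart (f i)` for `i ∈ S` and `lowPart (f i)` otherwise. -/
noncomputable def bandPiece (f : Fin m → EuclideanSpace ℝ (Fin d) → ℂ) (S : Finset (Fin m))
    (i : Fin m) : EuclideanSpace ℝ (Fin d) → ℂ :=
  if i ∈ S then fun x => f i x - lowPart (f i) x else lowPart (f i)

theorem IsTestFunction.bandPiece {f : Fin m → EuclideanSpace ℝ (Fin d) → ℂ}
    (hf : ∀ i, IsTestFunction (f i)) (S : Finset (Fin m)) (i : Fin m) :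
    IsTestFunction (bandPiece f S i) := by
  unfold _root_.bandPiece
  split_ifs
  · exact (hf i).sub (hf i).lowPart
  · exact (hf i).lowPart

theorem unitMaximal_le_sum_bandPiece (σ : Measure (ProdSpace m d)) [IsFiniteMeasure σ]
    {f : Fin m → EuclideanSpace ℝ (Fin d) → ℂ} (hf : ∀ i, IsTestFunction (f i))
    (x : EuclideanSpace ℝ (Fin d)) :
    unitMaximal σ f x ≤ ∑ S : Finset (Fin m), unitMaximal σ (bandPiece f S) x := by
  refine iSup₂_le fun t ht => ?_
  have h : multAverage σ f x t = ∑ S : Finset (Fin m), multAverage σ (bandPiece f S) x t := by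
    unfold multAverage
    rw [← integral_finsetSum _ fun S _ =>
      integrable_prod_shift σ (IsTestFunction.bandPiece hf S) x t]
    congr 1; ext y
    have h1 : ∀ i, f i (x - t • y i) =
        (f i (x - t • y i) - lowPart (f i) (x - t • y i)) + lowPart (f i) (x - t • y i) := by
      intro i; ring
    rw [Finset.prod_congr rfl fun i _ => h1 i, Fintype.prod_add]
    refine Finset.sum_congr rfl fun S _ => ?_
    rw [← Finset.prod_mul_prod_compl S fun i => bandPiece f S i (x - t • y i)]
    congr 1
    · exact Finset.prod_congr rfl fun i hi => by simp [bandPiece, hi]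
    · exact Finset.prod_congr rfl fun i hi => by simp [bandPiece, Finset.mem_compl.1 hi]
  rw [h]
  refine (enorm_sum_le _ _).trans (Finset.sum_le_sum fun S _ => ?_)
  exact le_iSup₂ (f := fun t _ => ‖multAverage σ (bandPiece f S) x t‖ₑ) t ht

theorem norm_smul_coord_le {y : ProdSpace m d} (hy : y ∈ Metric.closedBall (0 : ProdSpace m d) 1)
    {t : ℝ} (ht : t ∈ Set.Icc (1 : ℝ) 2) (i : Fin m) : ‖t • y i‖ ≤ 2 := by
  have h1 := PiLp.norm_apply_le y i
  have h2 : ‖y‖ ≤ 1 := by simpa using hy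
  rw [norm_smul, Real.norm_of_nonneg (by linarith [ht.1])]
  calc t * ‖y i‖ ≤ 2 * 1 := by
        have := ht.2
        gcongr
        exact h1.trans h2
    _ = 2 := by norm_num

/-- The contribution of the low frequencies is controlled by maximal functions. -/
theorem exists_unitMaximal_bandPiece_empty_le (σ : Measure (ProdSpace m d)) [IsFiniteMeasure σ]
    (hsupp : σ (Metric.closedBall (0 : ProdSpace m d) 1)ᶜ = 0) :
    ∃ C : ℝ≥0, ∀ (f : Fin m → EuclideanSpace ℝ (Fin d) → ℂ) (x : EuclideanSpace ℝ (Fin d)),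
      unitMaximal σ (bandPiece f ∅) x ≤ C * ∏ i, hlMaximal (fun y => ‖f i y‖ₑ) x := by
  obtain ⟨K, hK⟩ := exists_enorm_lowPart_le d
  refine ⟨K ^ m * (σ Set.univ).toNNReal, fun f x => iSup₂_le fun t ht => ?_⟩
  have hae : ∀ᵐ y ∂σ, y ∈ Metric.closedBall (0 : ProdSpace m d) 1 := hsupp
  calc ‖multAverage σ (bandPiece f ∅) x t‖ₑ
      ≤ ∫⁻ y, ‖∏ i, bandPiece f ∅ i (x - t • y i)‖ₑ ∂σ := enorm_integral_le_lintegral_enorm _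
    _ ≤ ∫⁻ y, ∏ i, (K * hlMaximal (fun y => ‖f i y‖ₑ) x) ∂σ := by
        refine lintegral_mono_ae (hae.mono fun y hy => ?_)
        rw [← ofReal_norm, norm_prod, ENNReal.ofReal_prod_of_nonneg fun i _ => norm_nonneg _]
        refine Finset.prod_le_prod' fun i _ => ?_
        rw [ofReal_norm]
        have : bandPiece f ∅ i = lowPart (f i) := by simp [bandPiece]
        rw [this]
        apply hK
        rw [dist_eq_norm, sub_sub_cancel_left, norm_neg]
        linarith [norm_smul_coord_le hy ht i]
    _ = _ := by
        rw [lintegral_const, Finset.prod_mul_distrib, Finset.prod_const, Finset.card_univ,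
          Fintype.card_fin, ENNReal.coe_mul, ENNReal.coe_toNNReal (measure_ne_top _ _),
          ENNReal.coe_pow]
        ring

/-- A fixed smooth cutoff equal to `1` on the ball of radius `3`. -/
noncomputable def cutoffBump (d : ℕ) : ContDiffBump (0 : EuclideanSpace ℝ (Fin d)) :=
  ⟨3, 4, by norm_num, by norm_num⟩

/-- The cutoff `cutoffBump d` as a Schwartz function. -/
noncomputable def cutoff (d : ℕ) : SchwartzMap (EuclideanSpace ℝ (Fin d)) ℂ :=
  HasCompactSupport.toSchwartzMap (f := fun x => ((cutoffBump d x : ℝ) : ℂ))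
    ((cutoffBump d).hasCompactSupport.comp_left (g := fun r : ℝ => (r : ℂ)) Complex.ofReal_zero)
    (Complex.ofRealCLM.contDiff.comp (cutoffBump d).contDiff)

theorem cutoff_apply (x : EuclideanSpace ℝ (Fin d)) : cutoff d x = ((cutoffBump d x : ℝ) : ℂ) :=
  rfl

theorem cutoff_eq_one {x : EuclideanSpace ℝ (Fin d)} (hx : ‖x‖ ≤ 3) : cutoff d x = 1 := by
  rw [cutoff_apply, (cutoffBump d).one_of_mem_closedBall (by simpa [cutoffBump] using hx),
    Complex.ofReal_one]

theorem norm_cutoff_le (x : EuclideanSpace ℝ (Fin d)) : ‖cutoff d x‖ ≤ 1 := by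
  rw [cutoff_apply, Complex.norm_real, Real.norm_of_nonneg (cutoffBump d).nonneg]
  exact (cutoffBump d).le_one

theorem cutoff_eq_zero {x : EuclideanSpace ℝ (Fin d)} (hx : 4 ≤ ‖x‖) : cutoff d x = 0 := by
  rw [cutoff_apply, (cutoffBump d).zero_of_le_dist (by simpa [cutoffBump] using hx),
    Complex.ofReal_zero]

/-- The function `f` cut off to the ball of radius `4` around `z`. -/
noncomputable def localize (z : EuclideanSpace ℝ (Fin d)) (f : EuclideanSpace ℝ (Fin d) → ℂ) :
    EuclideanSpace ℝ (Fin d) → ℂ := fun x => cutoff d (x - z) * f x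

theorem IsTestFunction.localize {f : EuclideanSpace ℝ (Fin d) → ℂ} (hf : IsTestFunction f)
    (z : EuclideanSpace ℝ (Fin d)) : IsTestFunction (localize z f) :=
  hf.mul_left (((cutoff d).smooth _).comp (contDiff_id.sub contDiff_const))

/-- For `x` within `1` of `z` and `‖t yᵢ‖ ≤ 2`, only values of `f i` within distance `3` of `z` are
sampled, and there the cutoff equals `1`. -/
theorem unitMaximal_eq_localize {σ : Measure (ProdSpace m d)}
    (hsupp : σ (Metric.closedBall (0 : ProdSpace m d) 1)ᶜ = 0)
    (f : Fin m → EuclideanSpace ℝ (Fin d) → ℂ) {x z : EuclideanSpace ℝ (Fin d)}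
    (hx : x ∈ Metric.ball z 1) :
    unitMaximal σ f x = unitMaximal σ (fun i => localize z (f i)) x := by
  have hae : ∀ᵐ y ∂σ, y ∈ Metric.closedBall (0 : ProdSpace m d) 1 := hsupp
  refine iSup_congr fun t => iSup_congr fun ht => ?_
  congr 1
  refine integral_congr_ae (hae.mono fun y hy => ?_)
  refine Finset.prod_congr rfl fun i _ => ?_
  change _ = cutoff d (x - t • y i - z) * f i (x - t • y i)
  rw [cutoff_eq_one, one_mul]
  have h1 := norm_smul_coord_le hy ht i
  have h2 : ‖x - z‖ < 1 := by rwa [← dist_eq_norm]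
  calc ‖x - t • y i - z‖ = ‖(x - z) - t • y i‖ := by congr 1; abel
    _ ≤ ‖x - z‖ + ‖t • y i‖ := norm_sub_le _ _
    _ ≤ 3 := by linarith

/-- The cutoff lives within `4` of `z`, hence within `5` of every `x` in the unit ball about `z`,
where the low part is bounded by the maximal function at `x`. The negative Sobolev norm is then
estimated by the `L²` norm; no frequency gain is available or needed. -/
theorem exists_negSobolevSq_localize_lowPart_le (d : ℕ) :
    ∃ K : ℝ≥0, K ≠ 0 ∧ ∀ {ε : ℝ}, 0 ≤ ε → ∀ f : EuclideanSpace ℝ (Fin d) → ℂ, IsTestFunction f →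
      ∀ x z : EuclideanSpace ℝ (Fin d), x ∈ Metric.ball z 1 →
        negSobolevSq ε (localize z (lowPart f)) ≤ K * hlMaximal (fun y => ‖f y‖ₑ) x ^ 2 := by
  obtain ⟨K, hK⟩ := exists_enorm_lowPart_le d
  have hv : volume (Metric.ball (0 : EuclideanSpace ℝ (Fin d)) 4) ≠ ∞ := measure_ball_lt_top.ne
  -- The added `1` only ensures that the constant is nonzero, so that it can be inverted later.
  refine ⟨K ^ 2 * (volume (Metric.ball (0 : EuclideanSpace ℝ (Fin d)) 4)).toNNReal + 1,
    by positivity, fun hε f hf x z hx => ?_⟩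
  refine (negSobolevSq_le_lintegral hε (hf.lowPart.localize z).toSchwartz).trans ?_
  calc ∫⁻ y, ‖localize z (lowPart f) y‖ₑ ^ 2
      ≤ ∫⁻ y, (Metric.ball z 4).indicator
          (fun _ => (K * hlMaximal (fun y => ‖f y‖ₑ) x) ^ 2) y := by
        refine lintegral_mono fun y => ?_
        by_cases hy : y ∈ Metric.ball z 4
        · rw [Set.indicator_of_mem hy]
          gcongr
          rw [localize, enorm_mul]
          refine (mul_le_of_le_one_left' ?_).trans (hK f x y ?_)
          · rw [← ofReal_norm]
            exact ENNReal.ofReal_le_one.2 (norm_cutoff_le _)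
          · have h1 : dist y z < 4 := hy
            have h2 : dist x z < 1 := hx
            linarith [dist_triangle_right y x z]
        · have : 4 ≤ ‖y - z‖ := by
            rw [← dist_eq_norm]; simpa using hy
          simp [localize, cutoff_eq_zero this]
    _ = (K ^ 2 * volume (Metric.ball (0 : EuclideanSpace ℝ (Fin d)) 4)) *
          hlMaximal (fun y => ‖f y‖ₑ) x ^ 2 := by
        rw [lintegral_indicator measurableSet_ball, setLIntegral_const,
          Measure.addHaar_ball_center]
        ring
    _ ≤ _ := by
        rw [ENNReal.coe_add, ENNReal.coe_mul, ENNReal.coe_toNNReal hv, ENNReal.coe_pow]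
        gcongr
        exact le_self_add

theorem measurable_negSobolevSq_localize (ε : ℝ) {h : EuclideanSpace ℝ (Fin d) → ℂ}
    (hh : IsTestFunction h) : Measurable fun z => negSobolevSq ε (localize z h) := by
  have hm1 : Measurable fun p : EuclideanSpace ℝ (Fin d) × EuclideanSpace ℝ (Fin d) =>
      𝓕 (localize p.1 h) p.2 := by
    simp_rw [fourier_eq_integral_fourierKernel]
    refine (StronglyMeasurable.integral_prod_right' (ν := volume)
      (f := fun q : (EuclideanSpace ℝ (Fin d) × EuclideanSpace ℝ (Fin d)) ×
        EuclideanSpace ℝ (Fin d) => fourierKernel q.2 q.1.2 * (cutoff d (q.2 - q.1.1) * h q.2))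
      (Continuous.stronglyMeasurable ?_)).measurable
    have := (cutoff d).continuous
    have := hh.continuous
    fun_prop
  unfold negSobolevSq
  refine Measurable.lintegral_prod_right' (f := fun p : EuclideanSpace ℝ (Fin d) ×
    EuclideanSpace ℝ (Fin d) => ‖𝓕 (localize p.1 h) p.2‖ₑ ^ 2 *
      ENNReal.ofReal ((1 + ‖p.2‖) ^ (-ε))) ?_
  exact (hm1.enorm.pow_const 2).mul (by fun_prop)

/-- Integrals are averages of integrals over unit balls. -/
theorem lintegral_eq_lintegral_ball {f : EuclideanSpace ℝ (Fin d) → ℝ≥0∞} (hf : Measurable f) :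
    (∫⁻ x, f x) * volume (Metric.ball (0 : EuclideanSpace ℝ (Fin d)) 1) =
      ∫⁻ z, ∫⁻ x in Metric.ball z 1, f x := by
  have h1 : ∀ z, ∫⁻ x in Metric.ball z 1, f x =
      ∫⁻ x, {p : EuclideanSpace ℝ (Fin d) × EuclideanSpace ℝ (Fin d) |
        dist p.2 p.1 < 1}.indicator (fun p => f p.2) (z, x) := by
    intro z
    rw [← lintegral_indicator measurableSet_ball]
    rfl
  have hms : MeasurableSet {p : EuclideanSpace ℝ (Fin d) × EuclideanSpace ℝ (Fin d) |
        dist p.2 p.1 < 1} := measurableSet_lt (by fun_prop) (by fun_prop)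
  simp_rw [h1]
  rw [lintegral_lintegral_swap, ← lintegral_mul_const _ hf]
  · refine lintegral_congr fun x => ?_
    have : ∀ z, {p : EuclideanSpace ℝ (Fin d) × EuclideanSpace ℝ (Fin d) |
        dist p.2 p.1 < 1}.indicator (fun p => f p.2) (z, x) =
        (Metric.ball x 1).indicator (fun _ => f x) z := by
      intro z
      simp only [Set.indicator, Metric.mem_ball, Set.mem_ofPred_eq, dist_comm]
    simp_rw [this]
    rw [lintegral_indicator measurableSet_ball, setLIntegral_const,
      Measure.addHaar_ball_center volume x]
  · exact ((hf.comp measurable_snd).indicator hms).aemeasurable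

/-- Hölder on a set of finite measure. On unit balls it lowers `L²` to `L^(2/p)`, which would be
impossible on the whole space and is the reason for localizing. -/
theorem lintegral_rpow_inv_le {X : Type*} [MeasurableSpace X] (μ : Measure X) {f : X → ℝ≥0∞}
    (hf : AEMeasurable f μ) {p : ℕ} (hp : 1 ≤ p) :
    ∫⁻ x, f x ^ (p : ℝ)⁻¹ ∂μ ≤
      (∫⁻ x, f x ∂μ) ^ (p : ℝ)⁻¹ * μ Set.univ ^ (1 - (p : ℝ)⁻¹) := by
  have h1 : (p : ℝ)⁻¹ ≤ 1 := inv_le_one_of_one_le₀ (by exact_mod_cast hp)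
  have := ENNReal.lintegral_mul_norm_pow_le (μ := μ) (g := fun _ => 1) hf aemeasurable_const
    (p := (p : ℝ)⁻¹) (q := 1 - (p : ℝ)⁻¹) (by positivity) (by linarith) (by ring)
  simpa using this

end UnitScale

/-! ### Lowering the exponent from `2` to `2/|S|` at unit scale. -/

section UnitScale

open FourierTransform

variable {m d : ℕ}

/-- The Sobolev norms `B` of the low factors are at most `L W(x)²` at every `x` of the ball, where
`W` is the product of the maximal functions and `L` a power of `K`. Hence `W(x)⁻²` can be replaced
by `L B⁻¹`, a constant on the ball, which cancels the low factors in the single-scale `L²` bound. -/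
theorem lintegral_ball_unitMaximal_le {σ : Measure (ProdSpace m d)} [IsFiniteMeasure σ]
    (hsupp : σ (Metric.closedBall (0 : ProdSpace m d) 1)ᶜ = 0) {ε : ℝ} {C K : ℝ≥0}
    (hC : ∀ g : Fin m → SchwartzMap (EuclideanSpace ℝ (Fin d)) ℂ,
      ∫⁻ x, unitMaximal σ (fun i => g i) x ^ 2 ≤ C * ∏ i, negSobolevSq ε (g i))
    (hK0 : K ≠ 0) (hK : ∀ f : EuclideanSpace ℝ (Fin d) → ℂ, IsTestFunction f →
      ∀ x z : EuclideanSpace ℝ (Fin d), x ∈ Metric.ball z 1 →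
        negSobolevSq ε (localize z (lowPart f)) ≤ K * hlMaximal (fun y => ‖f y‖ₑ) x ^ 2)
    {f : Fin m → EuclideanSpace ℝ (Fin d) → ℂ} (hf : ∀ i, IsTestFunction (f i))
    (S : Finset (Fin m)) (z : EuclideanSpace ℝ (Fin d)) :
    ∫⁻ x in Metric.ball z 1, (unitMaximal σ (bandPiece f S) x *
        (∏ i ∈ Sᶜ, hlMaximal (fun y => ‖f i y‖ₑ) x)⁻¹) ^ 2 ≤
      C * K ^ (Sᶜ).card *
        ∏ i ∈ S, negSobolevSq ε (localize z fun x => f i x - lowPart (f i) x) := by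
  set B : ℝ≥0∞ := ∏ i ∈ Sᶜ, negSobolevSq ε (localize z (lowPart (f i))) with hB
  set L : ℝ≥0∞ := (K : ℝ≥0∞) ^ (Sᶜ).card with hL
  have hL0 : L ≠ 0 := pow_ne_zero _ (by exact_mod_cast hK0)
  have hLt : L ≠ ∞ := by rw [hL]; finiteness
  have hloc : ∀ i, IsTestFunction (localize z (bandPiece f S i)) := fun i =>
    (IsTestFunction.bandPiece hf S i).localize z
  have hw : ∀ x ∈ Metric.ball z 1,
      ((∏ i ∈ Sᶜ, hlMaximal (fun y => ‖f i y‖ₑ) x)⁻¹) ^ 2 ≤ L * B⁻¹ := by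
    intro x hx
    set W := ∏ i ∈ Sᶜ, hlMaximal (fun y => ‖f i y‖ₑ) x with hW
    have h1 : B ≤ L * W ^ 2 := by
      rw [hB, hL, hW, ← Finset.prod_const, ← Finset.prod_pow, ← Finset.prod_mul_distrib]
      exact Finset.prod_le_prod' fun i _ => hK (f i) (hf i) x z hx
    calc (W⁻¹) ^ 2 = L * (L * W ^ 2)⁻¹ := by
          rw [ENNReal.mul_inv (Or.inl hL0) (Or.inl hLt), ← mul_assoc,
            ENNReal.mul_inv_cancel hL0 hLt, one_mul, ENNReal.inv_pow]
      _ ≤ L * B⁻¹ := by gcongr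
  calc _ ≤ ∫⁻ x in Metric.ball z 1,
          unitMaximal σ (fun i => localize z (bandPiece f S i)) x ^ 2 * (L * B⁻¹) := by
        refine setLIntegral_mono' measurableSet_ball fun x hx => ?_
        rw [mul_pow, unitMaximal_eq_localize hsupp _ hx]
        gcongr
        exact hw x hx
    _ = (∫⁻ x in Metric.ball z 1,
          unitMaximal σ (fun i => localize z (bandPiece f S i)) x ^ 2) * (L * B⁻¹) :=
        lintegral_mul_const _ ((measurable_unitMaximal σ hloc).pow_const 2)
    _ ≤ (C * ∏ i, negSobolevSq ε (localize z (bandPiece f S i))) * (L * B⁻¹) := by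
        gcongr
        exact (setLIntegral_le_lintegral _ _).trans (hC fun i => (hloc i).toSchwartz)
    _ = C * L * (∏ i ∈ S, negSobolevSq ε (localize z fun x => f i x - lowPart (f i) x)) *
          (B⁻¹ * B) := by
        rw [← Finset.prod_mul_prod_compl S fun i => negSobolevSq ε (localize z (bandPiece f S i))]
        have h1 : ∏ i ∈ S, negSobolevSq ε (localize z (bandPiece f S i)) =
            ∏ i ∈ S, negSobolevSq ε (localize z fun x => f i x - lowPart (f i) x) :=
          Finset.prod_congr rfl fun i hi => by simp [bandPiece, hi]
        have h2 : ∏ i ∈ Sᶜ, negSobolevSq ε (localize z (bandPiece f S i)) = B :=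
          Finset.prod_congr rfl fun i hi => by simp [bandPiece, Finset.mem_compl.1 hi]
        rw [h1, h2]
        ring
    -- Only `B⁻¹ * B ≤ 1` is used, which remains true for `B = 0` and `B = ∞`.
    _ ≤ _ := mul_le_of_le_one_right' (ENNReal.inv_mul_le_one B)

/-- The contribution of the frequencies above unit scale in the variables in `S`. -/
theorem exists_lintegral_unitMaximal_bandPiece_le (hm : 2 ≤ m) (hd : 1 ≤ d) {s : ℝ}
    (hs : ((m : ℝ) - 1) * (d : ℝ) / 2 + 1 / 2 < s) (σ : Measure (ProdSpace m d))
    [IsFiniteMeasure σ] (hsupp : σ (Metric.closedBall (0 : ProdSpace m d) 1)ᶜ = 0)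
    (hdecay : HasFourierDecay σ s) :
    ∃ ε : ℝ, 0 < ε ∧ ∀ S : Finset (Fin m), S.Nonempty → ∃ C : ℝ≥0,
      ∀ f : Fin m → EuclideanSpace ℝ (Fin d) → ℂ, (∀ i, IsTestFunction (f i)) →
        ∫⁻ x, ((unitMaximal σ (bandPiece f S) x *
          (∏ i ∈ Sᶜ, hlMaximal (fun y => ‖f i y‖ₑ) x)⁻¹) ^ 2) ^ (S.card : ℝ)⁻¹ ≤
        C * ∏ i ∈ S, (∫⁻ ξ, ‖𝓕 (f i) ξ‖ₑ ^ 2 * lpWeight ε ξ) ^ (S.card : ℝ)⁻¹ := by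
  obtain ⟨ε, hε, C₀, hC₀⟩ := exists_lintegral_iSup_multAverage_sq_le hm hd hs σ hsupp hdecay
  obtain ⟨K, hK0, hK⟩ := exists_negSobolevSq_localize_lowPart_le d
  obtain ⟨C₂, hC₂⟩ := exists_lintegral_negSobolevSq_translate_le hε.le (cutoff d)
  refine ⟨ε, hε, fun S hS => ?_⟩
  set p := S.card with hp
  have hp1 : 1 ≤ p := hS.card_pos
  have hp0 : (0 : ℝ) ≤ (p : ℝ)⁻¹ := by positivity
  set v := volume (Metric.ball (0 : EuclideanSpace ℝ (Fin d)) 1) with hv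
  have hv0 : v ≠ 0 := (Metric.measure_ball_pos volume _ one_pos).ne'
  have hvt : v ≠ ∞ := measure_ball_lt_top.ne
  set C : ℝ≥0∞ := ((C₀ * K ^ (Sᶜ).card : ℝ≥0∞) ^ (p : ℝ)⁻¹ * v ^ (1 - (p : ℝ)⁻¹) *
    ∏ i ∈ S, (C₂ : ℝ≥0∞) ^ (p : ℝ)⁻¹) * v⁻¹ with hC
  have h1p : 0 ≤ 1 - (p : ℝ)⁻¹ := by
    have : (p : ℝ)⁻¹ ≤ 1 := inv_le_one_of_one_le₀ (by exact_mod_cast hp1)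
    linarith
  have hCt : C ≠ ∞ := by
    refine ENNReal.mul_ne_top (ENNReal.mul_ne_top (ENNReal.mul_ne_top ?_ ?_) ?_)
      (ENNReal.inv_ne_top.2 hv0)
    · exact ENNReal.rpow_ne_top_of_nonneg hp0 (by finiteness)
    · exact ENNReal.rpow_ne_top_of_nonneg h1p hvt
    · exact ENNReal.prod_ne_top fun i _ => ENNReal.rpow_ne_top_of_nonneg hp0 (by finiteness)
  refine ⟨C.toNNReal, fun f hf => ?_⟩
  rw [ENNReal.coe_toNNReal hCt]
  have hT := measurable_unitMaximal σ (IsTestFunction.bandPiece hf S)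
  have hW : Measurable fun x => ∏ i ∈ Sᶜ, hlMaximal (fun y => ‖f i y‖ₑ) x :=
    Finset.measurable_prod _ fun i _ => (lowerSemicontinuous_hlMaximal _).measurable
  set G : EuclideanSpace ℝ (Fin d) → ℝ≥0∞ := fun x => (unitMaximal σ (bandPiece f S) x *
          (∏ i ∈ Sᶜ, hlMaximal (fun y => ‖f i y‖ₑ) x)⁻¹) ^ 2 with hG
  have hGm : Measurable G := (hT.mul hW.inv).pow_const 2
  set N : Fin m → EuclideanSpace ℝ (Fin d) → ℝ≥0∞ := fun i z =>
    negSobolevSq ε (localize z fun x => f i x - lowPart (f i) x) with hN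
  have hNm : ∀ i, Measurable (N i) := fun i =>
    measurable_negSobolevSq_localize ε ((hf i).sub (hf i).lowPart)
  have hNi : ∀ i, ∫⁻ z, N i z ≤ C₂ * ∫⁻ ξ, ‖𝓕 (f i) ξ‖ₑ ^ 2 * lpWeight ε ξ := fun i =>
    (hC₂ ((hf i).sub (hf i).lowPart).toSchwartz).trans
      (mul_le_mul_right (negSobolevSq_sub_lowPart_le (hf i) ε) _)
  have hmain : (∫⁻ x, G x ^ (p : ℝ)⁻¹) * v ≤
      (C₀ * K ^ (Sᶜ).card : ℝ≥0∞) ^ (p : ℝ)⁻¹ * v ^ (1 - (p : ℝ)⁻¹) *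
        ∏ i ∈ S, (C₂ * ∫⁻ ξ, ‖𝓕 (f i) ξ‖ₑ ^ 2 * lpWeight ε ξ) ^ (p : ℝ)⁻¹ := by
    rw [lintegral_eq_lintegral_ball (hGm.pow_const _)]
    calc ∫⁻ z, ∫⁻ x in Metric.ball z 1, G x ^ (p : ℝ)⁻¹
        ≤ ∫⁻ z, (C₀ * K ^ (Sᶜ).card : ℝ≥0∞) ^ (p : ℝ)⁻¹ * v ^ (1 - (p : ℝ)⁻¹) *
            ∏ i ∈ S, N i z ^ (p : ℝ)⁻¹ := by
          refine lintegral_mono fun z => ?_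
          refine (lintegral_rpow_inv_le _ hGm.aemeasurable hp1).trans ?_
          rw [Measure.restrict_apply_univ, Measure.addHaar_ball_center, mul_right_comm,
            ENNReal.prod_rpow_of_nonneg hp0, ← ENNReal.mul_rpow_of_nonneg _ _ hp0]
          gcongr
          exact lintegral_ball_unitMaximal_le hsupp hC₀ hK0 (hK hε.le) hf S z
      _ = (C₀ * K ^ (Sᶜ).card : ℝ≥0∞) ^ (p : ℝ)⁻¹ * v ^ (1 - (p : ℝ)⁻¹) *
            ∫⁻ z, ∏ i ∈ S, N i z ^ (p : ℝ)⁻¹ :=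
          lintegral_const_mul _ (Finset.measurable_prod _ fun i _ => (hNm i).pow_const _)
      _ ≤ _ := by
          gcongr
          -- Hölder in the centre `z` with `|S|` factors. Each factor is then a Sobolev norm
          -- averaged over translated cutoffs, which is controlled by the global one.
          refine (ENNReal.lintegral_prod_norm_pow_le S (fun i _ => (hNm i).aemeasurable)
            (p := fun _ => (p : ℝ)⁻¹) ?_ fun _ _ => hp0).trans ?_
          · rw [Finset.sum_const, nsmul_eq_mul, ← hp]
            exact mul_inv_cancel₀ (by exact_mod_cast (by omega : p ≠ 0))
          · refine Finset.prod_le_prod' fun i _ => ?_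
            gcongr
            exact hNi i
  calc ∫⁻ x, G x ^ (p : ℝ)⁻¹ = (∫⁻ x, G x ^ (p : ℝ)⁻¹) * v * v⁻¹ := by
        rw [mul_assoc, ENNReal.mul_inv_cancel hv0 hvt, mul_one]
    _ ≤ _ := mul_le_mul_left hmain _
    _ = _ := by
        simp_rw [ENNReal.mul_rpow_of_nonneg _ _ hp0]
        rw [Finset.prod_mul_distrib, hC, ENNReal.mul_rpow_of_nonneg _ _ hp0]
        ring

end UnitScale

/-! ### Rescaling to unit scale and summation over all dyadic scales. -/

section Scales

open FourierTransform

variable {m d : ℕ}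

theorem lintegral_comp_inv_smul {r : ℝ} (hr : 0 < r) (f : EuclideanSpace ℝ (Fin d) → ℝ≥0∞) :
    ∫⁻ x, f (r⁻¹ • x) = ENNReal.ofReal (r ^ d) * ∫⁻ x, f x := by
  have hr' : r⁻¹ ≠ 0 := (inv_pos.2 hr).ne'
  have h := (Homeomorph.smulOfNeZero r⁻¹ hr').measurableEmbedding.lintegral_map
    (μ := (volume : Measure (EuclideanSpace ℝ (Fin d)))) f
  simp only [Homeomorph.smulOfNeZero_apply] at h
  rw [← h]
  have h2 := Measure.map_addHaar_smul (volume : Measure (EuclideanSpace ℝ (Fin d))) hr'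
  rw [h2, lintegral_smul_measure, finrank_euclideanSpace_fin, inv_pow, inv_inv,
    abs_of_nonneg (by positivity), smul_eq_mul]

theorem hlMaximal_comp_smul_le {r : ℝ} (hr : 0 < r) (f : EuclideanSpace ℝ (Fin d) → ℝ≥0∞)
    (x : EuclideanSpace ℝ (Fin d)) :
    hlMaximal (fun y => f (r • y)) (r⁻¹ • x) ≤ hlMaximal f x := by
  refine iSup₂_le fun ρ hρ => ?_
  have hc : ENNReal.ofReal ((r⁻¹) ^ d) ≠ 0 := by
    rw [Ne, ENNReal.ofReal_eq_zero, not_le]; positivity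
  have h1 : ∫⁻ y in Metric.ball (r⁻¹ • x) ρ, f (r • y) =
      ENNReal.ofReal ((r⁻¹) ^ d) * ∫⁻ y in Metric.ball x (r * ρ), f y := by
    rw [← lintegral_indicator measurableSet_ball, ← lintegral_indicator measurableSet_ball,
      ← lintegral_comp_inv_smul (inv_pos.2 hr)]
    refine lintegral_congr fun y => ?_
    rw [inv_inv]
    have : y ∈ Metric.ball (r⁻¹ • x) ρ ↔ r • y ∈ Metric.ball x (r * ρ) := by
      have h2 : r • y - x = r • (y - r⁻¹ • x) := by
        rw [smul_sub, smul_smul, mul_inv_cancel₀ hr.ne', one_smul]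
      rw [mem_ball_iff_norm, mem_ball_iff_norm, h2, norm_smul, Real.norm_of_nonneg hr.le]
      exact (mul_lt_mul_iff_right₀ hr).symm
    by_cases hy : y ∈ Metric.ball (r⁻¹ • x) ρ
    · rw [Set.indicator_of_mem hy, Set.indicator_of_mem (this.1 hy)]
    · rw [Set.indicator_of_notMem hy, Set.indicator_of_notMem (mt this.2 hy)]
  have h2 : volume (Metric.ball (r⁻¹ • x) ρ) =
      ENNReal.ofReal ((r⁻¹) ^ d) * volume (Metric.ball x (r * ρ)) := by
    have := Measure.addHaar_ball_mul_of_pos volume (r⁻¹ • x) (inv_pos.2 hr) (r * ρ)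
    rwa [← mul_assoc, inv_mul_cancel₀ hr.ne', one_mul, finrank_euclideanSpace_fin,
      ← Measure.addHaar_ball_center volume x] at this
  have hv : volume (Metric.ball x (r * ρ)) ≠ 0 :=
    (Metric.measure_ball_pos volume _ (mul_pos hr hρ)).ne'
  rw [h1, h2, ENNReal.mul_inv (Or.inl hc) (Or.inl ENNReal.ofReal_ne_top), mul_mul_mul_comm,
    ENNReal.inv_mul_cancel hc ENNReal.ofReal_ne_top, one_mul]
  calc _ ≤ (volume (Metric.ball x (r * ρ)))⁻¹ * (volume (Metric.ball x (r * ρ)) * hlMaximal f x) := by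
        gcongr; exact lintegral_ball_le_hlMaximal f x (mul_pos hr hρ)
    _ ≤ _ := by
        rw [← mul_assoc]; exact mul_le_of_le_one_left' (ENNReal.inv_mul_le_one _)

theorem lintegral_fourier_comp_smul {r : ℝ} (hr : 0 < r) (f : EuclideanSpace ℝ (Fin d) → ℂ)
    (w : EuclideanSpace ℝ (Fin d) → ℝ≥0∞) :
    ENNReal.ofReal (r ^ d) * ∫⁻ ξ, ‖𝓕 (fun x => f (r • x)) ξ‖ₑ ^ 2 * w ξ =
      ∫⁻ ξ, ‖𝓕 f ξ‖ₑ ^ 2 * w (r • ξ) := by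
  set c := ENNReal.ofReal (r ^ d) with hc
  have hc0 : c ≠ 0 := by rw [hc, Ne, ENNReal.ofReal_eq_zero, not_le]; positivity
  have hct : c ≠ ∞ := ENNReal.ofReal_ne_top
  have h1 : ∀ ξ, c * ‖𝓕 (fun x => f (r • x)) ξ‖ₑ = ‖𝓕 f (r⁻¹ • ξ)‖ₑ := by
    intro ξ
    have h := Measure.integral_comp_smul (volume : Measure (EuclideanSpace ℝ (Fin d)))
      (fun u => fourierKernel u (r⁻¹ • ξ) * f u) r
    rw [fourier_eq_integral_fourierKernel, fourier_eq_integral_fourierKernel]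
    have h2 : ∀ y, fourierKernel (r • y) (r⁻¹ • ξ) = fourierKernel y ξ := by
      intro y
      rw [fourierKernel, fourierKernel, real_inner_smul_left, real_inner_smul_right,
        ← mul_assoc r, mul_inv_cancel₀ hr.ne', one_mul]
    simp only [h2] at h
    rw [h, enorm_smul, finrank_euclideanSpace_fin, abs_of_nonneg (by positivity), ← mul_assoc,
      Real.enorm_eq_ofReal (by positivity), hc, ← ENNReal.ofReal_mul (by positivity),
      mul_inv_cancel₀ (by positivity), ENNReal.ofReal_one, one_mul]
  have h2 := lintegral_comp_inv_smul hr fun ξ => ‖𝓕 f ξ‖ₑ ^ 2 * w (r • ξ)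
  simp only [smul_smul, mul_inv_cancel₀ hr.ne', one_smul, ← h1, mul_pow, mul_assoc] at h2
  rw [lintegral_const_mul' _ _ (by finiteness), sq, mul_assoc] at h2
  exact (ENNReal.mul_right_inj hc0 hct).1 h2

theorem multAverage_comp_smul (σ : Measure (ProdSpace m d))
    (f : Fin m → EuclideanSpace ℝ (Fin d) → ℂ) {r : ℝ} (hr : r ≠ 0) (x : EuclideanSpace ℝ (Fin d))
    (t : ℝ) :
    multAverage σ (fun i x => f i (r • x)) (r⁻¹ • x) t = multAverage σ f x (r * t) := by
  unfold multAverage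
  congr 1; ext y
  refine Finset.prod_congr rfl fun i _ => ?_
  dsimp only
  rw [smul_sub, smul_smul, smul_smul, mul_inv_cancel₀ hr, one_smul]

/-- Every `t > 0` lies in some `[2^k, 2^(k+1))`, and dilating all functions by `2^k` turns it into a
radius in `[1, 2]`. -/
theorem multMaximal_le_iSup_unitMaximal (σ : Measure (ProdSpace m d))
    (f : Fin m → EuclideanSpace ℝ (Fin d) → ℂ) (x : EuclideanSpace ℝ (Fin d)) :
    multMaximal σ f x ≤ ⨆ k : ℤ,
      unitMaximal σ (fun i x => f i ((2 : ℝ) ^ k • x)) (((2 : ℝ) ^ k)⁻¹ • x) := by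
  refine iSup₂_le fun t ht => ?_
  obtain ⟨k, hk1, hk2⟩ := exists_mem_Ico_zpow ht one_lt_two
  have h2 : (0 : ℝ) < 2 ^ k := by positivity
  have hmem : t / 2 ^ k ∈ Set.Icc (1 : ℝ) 2 := by
    rw [zpow_add_one₀ two_ne_zero] at hk2
    refine ⟨(one_le_div h2).2 hk1, (div_le_iff₀ h2).2 ?_⟩
    linarith
  refine le_trans ?_ (le_iSup _ k)
  refine le_trans (le_of_eq ?_) (le_iSup₂ (f := fun t _ =>
    ‖multAverage σ (fun i x => f i ((2 : ℝ) ^ k • x)) (((2 : ℝ) ^ k)⁻¹ • x) t‖ₑ) (t / 2 ^ k) hmem)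
  rw [multAverage_comp_smul σ f h2.ne', mul_div_cancel₀ _ h2.ne']

theorem tsum_prod_rpow_le {ι : Type*} (S : Finset ι) (hS : S.Nonempty) (R : ι → ℤ → ℝ≥0∞) :
    ∑' k, ∏ i ∈ S, R i k ^ (S.card : ℝ)⁻¹ ≤ ∏ i ∈ S, (∑' k, R i k) ^ (S.card : ℝ)⁻¹ := by
  simp_rw [← lintegral_count]
  refine ENNReal.lintegral_prod_norm_pow_le S (fun i _ => Measurable.of_discrete.aemeasurable)
    ?_ fun _ _ => by positivity
  rw [Finset.sum_const, nsmul_eq_mul]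
  exact mul_inv_cancel₀ (by exact_mod_cast hS.card_pos.ne')

theorem IsTestFunction.lintegral_enorm_sq_fourier {f : EuclideanSpace ℝ (Fin d) → ℂ}
    (hf : IsTestFunction f) : ∫⁻ ξ, ‖𝓕 f ξ‖ₑ ^ 2 = ∫⁻ x, ‖f x‖ₑ ^ 2 :=
  hf.toSchwartz.lintegral_enorm_sq_fourier

/-- Changing variables at scale `k` produces the Jacobian `2^(kd)`, which is distributed over the
`|S|` factors with exponent `1/|S|` and is exactly consumed by rescaling the frequency integrals.
Hölder for the sum over `k` then leaves `∑_k lpWeight ε (2^k ξ)` in each variable. -/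
theorem exists_tsum_lintegral_unitMaximal_bandPiece_le (hm : 2 ≤ m) (hd : 1 ≤ d) {s : ℝ}
    (hs : ((m : ℝ) - 1) * (d : ℝ) / 2 + 1 / 2 < s) (σ : Measure (ProdSpace m d))
    [IsFiniteMeasure σ] (hsupp : σ (Metric.closedBall (0 : ProdSpace m d) 1)ᶜ = 0)
    (hdecay : HasFourierDecay σ s) (S : Finset (Fin m)) (hS : S.Nonempty) :
    ∃ C : ℝ≥0, ∀ f : Fin m → EuclideanSpace ℝ (Fin d) → ℂ, (∀ i, IsTestFunction (f i)) →
      ∑' k : ℤ, ∫⁻ x, ((unitMaximal σ (bandPiece (fun i x => f i ((2 : ℝ) ^ k • x)) S)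
          (((2 : ℝ) ^ k)⁻¹ • x) *
          (∏ i ∈ Sᶜ, hlMaximal (fun y => ‖f i y‖ₑ) x)⁻¹) ^ 2) ^ (S.card : ℝ)⁻¹ ≤
        C * ∏ i ∈ S, (∫⁻ x, ‖f i x‖ₑ ^ 2) ^ (S.card : ℝ)⁻¹ := by
  obtain ⟨ε, hε, h⟩ := exists_lintegral_unitMaximal_bandPiece_le hm hd hs σ hsupp hdecay
  obtain ⟨C, hC⟩ := h S hS
  obtain ⟨Cw, hCw⟩ := exists_tsum_lpWeight_le (d := d) hε
  have hp0 : (0 : ℝ) ≤ (S.card : ℝ)⁻¹ := by positivity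
  refine ⟨C * ∏ i ∈ S, Cw ^ (S.card : ℝ)⁻¹, fun f hf => ?_⟩
  have hfk : ∀ k : ℤ, ∀ i, IsTestFunction fun x => f i ((2 : ℝ) ^ k • x) := fun k i =>
    (hf i).comp_smul (by positivity)
  have hstep : ∀ k : ℤ, ∫⁻ x, ((unitMaximal σ (bandPiece (fun i x => f i ((2 : ℝ) ^ k • x)) S)
          (((2 : ℝ) ^ k)⁻¹ • x) *
          (∏ i ∈ Sᶜ, hlMaximal (fun y => ‖f i y‖ₑ) x)⁻¹) ^ 2) ^ (S.card : ℝ)⁻¹ ≤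
      C * ∏ i ∈ S, (∫⁻ ξ, ‖𝓕 (f i) ξ‖ₑ ^ 2 * lpWeight ε ((2 : ℝ) ^ k • ξ)) ^ (S.card : ℝ)⁻¹ := by
    intro k
    have h2 : (0 : ℝ) < 2 ^ k := by positivity
    refine (lintegral_mono fun x => ?_).trans
      ((lintegral_comp_inv_smul h2 fun x =>
        ((unitMaximal σ (bandPiece (fun i x => f i ((2 : ℝ) ^ k • x)) S) x *
          (∏ i ∈ Sᶜ, hlMaximal (fun y => ‖f i ((2 : ℝ) ^ k • y)‖ₑ) x)⁻¹) ^ 2) ^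
            (S.card : ℝ)⁻¹).le.trans ?_)
    · dsimp only
      gcongr with i
      exact hlMaximal_comp_smul_le h2 (fun y => ‖f i y‖ₑ) x
    · refine (mul_le_mul_right (hC _ (hfk k)) _).trans ?_
      rw [mul_left_comm]
      gcongr
      simp_rw [← lintegral_fourier_comp_smul h2, ENNReal.mul_rpow_of_nonneg _ _ hp0]
      rw [Finset.prod_mul_distrib, Finset.prod_const, ← ENNReal.rpow_mul_natCast,
        inv_mul_cancel₀ (by exact_mod_cast hS.card_pos.ne'), ENNReal.rpow_one]
  refine (ENNReal.tsum_le_tsum hstep).trans ?_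
  rw [ENNReal.tsum_mul_left, ENNReal.coe_mul, mul_assoc]
  gcongr
  refine (tsum_prod_rpow_le S hS _).trans ?_
  push_cast
  rw [← Finset.prod_mul_distrib]
  refine Finset.prod_le_prod' fun i _ => ?_
  rw [ENNReal.coe_rpow_of_nonneg _ hp0, ← ENNReal.mul_rpow_of_nonneg _ _ hp0]
  gcongr
  have hFm : Measurable (𝓕 (f i)) := (hf i).toSchwartz.continuous_fourier.measurable
  have hm : ∀ k : ℤ, AEMeasurable fun ξ => ‖𝓕 (f i) ξ‖ₑ ^ 2 * lpWeight ε ((2 : ℝ) ^ k • ξ) :=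
    fun k => ((hFm.enorm.pow_const 2).mul
      ((measurable_lpWeight ε).comp (measurable_const_smul _))).aemeasurable
  rw [← lintegral_tsum hm,
    ← (hf i).lintegral_enorm_sq_fourier, ← lintegral_const_mul _ (hFm.enorm.pow_const 2)]
  refine lintegral_mono fun ξ => ?_
  dsimp only
  rw [ENNReal.tsum_mul_left, mul_comm]
  gcongr
  exact hCw ξ

end Scales

/-! ### The maximal estimate for test functions. -/

section TestFunctions

variable {m d : ℕ}

theorem ENNReal.rpow_sum_le_sum_rpow {ι : Type*} (s : Finset ι) (a : ι → ℝ≥0∞) {p : ℝ}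
    (hp : 0 < p) (hp1 : p ≤ 1) : (∑ i ∈ s, a i) ^ p ≤ ∑ i ∈ s, a i ^ p := by
  classical
  induction s using Finset.induction_on with
  | empty => simp [hp]
  | insert i s hi ih =>
    rw [Finset.sum_insert hi, Finset.sum_insert hi]
    exact (ENNReal.rpow_add_le_add_rpow _ _ hp.le hp1).trans (by gcongr)

theorem lintegral_prod_rpow_inv_card_le {X : Type*} [MeasurableSpace X] {μ : Measure X}
    (hm : m ≠ 0) {F : Fin m → X → ℝ≥0∞} (hF : ∀ i, AEMeasurable (F i) μ) :
    ∫⁻ x, (∏ i, F i x) ^ (m : ℝ)⁻¹ ∂μ ≤ ∏ i, (∫⁻ x, F i x ∂μ) ^ (m : ℝ)⁻¹ := by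
  simp_rw [← ENNReal.prod_rpow_of_nonneg (inv_nonneg.2 (Nat.cast_nonneg m : (0 : ℝ) ≤ m))]
  refine ENNReal.lintegral_prod_norm_pow_le Finset.univ (fun i _ => hF i) ?_
    fun _ _ => by positivity
  rw [Finset.sum_const, Finset.card_univ, Fintype.card_fin, nsmul_eq_mul]
  exact mul_inv_cancel₀ (by exact_mod_cast hm)

/-- Needed so that the product of maximal functions can be divided out and multiplied back in. -/
theorem hlMaximal_ne_zero {f : EuclideanSpace ℝ (Fin d) → ℂ} (hf : Continuous f) (h0 : f ≠ 0)
    (x : EuclideanSpace ℝ (Fin d)) : hlMaximal (fun y => ‖f y‖ₑ) x ≠ 0 := by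
  intro h
  obtain ⟨y, hy⟩ := Function.ne_iff.1 h0
  have h1 : ∫⁻ u in Metric.ball x (dist y x + 1), ‖f u‖ₑ = 0 := by
    have := lintegral_ball_le_hlMaximal (fun y => ‖f y‖ₑ) x
      (r := dist y x + 1) (by positivity)
    rwa [h, mul_zero, nonpos_iff_eq_zero] at this
  rw [setLIntegral_eq_zero_iff measurableSet_ball hf.enorm.measurable] at h1
  have h2 : IsOpen (Metric.ball x (dist y x + 1) ∩ {u | f u ≠ 0}) :=
    Metric.isOpen_ball.inter (isOpen_ne_fun hf continuous_const)
  have h3 : volume (Metric.ball x (dist y x + 1) ∩ {u | f u ≠ 0}) = 0 := by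
    refine measure_mono_null (fun u hu => ?_) h1
    intro h4
    exact hu.2 (by simpa using h4 hu.1)
  have h4 := h2.eq_empty_of_measure_zero h3
  exact (h4 ▸ (⟨by simp, hy⟩ : y ∈ Metric.ball x (dist y x + 1) ∩ {u | f u ≠ 0}) :
    y ∈ (∅ : Set (EuclideanSpace ℝ (Fin d))))

theorem IsTestFunction.hlMaximal_ne_top {f : EuclideanSpace ℝ (Fin d) → ℂ} (hf : IsTestFunction f)
    (x : EuclideanSpace ℝ (Fin d)) : hlMaximal (fun y => ‖f y‖ₑ) x ≠ ∞ := by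
  obtain ⟨K, hK⟩ := hf.exists_bound
  refine ((hlMaximal_le_of_le_const (c := ENNReal.ofReal K) (fun y => ?_) x).trans_lt
    ENNReal.ofReal_lt_top).ne
  rw [← ofReal_norm]
  exact ENNReal.ofReal_le_ofReal (hK y)

theorem IsTestFunction.lintegral_hlMaximal_sq_le {f : EuclideanSpace ℝ (Fin d) → ℂ}
    (hf : IsTestFunction f) :
    ∫⁻ x, hlMaximal (fun y => ‖f y‖ₑ) x ^ 2 ≤ (8 * 4 ^ d : ℝ≥0) * ∫⁻ x, ‖f x‖ₑ ^ 2 := by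
  obtain ⟨K, hK⟩ := hf.exists_bound
  have := _root_.lintegral_hlMaximal_sq_le hf.continuous.enorm.measurable
    (K := ENNReal.ofReal K) ENNReal.ofReal_ne_top fun y => by
      rw [← ofReal_norm]
      exact ENNReal.ofReal_le_ofReal (hK y)
  rw [finrank_euclideanSpace_fin] at this
  exact_mod_cast this

/-- The part of the maximal function where exactly the variables in `S` carry frequencies above
the scale of the average. -/
noncomputable def bandMaximal (σ : Measure (ProdSpace m d)) (S : Finset (Fin m))
    (f : Fin m → EuclideanSpace ℝ (Fin d) → ℂ) (x : EuclideanSpace ℝ (Fin d)) : ℝ≥0∞ :=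
  ⨆ k : ℤ, unitMaximal σ (bandPiece (fun i x => f i ((2 : ℝ) ^ k • x)) S) (((2 : ℝ) ^ k)⁻¹ • x)

theorem measurable_unitMaximal_dilate (σ : Measure (ProdSpace m d)) [IsFiniteMeasure σ]
    (S : Finset (Fin m)) {f : Fin m → EuclideanSpace ℝ (Fin d) → ℂ}
    (hf : ∀ i, IsTestFunction (f i)) (k : ℤ) :
    Measurable fun x => unitMaximal σ (bandPiece (fun i x => f i ((2 : ℝ) ^ k • x)) S)
      (((2 : ℝ) ^ k)⁻¹ • x) :=
  (measurable_unitMaximal σ (IsTestFunction.bandPiece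
    (fun i => (hf i).comp_smul (by positivity : (2 : ℝ) ^ k ≠ 0)) S)).comp
      (measurable_const_smul _)

theorem measurable_bandMaximal (σ : Measure (ProdSpace m d)) [IsFiniteMeasure σ]
    (S : Finset (Fin m)) {f : Fin m → EuclideanSpace ℝ (Fin d) → ℂ}
    (hf : ∀ i, IsTestFunction (f i)) : Measurable (bandMaximal σ S f) :=
  Measurable.iSup fun k => measurable_unitMaximal_dilate σ S hf k

theorem multMaximal_le_sum_bandMaximal (σ : Measure (ProdSpace m d)) [IsFiniteMeasure σ]
    {f : Fin m → EuclideanSpace ℝ (Fin d) → ℂ} (hf : ∀ i, IsTestFunction (f i))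
    (x : EuclideanSpace ℝ (Fin d)) :
    multMaximal σ f x ≤ ∑ S : Finset (Fin m), bandMaximal σ S f x := by
  refine (multMaximal_le_iSup_unitMaximal σ f x).trans (iSup_le fun k => ?_)
  refine (unitMaximal_le_sum_bandPiece σ
    (fun i => (hf i).comp_smul (by positivity : (2 : ℝ) ^ k ≠ 0)) _).trans ?_
  refine Finset.sum_le_sum fun S _ => ?_
  exact le_iSup (fun k : ℤ => unitMaximal σ (bandPiece (fun i x => f i ((2 : ℝ) ^ k • x)) S)
    (((2 : ℝ) ^ k)⁻¹ • x)) k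

theorem exists_lintegral_bandMaximal_empty_le (hm : 2 ≤ m) (σ : Measure (ProdSpace m d))
    [IsFiniteMeasure σ] (hsupp : σ (Metric.closedBall (0 : ProdSpace m d) 1)ᶜ = 0) :
    ∃ C : ℝ≥0, ∀ f : Fin m → EuclideanSpace ℝ (Fin d) → ℂ, (∀ i, IsTestFunction (f i)) →
      ∫⁻ x, (bandMaximal σ ∅ f x ^ 2) ^ (m : ℝ)⁻¹ ≤
        C * ∏ i, (∫⁻ x, ‖f i x‖ₑ ^ 2) ^ (m : ℝ)⁻¹ := by
  obtain ⟨K, hK⟩ := exists_unitMaximal_bandPiece_empty_le σ hsupp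
  have hm0 : (0 : ℝ) ≤ (m : ℝ)⁻¹ := by positivity
  refine ⟨(K ^ 2) ^ (m : ℝ)⁻¹ * ∏ _i : Fin m, (8 * 4 ^ d) ^ (m : ℝ)⁻¹, fun f hf => ?_⟩
  have hpt : ∀ x, (bandMaximal σ ∅ f x ^ 2) ^ (m : ℝ)⁻¹ ≤
      ((K : ℝ≥0∞) ^ 2) ^ (m : ℝ)⁻¹ * (∏ i, hlMaximal (fun y => ‖f i y‖ₑ) x ^ 2) ^ (m : ℝ)⁻¹ := by
    intro x
    rw [← ENNReal.mul_rpow_of_nonneg _ _ hm0, Finset.prod_pow, ← mul_pow]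
    gcongr
    refine iSup_le fun k => (hK _ _).trans ?_
    gcongr with i
    exact hlMaximal_comp_smul_le (by positivity) (fun y => ‖f i y‖ₑ) x
  have hM : ∀ i, Measurable fun x => hlMaximal (fun y => ‖f i y‖ₑ) x ^ 2 := fun i =>
    (lowerSemicontinuous_hlMaximal _).measurable.pow_const 2
  refine (lintegral_mono hpt).trans ?_
  rw [lintegral_const_mul _ ((Finset.measurable_prod _ fun i _ => hM i).pow_const _),
    ENNReal.coe_mul, mul_assoc, ENNReal.coe_rpow_of_nonneg _ hm0, ENNReal.coe_pow]
  gcongr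
  refine (lintegral_prod_rpow_inv_card_le (by omega) fun i => (hM i).aemeasurable).trans ?_
  rw [ENNReal.ofNNReal_finsetProd, ← Finset.prod_mul_distrib]
  refine Finset.prod_le_prod' fun i _ => ?_
  rw [ENNReal.coe_rpow_of_nonneg _ hm0, ← ENNReal.mul_rpow_of_nonneg _ _ hm0]
  gcongr
  exact (hf i).lintegral_hlMaximal_sq_le

/-- After division by the maximal functions, the supremum over scales is at most the sum over scales
in the power `2/|S|`. The square of the band maximal function is then a product of `m` integrable
factors, namely `|S|` copies of `Y` and the squares of the `m - |S|` maximal functions, and Hölder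
with `m` equal exponents applies. -/
theorem exists_lintegral_bandMaximal_le (hm : 2 ≤ m) (hd : 1 ≤ d) {s : ℝ}
    (hs : ((m : ℝ) - 1) * (d : ℝ) / 2 + 1 / 2 < s) (σ : Measure (ProdSpace m d))
    [IsFiniteMeasure σ] (hsupp : σ (Metric.closedBall (0 : ProdSpace m d) 1)ᶜ = 0)
    (hdecay : HasFourierDecay σ s) (S : Finset (Fin m)) (hS : S.Nonempty) :
    ∃ C : ℝ≥0, ∀ f : Fin m → EuclideanSpace ℝ (Fin d) → ℂ, (∀ i, IsTestFunction (f i)) →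
      (∀ i, f i ≠ 0) →
      ∫⁻ x, (bandMaximal σ S f x ^ 2) ^ (m : ℝ)⁻¹ ≤
        C * ∏ i, (∫⁻ x, ‖f i x‖ₑ ^ 2) ^ (m : ℝ)⁻¹ := by
  obtain ⟨C, hC⟩ := exists_tsum_lintegral_unitMaximal_bandPiece_le hm hd hs σ hsupp hdecay S hS
  have hm0 : (0 : ℝ) ≤ (m : ℝ)⁻¹ := by positivity
  have hp0 : (0 : ℝ) ≤ (S.card : ℝ)⁻¹ := by positivity
  have hcard : (S.card : ℝ) ≠ 0 := by exact_mod_cast hS.card_pos.ne'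
  refine ⟨(∏ _i ∈ S, C ^ (m : ℝ)⁻¹) * ∏ _i ∈ Sᶜ, (8 * 4 ^ d) ^ (m : ℝ)⁻¹, fun f hf hf0 => ?_⟩
  set W : EuclideanSpace ℝ (Fin d) → ℝ≥0∞ :=
    fun x => ∏ i ∈ Sᶜ, hlMaximal (fun y => ‖f i y‖ₑ) x with hW
  have hMm : ∀ i, Measurable (hlMaximal fun y => ‖f i y‖ₑ) := fun i =>
    (lowerSemicontinuous_hlMaximal _).measurable
  have hWm : Measurable W := Finset.measurable_prod _ fun i _ => hMm i
  have hW0 : ∀ x, W x ≠ 0 := fun x =>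
    Finset.prod_ne_zero_iff.2 fun i _ => hlMaximal_ne_zero (hf i).continuous (hf0 i) x
  have hWt : ∀ x, W x ≠ ∞ := fun x => ENNReal.prod_ne_top fun i _ => (hf i).hlMaximal_ne_top x
  set Y : EuclideanSpace ℝ (Fin d) → ℝ≥0∞ :=
    fun x => ((bandMaximal σ S f x * (W x)⁻¹) ^ 2) ^ (S.card : ℝ)⁻¹ with hY
  have hYm : Measurable Y :=
    (((measurable_bandMaximal σ S hf).mul hWm.inv).pow_const 2).pow_const _
  have hYle : ∫⁻ x, Y x ≤ C * ∏ i ∈ S, (∫⁻ x, ‖f i x‖ₑ ^ 2) ^ (S.card : ℝ)⁻¹ := by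
    refine le_trans ?_ (hC f hf)
    have hTm : ∀ k : ℤ, AEMeasurable fun x =>
        ((unitMaximal σ (bandPiece (fun i x => f i ((2 : ℝ) ^ k • x)) S)
          (((2 : ℝ) ^ k)⁻¹ • x) * (W x)⁻¹) ^ 2) ^ (S.card : ℝ)⁻¹ := fun k =>
      ((((measurable_unitMaximal_dilate σ S hf k).mul hWm.inv).pow_const 2).pow_const _).aemeasurable
    rw [← lintegral_tsum hTm]
    refine lintegral_mono fun x => ?_
    have hmono : Monotone fun a : ℝ≥0∞ => ((a * (W x)⁻¹) ^ 2) ^ (S.card : ℝ)⁻¹ := by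
      intro a b hab
      dsimp only
      gcongr
    have hcont : Continuous fun a : ℝ≥0∞ => ((a * (W x)⁻¹) ^ 2) ^ (S.card : ℝ)⁻¹ := by
      have := ENNReal.continuous_mul_const (ENNReal.inv_ne_top.2 (hW0 x))
      exact (ENNReal.continuous_rpow_const).comp ((ENNReal.continuous_pow 2).comp this)
    rw [hY]
    dsimp only
    rw [bandMaximal, hmono.map_iSup_of_continuousAt hcont.continuousAt
      (by simpa using hS)]
    exact iSup_le fun k => ENNReal.le_tsum k
  have hpt : ∀ x, bandMaximal σ S f x ^ 2 =
      ∏ i, if i ∈ S then Y x else hlMaximal (fun y => ‖f i y‖ₑ) x ^ 2 := by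
    intro x
    rw [Finset.prod_ite, Finset.prod_const]
    have h1 : (Finset.univ.filter fun i => i ∈ S) = S := by ext; simp
    have h2 : (Finset.univ.filter fun i => i ∉ S) = Sᶜ := by ext; simp
    rw [h1, h2, Finset.prod_pow, hY]
    dsimp only
    rw [← ENNReal.rpow_mul_natCast, inv_mul_cancel₀ hcard, ENNReal.rpow_one, ← mul_pow, mul_assoc,
      ENNReal.inv_mul_cancel (hW0 x) (hWt x), mul_one]
  simp_rw [hpt]
  refine (lintegral_prod_rpow_inv_card_le (by omega) fun i => ?_).trans ?_
  · split_ifs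
    · exact hYm.aemeasurable
    · exact ((hMm i).pow_const 2).aemeasurable
  rw [← Finset.prod_mul_prod_compl S, ← Finset.prod_mul_prod_compl S
    fun i => (∫⁻ x, ‖f i x‖ₑ ^ 2) ^ (m : ℝ)⁻¹, ENNReal.coe_mul, ENNReal.ofNNReal_finsetProd,
    ENNReal.ofNNReal_finsetProd, mul_mul_mul_comm, ← Finset.prod_mul_distrib,
    ← Finset.prod_mul_distrib]
  refine mul_le_mul' ?_ (Finset.prod_le_prod' fun i hi => ?_)
  · calc ∏ i ∈ S, (∫⁻ x, if i ∈ S then Y x else hlMaximal (fun y => ‖f i y‖ₑ) x ^ 2) ^ (m : ℝ)⁻¹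
        = ∏ i ∈ S, (∫⁻ x, Y x) ^ (m : ℝ)⁻¹ := Finset.prod_congr rfl fun i hi => by simp [hi]
      _ ≤ ∏ i ∈ S, (C * ∏ i ∈ S, (∫⁻ x, ‖f i x‖ₑ ^ 2) ^ (S.card : ℝ)⁻¹) ^ (m : ℝ)⁻¹ := by
          gcongr
      _ = _ := by
          simp_rw [ENNReal.coe_rpow_of_nonneg _ hm0, ENNReal.mul_rpow_of_nonneg _ _ hm0]
          rw [Finset.prod_mul_distrib, Finset.prod_mul_distrib]
          congr 1
          rw [Finset.prod_const, ENNReal.prod_rpow_of_nonneg hm0, ENNReal.prod_rpow_of_nonneg hp0,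
            ← ENNReal.rpow_mul, ← ENNReal.rpow_mul_natCast]
          congr 1
          field_simp
  · simp only [if_neg (Finset.mem_compl.1 hi)]
    rw [ENNReal.coe_rpow_of_nonneg _ hm0,
      ← ENNReal.mul_rpow_of_nonneg _ _ hm0]
    gcongr
    exact (hf i).lintegral_hlMaximal_sq_le

/-- The bound for test functions. -/
theorem exists_lintegral_multMaximal_le (hm : 2 ≤ m) (hd : 1 ≤ d) {s : ℝ}
    (hs : ((m : ℝ) - 1) * (d : ℝ) / 2 + 1 / 2 < s) (σ : Measure (ProdSpace m d))
    [IsFiniteMeasure σ] (hsupp : σ (Metric.closedBall (0 : ProdSpace m d) 1)ᶜ = 0)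
    (hdecay : HasFourierDecay σ s) :
    ∃ C : ℝ≥0, ∀ f : Fin m → EuclideanSpace ℝ (Fin d) → ℂ, (∀ i, IsTestFunction (f i)) →
      ∫⁻ x, (multMaximal σ f x ^ 2) ^ (m : ℝ)⁻¹ ≤
        C * ∏ i, (∫⁻ x, ‖f i x‖ₑ ^ 2) ^ (m : ℝ)⁻¹ := by
  have h : ∀ S : Finset (Fin m), ∃ C : ℝ≥0, ∀ f : Fin m → EuclideanSpace ℝ (Fin d) → ℂ,
      (∀ i, IsTestFunction (f i)) → (∀ i, f i ≠ 0) →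
      ∫⁻ x, (bandMaximal σ S f x ^ 2) ^ (m : ℝ)⁻¹ ≤
        C * ∏ i, (∫⁻ x, ‖f i x‖ₑ ^ 2) ^ (m : ℝ)⁻¹ := by
    intro S
    rcases S.eq_empty_or_nonempty with rfl | hS
    · obtain ⟨C, hC⟩ := exists_lintegral_bandMaximal_empty_le hm σ hsupp
      exact ⟨C, fun f hf _ => hC f hf⟩
    · exact exists_lintegral_bandMaximal_le hm hd hs σ hsupp hdecay S hS
  choose C hC using h
  have hm0 : (0 : ℝ) < m := by positivity
  refine ⟨∑ S, C S, fun f hf => ?_⟩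
  by_cases hf0 : ∀ i, f i ≠ 0
  -- Since `m ≥ 2`, the power `2/m` is subadditive, so the finitely many band pieces can be summed
  -- although `L^(2/m)` is in general only quasi-normed.
  · have hp1 : 2 * (m : ℝ)⁻¹ ≤ 1 := by
      rw [← div_eq_mul_inv, div_le_one hm0]; exact_mod_cast hm
    have e : ∀ a : ℝ≥0∞, (a ^ 2) ^ (m : ℝ)⁻¹ = a ^ (2 * (m : ℝ)⁻¹) := fun a => by
      rw [ENNReal.rpow_mul, ENNReal.rpow_two]
    calc ∫⁻ x, (multMaximal σ f x ^ 2) ^ (m : ℝ)⁻¹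
        ≤ ∫⁻ x, ∑ S : Finset (Fin m), (bandMaximal σ S f x ^ 2) ^ (m : ℝ)⁻¹ := by
          refine lintegral_mono fun x => ?_
          simp_rw [e]
          refine le_trans ?_ (ENNReal.rpow_sum_le_sum_rpow _ _ (by positivity) hp1)
          gcongr
          exact multMaximal_le_sum_bandMaximal σ hf x
      _ = ∑ S : Finset (Fin m), ∫⁻ x, (bandMaximal σ S f x ^ 2) ^ (m : ℝ)⁻¹ :=
          lintegral_finsetSum _ fun S _ =>
            ((measurable_bandMaximal σ S hf).pow_const 2).pow_const _
      _ ≤ ∑ S, C S * ∏ i, (∫⁻ x, ‖f i x‖ₑ ^ 2) ^ (m : ℝ)⁻¹ :=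
          Finset.sum_le_sum fun S _ => hC S f hf hf0
      _ = _ := by rw [ENNReal.ofNNReal_finsetSum, Finset.sum_mul]
  · push Not at hf0
    obtain ⟨i, hi⟩ := hf0
    have : ∀ x, multMaximal σ f x = 0 := by
      intro x
      simp only [multMaximal, ENNReal.iSup_eq_zero, enorm_eq_zero]
      intro t _
      refine integral_eq_zero_of_ae (Filter.Eventually.of_forall fun y => ?_)
      exact Finset.prod_eq_zero (Finset.mem_univ i) (by simp [hi])
    have h2 : (0 : ℝ) < (m : ℝ)⁻¹ := by positivity
    simp [this, ENNReal.zero_rpow_of_pos h2]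

end TestFunctions

/-! ### Approximation of lower semicontinuous functions by test functions. -/

section Mollification

open Filter Topology
open scoped Convolution

variable {d : ℕ}

/-- Smooth bump functions shrinking to the origin. -/
noncomputable def shrinkingBump (d n : ℕ) : ContDiffBump (0 : EuclideanSpace ℝ (Fin d)) :=
  ⟨1 / (n + 1) / 2, 1 / (n + 1), by positivity, half_lt_self (by positivity)⟩

/-- Truncation of a function in height and space. -/
noncomputable def heightTrunc (n : ℕ) (g : EuclideanSpace ℝ (Fin d) → ℝ≥0∞) :
    EuclideanSpace ℝ (Fin d) → ℝ≥0∞ :=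
  (Metric.ball 0 n).indicator fun z => min (g z) n

/-- Mollified truncations. -/
noncomputable def smoothTrunc (n : ℕ) (g : EuclideanSpace ℝ (Fin d) → ℝ≥0∞)
    (x : EuclideanSpace ℝ (Fin d)) : ℝ≥0∞ :=
  ∫⁻ y, ENNReal.ofReal ((shrinkingBump d n).normed volume y) * heightTrunc n g (x - y)

variable {g : EuclideanSpace ℝ (Fin d) → ℝ≥0∞}

theorem heightTrunc_le_natCast (n : ℕ) (g : EuclideanSpace ℝ (Fin d) → ℝ≥0∞)
    (z : EuclideanSpace ℝ (Fin d)) : heightTrunc n g z ≤ n :=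
  Set.indicator_apply_le' (fun _ => min_le_right _ _) fun _ => zero_le

theorem heightTrunc_le (n : ℕ) (g : EuclideanSpace ℝ (Fin d) → ℝ≥0∞)
    (z : EuclideanSpace ℝ (Fin d)) : heightTrunc n g z ≤ g z :=
  Set.indicator_apply_le' (fun _ => min_le_left _ _) fun _ => zero_le

theorem Measurable.heightTrunc (hg : Measurable g) (n : ℕ) : Measurable (heightTrunc n g) :=
  (hg.min measurable_const).indicator measurableSet_ball

theorem lintegral_ofReal_shrinkingBump (d n : ℕ) :
    ∫⁻ y, ENNReal.ofReal ((shrinkingBump d n).normed volume y) = 1 := by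
  rw [← ofReal_integral_eq_lintegral_ofReal (shrinkingBump d n).integrable_normed
    (Eventually.of_forall fun y => (shrinkingBump d n).nonneg_normed y),
    (shrinkingBump d n).integral_normed, ENNReal.ofReal_one]

theorem measurable_ofReal_shrinkingBump (d n : ℕ) :
    Measurable fun y => ENNReal.ofReal ((shrinkingBump d n).normed volume y) :=
  ((shrinkingBump d n).continuous_normed).measurable.ennreal_ofReal

theorem smoothTrunc_le_natCast (n : ℕ) (g : EuclideanSpace ℝ (Fin d) → ℝ≥0∞)
    (x : EuclideanSpace ℝ (Fin d)) : smoothTrunc n g x ≤ n := by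
  calc smoothTrunc n g x
      ≤ ∫⁻ y, ENNReal.ofReal ((shrinkingBump d n).normed volume y) * n := by
        refine lintegral_mono fun y => ?_
        gcongr
        exact heightTrunc_le_natCast n g _
    _ = n := by
        rw [lintegral_mul_const _ (measurable_ofReal_shrinkingBump d n),
          lintegral_ofReal_shrinkingBump, one_mul]

theorem isTestFunction_smoothTrunc (hg : Measurable g) (n : ℕ) :
    IsTestFunction fun x => (((smoothTrunc n g x).toReal : ℝ) : ℂ) := by
  set τ : EuclideanSpace ℝ (Fin d) → ℂ := fun z => ((heightTrunc n g z).toReal : ℝ) with hτ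
  have hτm : Measurable τ := Complex.measurable_ofReal.comp (hg.heightTrunc n).ennreal_toReal
  have hτs : HasCompactSupport τ := by
    refine HasCompactSupport.intro (isCompact_closedBall 0 (n : ℝ)) fun z hz => ?_
    have : z ∉ Metric.ball 0 (n : ℝ) := fun h => hz (Metric.ball_subset_closedBall h)
    simp [hτ, heightTrunc, this]
  have hτb : ∀ z, ‖τ z‖ ≤ n := by
    intro z
    rw [hτ]
    dsimp only
    rw [Complex.norm_real, Real.norm_of_nonneg ENNReal.toReal_nonneg]
    exact ENNReal.toReal_le_of_le_ofReal (by positivity) (by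
      rw [ENNReal.ofReal_natCast]; exact heightTrunc_le_natCast n g z)
  have hτl : LocallyIntegrable τ := by
    refine (locallyIntegrable_const (n : ℝ)).mono hτm.aestronglyMeasurable
      (Eventually.of_forall fun z => ?_)
    simpa using hτb z
  have heq : (fun x => (((smoothTrunc n g x).toReal : ℝ) : ℂ)) =
      (shrinkingBump d n).normed volume ⋆[ContinuousLinearMap.lsmul ℝ ℝ, volume] τ := by
    ext x
    have hm : Measurable fun y => ENNReal.ofReal ((shrinkingBump d n).normed volume y) *
        heightTrunc n g (x - y) :=
      (measurable_ofReal_shrinkingBump d n).mul ((hg.heightTrunc n).comp (by fun_prop))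
    rw [smoothTrunc, ← integral_toReal hm.aemeasurable, ← integral_complex_ofReal, convolution]
    · congr 1; ext y
      simp [hτ, ENNReal.toReal_mul,
        ENNReal.toReal_ofReal ((shrinkingBump d n).nonneg_normed (μ := volume) y)]
    · refine Eventually.of_forall fun y => ENNReal.mul_lt_top ENNReal.ofReal_lt_top ?_
      exact (heightTrunc_le_natCast n g _).trans_lt (ENNReal.natCast_lt_top n)
  rw [heq]
  exact ⟨(shrinkingBump d n).hasCompactSupport_normed.contDiff_convolution_left _
    (shrinkingBump d n).contDiff_normed hτl,
    (shrinkingBump d n).hasCompactSupport_normed.convolution _ hτs⟩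

theorem enorm_smoothTrunc (n : ℕ) (g : EuclideanSpace ℝ (Fin d) → ℝ≥0∞)
    (x : EuclideanSpace ℝ (Fin d)) :
    ‖(((smoothTrunc n g x).toReal : ℝ) : ℂ)‖ₑ = smoothTrunc n g x := by
  rw [← ofReal_norm, Complex.norm_real, Real.norm_of_nonneg ENNReal.toReal_nonneg,
    ENNReal.ofReal_toReal]
  exact ((smoothTrunc_le_natCast n g x).trans_lt (ENNReal.natCast_lt_top n)).ne

/-- If `c < g x`, then `c < g` on a neighbourhood of `x`; once the mollifier fits inside it and the
truncations no longer interfere, averaging against a probability density keeps the value at least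
`c`. -/
theorem le_liminf_smoothTrunc (hg : LowerSemicontinuous g) (x : EuclideanSpace ℝ (Fin d)) :
    g x ≤ liminf (fun n => smoothTrunc n g x) atTop := by
  refine le_of_forall_lt_imp_le_of_dense fun c hc => ?_
  refine le_liminf_of_le (by isBoundedDefault) ?_
  obtain ⟨δ, hδ, hball⟩ := Metric.eventually_nhds_iff.1 (hg x c hc)
  obtain ⟨N₁, hN₁⟩ := ENNReal.exists_nat_gt hc.ne_top
  obtain ⟨N₂, hN₂⟩ := exists_nat_gt (‖x‖ + 1)
  have h1 : ∀ᶠ n : ℕ in atTop, 1 / ((n : ℝ) + 1) < δ :=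
    tendsto_one_div_add_atTop_nhds_zero_nat.eventually_lt_const hδ
  filter_upwards [h1, eventually_ge_atTop N₁, eventually_ge_atTop N₂] with n hn hn1 hn2
  calc c = ∫⁻ y, ENNReal.ofReal ((shrinkingBump d n).normed volume y) * c := by
        rw [lintegral_mul_const _ (measurable_ofReal_shrinkingBump d n),
          lintegral_ofReal_shrinkingBump, one_mul]
    _ ≤ smoothTrunc n g x := by
        refine lintegral_mono fun y => ?_
        dsimp only
        by_cases hy : y ∈ Function.support ((shrinkingBump d n).normed volume)
        · gcongr
          rw [(shrinkingBump d n).support_normed_eq, mem_ball_zero_iff] at hy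
          have hy' : ‖y‖ < 1 / ((n : ℝ) + 1) := hy
          have hle : 1 / ((n : ℝ) + 1) ≤ 1 := by
            rw [div_le_one (by positivity)]
            linarith [Nat.cast_nonneg (α := ℝ) n]
          have h2 : x - y ∈ Metric.ball (0 : EuclideanSpace ℝ (Fin d)) n := by
            rw [mem_ball_zero_iff]
            have h3 : (N₂ : ℝ) ≤ n := by exact_mod_cast hn2
            linarith [norm_sub_le x y]
          rw [heightTrunc, Set.indicator_of_mem h2]
          refine le_min (hball ?_).le (hN₁.le.trans (by exact_mod_cast hn1))
          rw [dist_eq_norm, sub_sub_cancel_left, norm_neg]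
          exact hy'.trans hn
        · rw [Function.notMem_support] at hy
          simp [hy]

/-- Cauchy–Schwarz against the probability density bounds the square of the average by the average
of the square; Fubini and translation invariance conclude. -/
theorem lintegral_smoothTrunc_sq_le (hg : Measurable g) (n : ℕ) :
    ∫⁻ x, smoothTrunc n g x ^ 2 ≤ ∫⁻ x, g x ^ 2 := by
  set φ : EuclideanSpace ℝ (Fin d) → ℝ≥0∞ :=
    fun y => ENNReal.ofReal ((shrinkingBump d n).normed volume y) with hφ
  have hφm : Measurable φ := measurable_ofReal_shrinkingBump d n
  have hφ1 : ∫⁻ y, φ y = 1 := lintegral_ofReal_shrinkingBump d n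
  have hτm := hg.heightTrunc n
  have hpt : ∀ x, smoothTrunc n g x ^ 2 ≤ ∫⁻ y, φ y * heightTrunc n g (x - y) ^ 2 := by
    intro x
    have hm : Measurable fun y => φ y * heightTrunc n g (x - y) ^ 2 :=
      hφm.mul ((hτm.comp (by fun_prop)).pow_const 2)
    have h1 := ENNReal.lintegral_mul_norm_pow_le (μ := volume) hm.aemeasurable hφm.aemeasurable
      (p := 1 / 2) (q := 1 / 2) (by norm_num) (by norm_num) (by norm_num)
    have h2 : ∀ y, (φ y * heightTrunc n g (x - y) ^ 2) ^ (1 / 2 : ℝ) * φ y ^ (1 / 2 : ℝ) =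
        φ y * heightTrunc n g (x - y) := by
      intro y
      rw [ENNReal.mul_rpow_of_nonneg _ _ (by norm_num), mul_right_comm,
        ← ENNReal.rpow_add_of_nonneg _ _ (by norm_num) (by norm_num), ← ENNReal.rpow_natCast_mul]
      norm_num
    simp only [h2, hφ1, ENNReal.one_rpow, mul_one] at h1
    calc smoothTrunc n g x ^ 2
        ≤ ((∫⁻ y, φ y * heightTrunc n g (x - y) ^ 2) ^ (1 / 2 : ℝ)) ^ 2 := by
          gcongr; exact h1
      _ = _ := by rw [← ENNReal.rpow_mul_natCast]; norm_num
  calc ∫⁻ x, smoothTrunc n g x ^ 2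
      ≤ ∫⁻ x, ∫⁻ y, φ y * heightTrunc n g (x - y) ^ 2 := lintegral_mono hpt
    _ = ∫⁻ y, ∫⁻ x, φ y * heightTrunc n g (x - y) ^ 2 := by
        refine lintegral_lintegral_swap (Measurable.aemeasurable ?_)
        exact (hφm.comp measurable_snd).mul
          ((hτm.comp (measurable_fst.sub measurable_snd)).pow_const 2)
    _ = ∫⁻ y, φ y * ∫⁻ x, heightTrunc n g x ^ 2 := by
        refine lintegral_congr fun y => ?_
        rw [lintegral_const_mul' _ _ ENNReal.ofReal_ne_top,
          lintegral_sub_right_eq_self fun x => heightTrunc n g x ^ 2]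
    _ = ∫⁻ x, heightTrunc n g x ^ 2 := by rw [lintegral_mul_const _ hφm, hφ1, one_mul]
    _ ≤ _ := lintegral_mono fun x => by
        dsimp only
        gcongr
        exact heightTrunc_le n g x

end Mollification

/-! ### Lower semicontinuous majorants. -/

section General

open Filter Topology

variable {m d : ℕ}

theorem ENNReal.prod_liminf_le {ι α : Type*} {l : Filter α} (s : Finset ι) (u : ι → α → ℝ≥0∞) :
    ∏ i ∈ s, liminf (u i) l ≤ liminf (fun a => ∏ i ∈ s, u i a) l := by
  classical
  induction s using Finset.induction_on with
  | empty =>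
    simp only [Finset.prod_empty]
    exact le_liminf_of_le (by isBoundedDefault) (Eventually.of_forall fun _ => le_rfl)
  | insert i s hi ih =>
    simp_rw [Finset.prod_insert hi]
    exact (mul_le_mul_right ih _).trans ENNReal.le_liminf_mul

theorem measurable_multMaximal (σ : Measure (ProdSpace m d)) [IsFiniteMeasure σ]
    {f : Fin m → EuclideanSpace ℝ (Fin d) → ℂ} (hf : ∀ i, IsTestFunction (f i)) :
    Measurable (multMaximal σ f) := by
  refine LowerSemicontinuous.measurable (lowerSemicontinuous_iSup fun t =>
    lowerSemicontinuous_iSup fun _ => ?_)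
  exact (continuous_multAverage σ hf t).enorm.lowerSemicontinuous

/-- The mollified truncations are nonnegative, so the modulus of the average loses nothing and the
maximal bound controls integrals of absolute values. -/
theorem enorm_multAverage_smoothTrunc (σ : Measure (ProdSpace m d)) [IsFiniteMeasure σ]
    {g : Fin m → EuclideanSpace ℝ (Fin d) → ℝ≥0∞} (hg : ∀ i, Measurable (g i)) (n : ℕ)
    (x : EuclideanSpace ℝ (Fin d)) (t : ℝ) :
    ‖multAverage σ (fun i x => (((smoothTrunc n (g i) x).toReal : ℝ) : ℂ)) x t‖ₑ =
      ∫⁻ y, ∏ i, smoothTrunc n (g i) (x - t • y i) ∂σ := by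
  have h1 : multAverage σ (fun i x => (((smoothTrunc n (g i) x).toReal : ℝ) : ℂ)) x t =
      ((∫ y, ∏ i, (smoothTrunc n (g i) (x - t • y i)).toReal ∂σ : ℝ) : ℂ) := by
    rw [multAverage, ← integral_complex_ofReal]
    congr 1; ext y
    push_cast; rfl
  have h0 : ∀ y : ProdSpace m d, 0 ≤ ∏ i, (smoothTrunc n (g i) (x - t • y i)).toReal := fun y =>
    Finset.prod_nonneg fun i _ => ENNReal.toReal_nonneg
  have hi : Integrable (fun y : ProdSpace m d =>
      ∏ i, (smoothTrunc n (g i) (x - t • y i)).toReal) σ := by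
    have := (integrable_prod_shift σ (fun i => isTestFunction_smoothTrunc (hg i) n) x t).re
    refine this.congr (Eventually.of_forall fun y => ?_)
    simp only [← Complex.ofReal_prod]
    rfl
  rw [h1, ← ofReal_norm, Complex.norm_real, Real.norm_of_nonneg (integral_nonneg h0),
    ofReal_integral_eq_lintegral_ofReal hi (Eventually.of_forall h0)]
  refine lintegral_congr fun y => ?_
  rw [ENNReal.ofReal_prod_of_nonneg fun i _ => ENNReal.toReal_nonneg]
  refine Finset.prod_congr rfl fun i _ => ENNReal.ofReal_toReal ?_
  exact ((smoothTrunc_le_natCast n (g i) _).trans_lt (ENNReal.natCast_lt_top n)).ne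

/-- A measurable majorant of the maximal function of lower semicontinuous functions. -/
theorem exists_majorant_of_lowerSemicontinuous {σ : Measure (ProdSpace m d)} [IsFiniteMeasure σ]
    {C : ℝ≥0} (hC : ∀ f : Fin m → EuclideanSpace ℝ (Fin d) → ℂ, (∀ i, IsTestFunction (f i)) →
      ∫⁻ x, (multMaximal σ f x ^ 2) ^ (m : ℝ)⁻¹ ≤
        C * ∏ i, (∫⁻ x, ‖f i x‖ₑ ^ 2) ^ (m : ℝ)⁻¹)
    {g : Fin m → EuclideanSpace ℝ (Fin d) → ℝ≥0∞} (hg : ∀ i, LowerSemicontinuous (g i)) :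
    ∃ H : EuclideanSpace ℝ (Fin d) → ℝ≥0∞, Measurable H ∧
      (∀ x (t : ℝ), 0 < t → ∫⁻ y, ∏ i, g i (x - t • y i) ∂σ ≤ H x) ∧
      ∫⁻ x, (H x ^ 2) ^ (m : ℝ)⁻¹ ≤ C * ∏ i, (∫⁻ x, g i x ^ 2) ^ (m : ℝ)⁻¹ := by
  have hgm : ∀ i, Measurable (g i) := fun i => (hg i).measurable
  set F : ℕ → Fin m → EuclideanSpace ℝ (Fin d) → ℂ :=
    fun n i x => (((smoothTrunc n (g i) x).toReal : ℝ) : ℂ) with hF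
  have hFt : ∀ n i, IsTestFunction (F n i) := fun n i => isTestFunction_smoothTrunc (hgm i) n
  have hm : ∀ n, Measurable (multMaximal σ (F n)) := fun n => measurable_multMaximal σ (hFt n)
  have hSm : ∀ n i, Measurable (smoothTrunc n (g i)) := by
    intro n i
    have h := (hFt n i).continuous.enorm.measurable
    have e : (fun x => ‖F n i x‖ₑ) = smoothTrunc n (g i) := by
      ext x; exact enorm_smoothTrunc n (g i) x
    rwa [e] at h
  -- Fatou is used twice: against `σ` for the pointwise domination, and against Lebesgue measure for
  -- the norm bound. As a lower limit of measurable functions this majorant is measurable.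
  refine ⟨fun x => liminf (fun n => multMaximal σ (F n) x) atTop, Measurable.liminf hm,
    fun x t ht => ?_, ?_⟩
  · calc ∫⁻ y, ∏ i, g i (x - t • y i) ∂σ
        ≤ ∫⁻ y, liminf (fun n => ∏ i, smoothTrunc n (g i) (x - t • y i)) atTop ∂σ := by
          refine lintegral_mono fun y => ?_
          refine le_trans ?_ (ENNReal.prod_liminf_le _ _)
          exact Finset.prod_le_prod' fun i _ => le_liminf_smoothTrunc (hg i) _
      _ ≤ liminf (fun n => ∫⁻ y, ∏ i, smoothTrunc n (g i) (x - t • y i) ∂σ) atTop := by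
          refine lintegral_liminf_le fun n => Finset.measurable_prod _ fun i _ => ?_
          exact (hSm n i).comp (by fun_prop)
      _ ≤ _ := by
          refine liminf_le_liminf (Eventually.of_forall fun n => ?_)
          dsimp only
          rw [← enorm_multAverage_smoothTrunc σ hgm]
          exact le_iSup₂ (f := fun t _ => ‖multAverage σ (F n) x t‖ₑ) t ht
  · have hmono : Monotone fun a : ℝ≥0∞ => (a ^ 2) ^ (m : ℝ)⁻¹ := by
      intro a b hab
      dsimp only
      gcongr
    have hcont : Continuous fun a : ℝ≥0∞ => (a ^ 2) ^ (m : ℝ)⁻¹ :=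
      ENNReal.continuous_rpow_const.comp (ENNReal.continuous_pow 2)
    calc ∫⁻ x, (liminf (fun n => multMaximal σ (F n) x) atTop ^ 2) ^ (m : ℝ)⁻¹
        = ∫⁻ x, liminf (fun n => (multMaximal σ (F n) x ^ 2) ^ (m : ℝ)⁻¹) atTop := by
          refine lintegral_congr fun x => ?_
          exact hmono.map_liminf_of_continuousAt (fun n => multMaximal σ (F n) x)
            hcont.continuousAt
      _ ≤ liminf (fun n => ∫⁻ x, (multMaximal σ (F n) x ^ 2) ^ (m : ℝ)⁻¹) atTop :=
          lintegral_liminf_le fun n => ((hm n).pow_const 2).pow_const _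
      _ ≤ liminf (fun _ : ℕ => C * ∏ i, (∫⁻ x, g i x ^ 2) ^ (m : ℝ)⁻¹) atTop := by
          refine liminf_le_liminf (Eventually.of_forall fun n => ?_)
          refine (hC (F n) (hFt n)).trans ?_
          refine mul_le_mul_right (Finset.prod_le_prod' fun i _ => ENNReal.rpow_le_rpow ?_
            (inv_nonneg.2 (Nat.cast_nonneg m))) _
          refine le_trans (le_of_eq ?_) (lintegral_smoothTrunc_sq_le (hgm i) n)
          refine lintegral_congr fun x => ?_
          rw [hF, enorm_smoothTrunc]
      _ = _ := liminf_const _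

/-- A positive lower semicontinuous majorant with almost the same `L²` norm, which is infinite
wherever `f` differs from a measurable representative. -/
theorem exists_lowerSemicontinuous_majorant {f : EuclideanSpace ℝ (Fin d) → ℂ}
    (hf : AEStronglyMeasurable f volume) {ε : ℝ≥0∞} (hε : ε ≠ 0) :
    ∃ (g : EuclideanSpace ℝ (Fin d) → ℝ≥0∞) (f' : EuclideanSpace ℝ (Fin d) → ℂ),
      LowerSemicontinuous g ∧ Measurable f' ∧ (∀ x, ‖f x‖ₑ ≤ g x) ∧ (∀ x, g x ≠ 0) ∧
      (∀ x, g x ≠ ∞ → f x = f' x) ∧ ∫⁻ x, g x ^ 2 ≤ (∫⁻ x, ‖f x‖ₑ ^ 2) + ε := by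
  have hε2 : ε / 2 ≠ 0 := (ENNReal.half_pos hε).ne'
  set f' := hf.mk f with hf'
  have hf'm : Measurable f' := hf.stronglyMeasurable_mk.measurable
  have hae : ∀ᵐ x, f x = f' x := hf.ae_eq_mk
  set N := toMeasurable volume {x | ¬ f x = f' x} with hN
  have hN0 : volume N = 0 := by rw [hN, measure_toMeasurable]; exact hae
  obtain ⟨w, hw0, hwm, hw⟩ := exists_pos_lintegral_lt_of_sigmaFinite
    (volume : Measure (EuclideanSpace ℝ (Fin d))) hε2
  -- The term `w` makes the majorant positive at arbitrarily small cost, and the infinite value on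
  -- the null set `N` costs nothing; a lower semicontinuous majorant of `u` with nearly the same
  -- integral is then taken, and its square root is `g`.
  set u : EuclideanSpace ℝ (Fin d) → ℝ≥0∞ := fun x => ‖f' x‖ₑ ^ 2 + w x + N.indicator (fun _ => ∞) x
    with hu
  have hum : Measurable u := ((hf'm.enorm.pow_const 2).add hwm.coe_nnreal_ennreal).add
    (measurable_const.indicator (measurableSet_toMeasurable _ _))
  have hint : ∫⁻ x, u x ≤ (∫⁻ x, ‖f x‖ₑ ^ 2) + ε / 2 := by
    rw [hu, lintegral_add_right _ (measurable_const.indicator (measurableSet_toMeasurable _ _)),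
      lintegral_indicator (measurableSet_toMeasurable _ _), setLIntegral_measure_zero _ _ hN0,
      add_zero, lintegral_add_right _ hwm.coe_nnreal_ennreal]
    refine add_le_add (le_of_eq ?_) hw.le
    exact lintegral_congr_ae (hae.mono fun x hx => by simp only [hx])
  obtain ⟨G, hG1, hG2, hG3⟩ := exists_le_lowerSemicontinuous_lintegral_ge
    (volume : Measure (EuclideanSpace ℝ (Fin d))) u hum hε2
  have hsq : ∀ a : ℝ≥0∞, (a ^ (1 / 2 : ℝ)) ^ 2 = a := fun a => by
    rw [← ENNReal.rpow_mul_natCast]; norm_num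
  have hsq' : ∀ a : ℝ≥0∞, (a ^ 2) ^ (1 / 2 : ℝ) = a := fun a => by
    rw [← ENNReal.rpow_natCast_mul]; norm_num
  have hmem : ∀ x, x ∉ N → f x = f' x := fun x hx => by
    by_contra h
    exact hx (subset_toMeasurable _ _ h)
  have htop : ∀ x, x ∈ N → G x = ∞ := fun x hx => by
    refine top_le_iff.1 (le_trans (top_le_iff.2 ?_) (hG1 x))
    simp [hu, hx]
  refine ⟨fun x => G x ^ (1 / 2 : ℝ), f', ?_, hf'm, fun x => ?_, fun x => ?_, fun x hx => ?_, ?_⟩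
  · exact ENNReal.continuous_rpow_const.comp_lowerSemicontinuous hG2
      (ENNReal.monotone_rpow_of_nonneg (by norm_num))
  · by_cases hx : x ∈ N
    · simp [htop x hx]
    · rw [hmem x hx, ← hsq' ‖f' x‖ₑ]
      refine ENNReal.rpow_le_rpow ?_ (by norm_num)
      exact (le_self_add.trans le_self_add).trans (hG1 x)
  · have h1 : (0 : ℝ≥0∞) < G x := by
      refine lt_of_lt_of_le (ENNReal.coe_pos.2 (hw0 x)) (le_trans ?_ (hG1 x))
      exact le_add_self.trans le_self_add
    exact (ENNReal.rpow_pos_of_nonneg h1 (by norm_num)).ne'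
  · refine hmem x fun hxN => hx ?_
    simp [htop x hxN]
  · simp_rw [hsq]
    refine (hG3.trans (add_le_add_left hint _)).trans (le_of_eq ?_)
    rw [add_assoc, ENNReal.add_halves]

end General

/-! ### Passage to general square integrable functions. -/

section Conclusion

open Filter Topology

variable {m d : ℕ}

/-- Absolute convergence of the averages for almost every point and all radii. -/
theorem ae_forall_integrable_prod_shift {σ : Measure (ProdSpace m d)} [IsFiniteMeasure σ]
    (hm : m ≠ 0) {C : ℝ≥0}
    (hC : ∀ f : Fin m → EuclideanSpace ℝ (Fin d) → ℂ, (∀ i, IsTestFunction (f i)) →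
      ∫⁻ x, (multMaximal σ f x ^ 2) ^ (m : ℝ)⁻¹ ≤
        C * ∏ i, (∫⁻ x, ‖f i x‖ₑ ^ 2) ^ (m : ℝ)⁻¹)
    {f : Fin m → EuclideanSpace ℝ (Fin d) → ℂ} (hf : ∀ i, AEStronglyMeasurable (f i) volume)
    (hf2 : ∀ i, ∫⁻ x, ‖f i x‖ₑ ^ 2 ≠ ∞) :
    ∀ᵐ x : EuclideanSpace ℝ (Fin d), ∀ t : ℝ, 0 < t →
      Integrable (fun y : ProdSpace m d => ∏ i, f i (x - t • y i)) σ := by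
  choose g f' hg hf' hfg hg0 hgf hgi using fun i =>
    exists_lowerSemicontinuous_majorant (hf i) one_ne_zero
  obtain ⟨H, hHm, hH, hHi⟩ := exists_majorant_of_lowerSemicontinuous hC hg
  have hm0 : (0 : ℝ) < (m : ℝ)⁻¹ := by positivity
  have hfin : ∫⁻ x, (H x ^ 2) ^ (m : ℝ)⁻¹ ≠ ∞ := by
    refine (hHi.trans_lt (ENNReal.mul_lt_top ENNReal.coe_lt_top
      (ENNReal.prod_lt_top fun i _ => ?_))).ne
    refine ENNReal.rpow_lt_top_of_nonneg hm0.le ((hgi i).trans_lt ?_).ne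
    exact ENNReal.add_lt_top.2 ⟨(hf2 i).lt_top, ENNReal.one_lt_top⟩
  filter_upwards [ae_lt_top ((hHm.pow_const 2).pow_const _) hfin] with x hx t ht
  have hHx : H x < ∞ := by
    rw [ENNReal.rpow_lt_top_iff_of_pos hm0] at hx
    exact (ENNReal.pow_lt_top_iff.1 hx).resolve_right two_ne_zero
  have hlt : ∫⁻ y, ∏ i, g i (x - t • y i) ∂σ < ∞ := (hH x t ht).trans_lt hHx
  have hgm : Measurable fun y : ProdSpace m d => ∏ i, g i (x - t • y i) :=
    Finset.measurable_prod _ fun i _ => (hg i).measurable.comp (by fun_prop)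
  refine ⟨?_, ?_⟩
  · have hm' : Measurable fun y : ProdSpace m d => ∏ i, f' i (x - t • y i) :=
      Finset.measurable_prod _ fun i _ => (hf' i).comp (by fun_prop)
    refine hm'.aestronglyMeasurable.congr ?_
    -- Where the product of the `g i` is finite, no factor is infinite, because the others are
    -- nonzero. There every `f i` agrees with `f' i`, which gives measurability with respect to `σ`
    -- even when `σ` is singular.
    filter_upwards [ae_lt_top hgm hlt.ne] with y hy
    refine Finset.prod_congr rfl fun i _ => (hgf i _ fun h => hy.ne ?_).symm
    rw [← Finset.mul_prod_erase _ _ (Finset.mem_univ i), h]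
    exact ENNReal.top_mul (Finset.prod_ne_zero_iff.2 fun j _ => hg0 j _)
  · refine lt_of_le_of_lt (lintegral_mono fun y => ?_) hlt
    rw [← ofReal_norm, norm_prod, ENNReal.ofReal_prod_of_nonneg fun i _ => norm_nonneg _]
    refine Finset.prod_le_prod' fun i _ => ?_
    rw [ofReal_norm]
    exact hfg i _

/-- The bound for general square integrable functions, in terms of integrals. -/
theorem lintegral_multMaximal_le {σ : Measure (ProdSpace m d)} [IsFiniteMeasure σ] {C : ℝ≥0}
    (hC : ∀ f : Fin m → EuclideanSpace ℝ (Fin d) → ℂ, (∀ i, IsTestFunction (f i)) →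
      ∫⁻ x, (multMaximal σ f x ^ 2) ^ (m : ℝ)⁻¹ ≤
        C * ∏ i, (∫⁻ x, ‖f i x‖ₑ ^ 2) ^ (m : ℝ)⁻¹)
    {f : Fin m → EuclideanSpace ℝ (Fin d) → ℂ} (hf : ∀ i, AEStronglyMeasurable (f i) volume)
    (hf2 : ∀ i, ∫⁻ x, ‖f i x‖ₑ ^ 2 ≠ ∞) :
    ∫⁻ x, (multMaximal σ f x ^ 2) ^ (m : ℝ)⁻¹ ≤
      C * ∏ i, (∫⁻ x, ‖f i x‖ₑ ^ 2) ^ (m : ℝ)⁻¹ := by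
  have hm0 : (0 : ℝ) ≤ (m : ℝ)⁻¹ := by positivity
  -- The majorants lose an arbitrary `ε` in the squared norms, removed at the end by letting `ε →
  -- 0`. Monotonicity of the lower Lebesgue integral makes measurability of `multMaximal σ f`
  -- unnecessary.
  have key : ∀ ε : ℝ≥0∞, ε ≠ 0 → ∫⁻ x, (multMaximal σ f x ^ 2) ^ (m : ℝ)⁻¹ ≤
      C * ∏ i, ((∫⁻ x, ‖f i x‖ₑ ^ 2) + ε) ^ (m : ℝ)⁻¹ := by
    intro ε hε
    choose g f' hg hf' hfg hg0 hgf hgi using fun i =>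
      exists_lowerSemicontinuous_majorant (hf i) hε
    obtain ⟨H, hHm, hH, hHi⟩ := exists_majorant_of_lowerSemicontinuous hC hg
    refine (lintegral_mono fun x => ?_).trans (hHi.trans ?_)
    · dsimp only
      gcongr
      refine iSup₂_le fun t ht => ?_
      refine (enorm_integral_le_lintegral_enorm _).trans (le_trans ?_ (hH x t ht))
      refine lintegral_mono fun y => ?_
      rw [← ofReal_norm, norm_prod, ENNReal.ofReal_prod_of_nonneg fun i _ => norm_nonneg _]
      refine Finset.prod_le_prod' fun i _ => ?_
      rw [ofReal_norm]
      exact hfg i _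
    · exact mul_le_mul_right (Finset.prod_le_prod' fun i _ => ENNReal.rpow_le_rpow (hgi i) hm0) _
  have hlim : Tendsto (fun n : ℕ => (C : ℝ≥0∞) *
      ∏ i, ((∫⁻ x, ‖f i x‖ₑ ^ 2) + (n : ℝ≥0∞)⁻¹) ^ (m : ℝ)⁻¹) atTop
      (𝓝 (C * ∏ i, (∫⁻ x, ‖f i x‖ₑ ^ 2) ^ (m : ℝ)⁻¹)) := by
    refine ENNReal.Tendsto.const_mul (ENNReal.tendsto_finsetProd_of_ne_top _ (fun i _ => ?_)
      fun i _ => ENNReal.rpow_ne_top_of_nonneg hm0 (hf2 i)) (Or.inr ENNReal.coe_ne_top)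
    have h1 : Tendsto (fun n : ℕ => (∫⁻ x, ‖f i x‖ₑ ^ 2) + (n : ℝ≥0∞)⁻¹) atTop
        (𝓝 ((∫⁻ x, ‖f i x‖ₑ ^ 2) + 0)) := ENNReal.tendsto_inv_nat_nhds_zero.const_add _
    rw [add_zero] at h1
    exact (ENNReal.continuous_rpow_const.tendsto _).comp h1
  exact ge_of_tendsto' hlim fun n => key _ (ENNReal.inv_ne_zero.2 (ENNReal.natCast_ne_top n))

end Conclusion

theorem theorem1p3 (m d : ℕ) (hm : 2 ≤ m) (hd : 1 ≤ d) (s : ℝ)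
    (hs : ((m : ℝ) - 1) * (d : ℝ) / 2 + 1 / 2 < s)
    (σ : Measure (ProdSpace m d)) [IsFiniteMeasure σ]
    (hsupp : σ (Metric.closedBall (0 : ProdSpace m d) 1)ᶜ = 0)
    (hdecay : HasFourierDecay σ s) :
    ∃ C : ℝ≥0, ∀ f : Fin m → EuclideanSpace ℝ (Fin d) → ℂ,
      (∀ i, MemLp (f i) 2 volume) →
        (∀ᵐ x : EuclideanSpace ℝ (Fin d), ∀ t : ℝ, 0 < t →
          Integrable (fun y : ProdSpace m d => ∏ i, f i (x - t • y i)) σ) ∧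
        eLpNorm (multMaximal σ f) (2 / (m : ℝ≥0∞)) volume
          ≤ (C : ℝ≥0∞) * ∏ i, eLpNorm (f i) 2 volume := by
  obtain ⟨C, hC⟩ := exists_lintegral_multMaximal_le hm hd hs σ hsupp hdecay
  have hm0 : (0 : ℝ) < m := by positivity
  have hm2 : (0 : ℝ) ≤ (m : ℝ) / 2 := by positivity
  have hL2 : ∀ h : EuclideanSpace ℝ (Fin d) → ℂ,
      eLpNorm h 2 volume = (∫⁻ x, ‖h x‖ₑ ^ 2) ^ (1 / 2 : ℝ) := fun h => by
    rw [eLpNorm_eq_lintegral_rpow_enorm_toReal two_ne_zero ENNReal.ofNat_ne_top]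
    simp
  -- The integral estimate bounds the `2/m`-th power of the quasi-norm, so it is raised to the power
  -- `m/2`; each factor `(∫ |f i|²)^(1/m)` then becomes the `L²` norm.
  refine ⟨C ^ ((m : ℝ) / 2), fun f hf => ?_⟩
  have hf2 : ∀ i, ∫⁻ x, ‖f i x‖ₑ ^ 2 ≠ ∞ := fun i h => by
    have := (hf i).2
    rw [hL2, h, ENNReal.top_rpow_of_pos (by norm_num)] at this
    exact this.ne rfl
  refine ⟨ae_forall_integrable_prod_shift (by omega) hC (fun i => (hf i).1) hf2, ?_⟩
  have hp0 : (2 / (m : ℝ≥0∞)) ≠ 0 :=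
    ENNReal.div_ne_zero.2 ⟨two_ne_zero, ENNReal.natCast_ne_top m⟩
  have hpt : (2 / (m : ℝ≥0∞)) ≠ ∞ :=
    ENNReal.div_ne_top ENNReal.ofNat_ne_top (by exact_mod_cast (by omega : m ≠ 0))
  have hpr : (2 / (m : ℝ≥0∞)).toReal = 2 / (m : ℝ) := by simp [ENNReal.toReal_div]
  rw [eLpNorm_eq_lintegral_rpow_enorm_toReal hp0 hpt, hpr, one_div_div]
  simp_rw [hL2]
  have e : ∀ a : ℝ≥0∞, ‖a‖ₑ ^ (2 / (m : ℝ)) = (a ^ 2) ^ (m : ℝ)⁻¹ := fun a => by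
    rw [enorm_eq_self, div_eq_mul_inv, ENNReal.rpow_mul, ENNReal.rpow_two]
  simp_rw [e]
  calc (∫⁻ x, (multMaximal σ f x ^ 2) ^ (m : ℝ)⁻¹) ^ ((m : ℝ) / 2)
      ≤ (C * ∏ i, (∫⁻ x, ‖f i x‖ₑ ^ 2) ^ (m : ℝ)⁻¹) ^ ((m : ℝ) / 2) := by
        gcongr
        exact lintegral_multMaximal_le hC (fun i => (hf i).1) hf2
    _ = _ := by
        rw [ENNReal.mul_rpow_of_nonneg _ _ hm2, ENNReal.coe_rpow_of_nonneg _ hm2,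
          ← ENNReal.prod_rpow_of_nonneg hm2]
        congr 1
        refine Finset.prod_congr rfl fun i _ => ?_
        rw [← ENNReal.rpow_mul]
        congr 1
        field_simp
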